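/- **Setting.** Let $\Omega\subset\mathbb R^2$ be a bounded simply connected polygonal domain, $T>0$, $k\in\mathbb N$. Let $\Omega_h$ be a conforming decomposition of $\Omega$ into finitely many triangles $E$ of diameter $h_E$ satisfying (M1): each $E$ is star shaped with respect to a ball of radius $\rho_E$ with $h_E\le c_{\rm M1}\rho_E$. Let $V_h\subset[H^1_0(\Omega)]^2$ and $Q_h\subset L^2_0(\Omega)$ be spaces of piecewise polynomials on $\Omega_h$ with $V_h\subset[\mathbb P_{k+3}(\Omega_h)]^2$ and $\operatorname{div}V_h=Q_h$, and let $Z_h=\{v\in V_h:\int_\Omega q\,\operatorname{div}v=0\ \forall q\in Q_h\}$. Let $N\in\mathbb N$, $\tau=T/(N+1)$, $t_n=n\tau$, $I_n=(t_n,t_{n+1})$ $(0\le n\le N)$, and let $Z_h^\tau=\mathbb P_1(I^\tau,Z_h)$ be the space of functions of time with values in $Z_h$ that are affine on each $I_n$; $v^n_+$ and $v^{n+1}_-$ are the one-sided limits of $v$ in $I_n$ at its left and right end, and $[\![v]\!]_{t_j}=v^j_+-v^j_-$. Let $\nu>0$, $f\in[L^2(\Omega\times(0,T))]^2$ with weak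 curl $\operatorname{curl}f\in L^2(0,T;L^2(\Omega))$, and $U_0\in V_h$. Norms and inner products without subscript are those of $L^2(\Omega)$; $\operatorname{curl}v=\partial_1v_2-\partial_2v_1$; $\epsilon(v)$ is the symmetric gradient; $[\![\cdot]\!]$ on $\partial E$ is the jump across the mesh edges, set to $0$ on edges contained in $\partial\Omega$. For each $E$ let $\gamma_E$ be the smallest positive constant with $\|p\|_{H^2(E)}\le\gamma_E h_E^{-2}\|p\|_{L^2(E)}$ for all $p\in\mathbb P_{k+2}(E)$, and let $\delta_E$ be parameters with $$0\le\delta_E\le\frac{h_E^4}{\nu\,\gamma_E^2}\qquad\text{for all }E\in\Omega_h .$$ Define, for $0\le n\le N$, $$\begin{aligned} \mathcal A_n(w_1,w_2;v,z)={}&\int_0^{t_{n+1}}(v_t,z)\,dt+\sum_{j=1}^n([\![v]\!]_{t_j},z^j_+)+(v^0_+,z^0_+)+\int_0^{t_{n+1}}\mathcal K(w_1,w_2;v,z)\,dt,\\ \mathcal K(w_1,w_2;v,z)={}&\nu\int_\Omega\epsilon(v):\epsilon(z)+\int_\Omega[(\nabla v)w_1]\cdot z\\ &+\sum_E\delta_E\int_E\operatorname{curl}\bigl(v_t+(\nabla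 v)w_1-\nu\,\mathbf{div}\,\epsilon(v)\bigr)\operatorname{curl}\bigl(z_t+(\nabla z)w_2\bigr)\\ &+\sum_E\frac{h_E^2}{2}\int_{\partial E}[\![(\nabla v)w_1]\!]\cdot[\![(\nabla z)w_2]\!],\\ \mathcal R_n(\sigma,w_2;z)={}&\int_0^{t_{n+1}}(f,z)\,dt+\int_0^{t_{n+1}}\sum_E\delta_E\int_E\operatorname{curl}f\,\operatorname{curl}\bigl(z_t+(\nabla z)w_2\bigr)\,dt+(\sigma,z^0_+),\\ \|v\|_{W,n}^2={}&\tfrac12\Bigl(\|v^{n+1}_-\|^2+\sum_{j=1}^n\|[\![v]\!]_{t_j}\|^2+\|v^0_+\|^2\Bigr)+\nu\|\epsilon(v)\|^2_{L^2(0,t_{n+1};L^2(\Omega))}\\ &+\sum_E\Bigl(\delta_E\|\operatorname{curl}(v_t+(\nabla v)W)\|^2_{L^2(0,t_{n+1};L^2(E))}+\tfrac{h_E^2}{2}\|[\![(\nabla v)W]\!]\|^2_{L^2(0,t_{n+1};L^2(\partial E))}\Bigr),\\ \mathrm{DATA}(n)={}&\|U_0\|^2+\|f\|^2_{L^2(0,t_{n+1};L^2(\Omega))}+\sum_E\delta_E\|\operatorname{curl}f\|^2_{L^2(0,t_{n+1};L^2(E))}.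 \end{aligned}$$ **Proposition (Well-posedness).** The discrete kernel problem: find $U\in Z_h^\tau$ with $$\mathcal A_N(U,U;U,V)=\mathcal R_N(U_0,U;V)\qquad\text{for all }V\in Z_h^\tau,$$ has at least one solution. Moreover there is a constant $C>0$, depending only on $\Omega$, $T$, $k$ and $c_{\rm M1}$ (and not on the mesh, the discrete spaces, $\tau$, $\nu$, the $\delta_E$, $f$ or $U_0$), such that every solution $U$ satisfies $$\|U\|_{U,n}^2\le C\,\mathrm{DATA}(n)\qquad(n=0,\dots,N).$$ -/

import Mathlib

open MeasureTheory Filter Topology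
open scoped ContDiff

namespace VortStab

noncomputable section

/-! ### Domains, weak derivatives, triangulations -/

/-- The Euclidean plane. -/
abbrev Plane := EuclideanSpace ℝ (Fin 2)

/-- A bounded, open, simply connected set whose boundary is a finite union of segments. -/
structure IsPolygonalDomain (Ω : Set Plane) : Prop where
  isOpen : IsOpen Ω
  isBounded : Bornology.IsBounded Ω
  isSimplyConnected : IsSimplyConnected Ω
  polygonal : ∃ S : Finset (Plane × Plane), frontier Ω = ⋃ p ∈ S, segment ℝ p.1 p.2

/-- The classical partial derivative `∂φ/∂x_i` of a function on the plane. -/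
def partialD (i : Fin 2) (φ : Plane → ℝ) (x : Plane) : ℝ :=
  fderiv ℝ φ x (EuclideanSpace.single i 1)

/-- Smooth functions with compact support in `Ω`. -/
def IsTestFunction (Ω : Set Plane) (φ : Plane → ℝ) : Prop :=
  ContDiff ℝ ∞ φ ∧ HasCompactSupport φ ∧ tsupport φ ⊆ Ω

/-- `v ∈ H¹₀(Ω)`: the closure of the test functions in `H¹(Ω)`. There are test functions `φₙ`
with `φₙ → v` and `∂ᵢφₙ → gᵢ` in `L²(Ω)`; then `g` is the weak gradient of `v`. -/
def MemH10 (Ω : Set Plane) (v : Plane → ℝ) : Prop :=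
  MemLp v 2 (volume.restrict Ω) ∧
  ∃ (φ : ℕ → Plane → ℝ) (g : Fin 2 → Plane → ℝ),
    (∀ n, IsTestFunction Ω (φ n)) ∧
    (∀ i, MemLp (g i) 2 (volume.restrict Ω)) ∧
    Tendsto (fun n => eLpNorm (φ n - v) 2 (volume.restrict Ω)) atTop (𝓝 0) ∧
    ∀ i, Tendsto (fun n => eLpNorm (partialD i (φ n) - g i) 2 (volume.restrict Ω)) atTop (𝓝 0)

/-- `κ` is the weak (distributional) curl `∂₁ w₂ - ∂₂ w₁` of the vector field `w` on `Ω`. -/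
def IsWeakCurl (Ω : Set Plane) (w : Plane → Plane) (κ : Plane → ℝ) : Prop :=
  ∀ φ : Plane → ℝ, IsTestFunction Ω φ →
    ∫ x in Ω, κ x * φ x = ∫ x in Ω, (w x 0 * partialD 1 φ x - w x 1 * partialD 0 φ x)

/-- A conforming decomposition of `Ω` into finitely many triangles, given as a simplicial
complex (so two triangles meet in a common vertex, in a common edge, or not at all). -/
structure Triangulation (Ω : Set Plane) extends Geometry.SimplicialComplex ℝ Plane where
  finite_faces : faces.Finite
  pure_two : ∀ s ∈ faces, ∃ t ∈ faces, s ⊆ t ∧ t.card = 3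
  space_eq : toSimplicialComplex.space = closure Ω
  interior_subset : ∀ s ∈ faces, s.card = 3 → interior (convexHull ℝ (s : Set Plane)) ⊆ Ω

namespace Triangulation

variable {Ω : Set Plane}

/-- The elements `E ∈ Ω_h` (triangles, given by their three vertices). -/
abbrev Cell (𝒯 : Triangulation Ω) : Type := {s : Finset Plane // s ∈ 𝒯.faces ∧ s.card = 3}

instance (𝒯 : Triangulation Ω) : Fintype 𝒯.Cell :=
  (𝒯.finite_faces.subset (fun _ hs => hs.1 : {s | s ∈ 𝒯.faces ∧ s.card = 3} ⊆ 𝒯.faces)).fintype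

/-- The closed triangle `E` as a subset of the plane. -/
def carrier {𝒯 : Triangulation Ω} (E : 𝒯.Cell) : Set Plane := convexHull ℝ (E.1 : Set Plane)

/-- The diameter `h_E`. -/
def diam {𝒯 : Triangulation Ω} (E : 𝒯.Cell) : ℝ := Metric.diam (carrier E)

/-- Shape regularity with constant `c`: each element is star shaped with respect to a ball of
radius `ρ_E`, and `h_E ≤ c ρ_E`. -/
def ShapeRegular (𝒯 : Triangulation Ω) (c : ℝ) : Prop :=
  ∀ E : 𝒯.Cell, ∃ (x : Plane) (ρ : ℝ), 0 < ρ ∧ Metric.ball x ρ ⊆ carrier E ∧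
    (∀ y ∈ Metric.ball x ρ, StarConvex ℝ y (carrier E)) ∧ diam E ≤ c * ρ

end Triangulation

open Triangulation

/-! ### Polynomials on one element -/

/-- Real polynomials in two variables. -/
abbrev Poly := MvPolynomial (Fin 2) ℝ

/-- Value of a polynomial at a point of the plane. -/
def pval (p : Poly) (x : Plane) : ℝ := MvPolynomial.eval (fun i => x i) p

/-- `∂p/∂x_i`. -/
def pd (i : Fin 2) (p : Poly) : Poly := MvPolynomial.pderiv i p

/-- `curl v = ∂₁ v₂ - ∂₂ v₁`. -/
def pcurl (v : Fin 2 → Poly) : Poly := pd 0 (v 1) - pd 1 (v 0)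

/-- `div v = ∂₁ v₁ + ∂₂ v₂`. -/
def pdiv (v : Fin 2 → Poly) : Poly := ∑ i, pd i (v i)

/-- `(∇v) w`, that is `((∇v) w)_i = ∑_j (∂_j v_i) w_j`. -/
def pconv (v w : Fin 2 → Poly) : Fin 2 → Poly := fun i => ∑ j, pd j (v i) * w j

/-- The symmetric gradient `ε(v)`. -/
def peps (v : Fin 2 → Poly) : Fin 2 → Fin 2 → Poly :=
  fun i j => MvPolynomial.C (1 / 2) * (pd j (v i) + pd i (v j))

/-- The (row-wise) divergence of a tensor field. -/
def pdivT (σ : Fin 2 → Fin 2 → Poly) : Fin 2 → Poly := fun i => ∑ j, pd j (σ i j)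

section Fields

variable {Ω : Set Plane} {𝒯 : Triangulation Ω}

/-- `‖p‖²_{L²(E)}`. -/
def l2Sq (E : 𝒯.Cell) (p : Poly) : ℝ := ∫ x in carrier E, pval p x ^ 2

/-- `‖p‖²_{H²(E)}`: the sum of `‖∂^α p‖²_{L²(E)}` over the multi-indices `|α| ≤ 2`. -/
def h2Sq (E : 𝒯.Cell) (p : Poly) : ℝ :=
  l2Sq E p + ∑ i, l2Sq E (pd i p) +
    (l2Sq E (pd 0 (pd 0 p)) + l2Sq E (pd 0 (pd 1 p)) + l2Sq E (pd 1 (pd 1 p)))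

/-- The constant `γ_E` of the inverse estimate on `E` for polynomials of degree `≤ m`: the
smallest positive `γ` with `‖p‖_{H²(E)} ≤ γ h_E⁻² ‖p‖_{L²(E)}` for all such `p`. -/
def gammaE (m : ℕ) (E : 𝒯.Cell) : ℝ :=
  sInf {γ : ℝ | 0 < γ ∧ ∀ p : Poly, p.totalDegree ≤ m →
    √(h2Sq E p) ≤ γ * (diam E ^ 2)⁻¹ * √(l2Sq E p)}

/-! ### Piecewise polynomial fields -/

/-- Piecewise polynomial scalar functions: one polynomial on each element. -/
abbrev SField (𝒯 : Triangulation Ω) := 𝒯.Cell → Poly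

/-- Piecewise polynomial vector fields: two polynomials on each element. -/
abbrev VField (𝒯 : Triangulation Ω) := 𝒯.Cell → Fin 2 → Poly

open Classical in
/-- The function on the plane given by a piecewise polynomial (it is set to `0` outside the open
triangles, which within `Ω` is a null set). -/
def realize (q : SField 𝒯) (x : Plane) : ℝ :=
  ∑ E : 𝒯.Cell, if x ∈ interior (carrier E) then pval (q E) x else 0

/-- The elementwise divergence as a linear map. -/
def divh (𝒯 : Triangulation Ω) : VField 𝒯 →ₗ[ℝ] SField 𝒯 where
  toFun v := fun E => pdiv (v E)
  map_add' u v := by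
    funext E; simp [pdiv, pd, Finset.sum_add_distrib]
  map_smul' c v := by
    funext E; simp [pdiv, pd]

/-- The `L²(Ω)` inner product `(u, v)` of piecewise polynomial vector fields. -/
def inner2 (u v : VField 𝒯) : ℝ :=
  ∑ E : 𝒯.Cell, ∫ x in carrier E, ∑ i, pval (u E i) x * pval (v E i) x

/-- `a(u, v) = ∫_Ω ε(u) : ε(v)`. -/
def aForm (u v : VField 𝒯) : ℝ :=
  ∑ E : 𝒯.Cell, ∫ x in carrier E, ∑ i, ∑ j, pval (peps (u E) i j) x * pval (peps (v E) i j) x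

/-- `b(v, q) = ∫_Ω q div v`. -/
def bForm (v : VField 𝒯) (q : SField 𝒯) : ℝ :=
  ∑ E : 𝒯.Cell, ∫ x in carrier E, pval (q E) x * pval (pdiv (v E)) x

/-- `c(w; u, v) = ∫_Ω [(∇u) w] · v`. -/
def cForm (w u v : VField 𝒯) : ℝ :=
  ∑ E : 𝒯.Cell, ∫ x in carrier E, ∑ i, pval (pconv (u E) (w E) i) x * pval (v E i) x

/-- A pair of conforming finite element spaces `V_h ⊂ [H¹₀(Ω)]²`, `Q_h ⊂ L²₀(Ω)` of piecewise
polynomials, with velocities of degree at most `k + 3` and `div V_h = Q_h`. -/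
structure FEPair (𝒯 : Triangulation Ω) (k : ℕ) where
  /-- discrete velocities -/
  V : Submodule ℝ (VField 𝒯)
  /-- discrete pressures -/
  Q : Submodule ℝ (SField 𝒯)
  degree_le : ∀ v ∈ V, ∀ E i, (v E i).totalDegree ≤ k + 3
  conforming : ∀ v ∈ V, ∀ i, MemH10 Ω (realize fun E => v E i)
  mean_zero : ∀ q ∈ Q, ∑ E : 𝒯.Cell, ∫ x in carrier E, pval (q E) x = 0
  div_range : V.map (divh 𝒯) = Q

/-- The discrete kernel `Z_h = {v ∈ V_h : b(v, q) = 0 for all q ∈ Q_h}`. -/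
def FEPair.Z {k : ℕ} (S : FEPair 𝒯 k) : Set (VField 𝒯) :=
  {v | v ∈ S.V ∧ ∀ q ∈ S.Q, bForm v q = 0}

/-! ### Piecewise affine functions of time

The interval `(0, T)` is cut into the slabs `I_n = (t_n, t_{n+1})`, `n = 0, …, N`, `t_n = n τ`.
-/

/-- Piecewise affine functions of time with values in `M`: the pair `U n = (a, b)` stands for
`t ↦ a + (t - t_n) b` on `I_n`. -/
abbrev DG (N : ℕ) (M : Type*) := Fin (N + 1) → M × M

variable {N : ℕ}

/-- The value at time `t ∈ I_n`. -/
def tval (τ : ℝ) (U : DG N (VField 𝒯)) (n : Fin (N + 1)) (t : ℝ) : VField 𝒯 :=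
  (U n).1 + (t - (n : ℕ) * τ) • (U n).2

/-- The time derivative on `I_n`. -/
def tder (U : DG N (VField 𝒯)) (n : Fin (N + 1)) : VField 𝒯 := (U n).2

/-- The trace from the right, `U_+^n = lim_{s → 0+} U(t_n + s)`. -/
def plus (U : DG N (VField 𝒯)) (n : Fin (N + 1)) : VField 𝒯 := (U n).1

/-- The trace from the left at the end of `I_n`, `U_-^{n+1} = lim_{s → 0+} U(t_{n+1} - s)`. -/
def minusNext (τ : ℝ) (U : DG N (VField 𝒯)) (n : Fin (N + 1)) : VField 𝒯 :=
  (U n).1 + τ • (U n).2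

/-- The time jump `U_+^{j+1} - U_-^{j+1}` at `t_{j+1}`, for `j + 1 = 1, …, N`. -/
def tjump (τ : ℝ) (U : DG N (VField 𝒯)) (j : Fin N) : VField 𝒯 :=
  plus U j.succ - minusNext τ U j.castSucc

/-- `∫_0^{t_{n+1}} g dt`, where `g j` is the integrand on the slab `I_j`. -/
def timeInt (τ : ℝ) (n : Fin (N + 1)) (g : Fin (N + 1) → ℝ → ℝ) : ℝ :=
  ∑ j ∈ Finset.Iic n, ∫ t in ((j : ℕ) * τ)..(((j : ℕ) + 1) * τ), g j t

/-- `Z_h^τ = P₁(I^τ, Z_h)`. -/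
def FEPair.Zτ {k : ℕ} (S : FEPair 𝒯 k) (N : ℕ) : Set (DG N (VField 𝒯)) :=
  {U | ∀ n, (U n).1 ∈ S.Z ∧ (U n).2 ∈ S.Z}

/-! ### Stabilizing forms -/

/-- Elementwise `v_t + (∇v) w`; the time derivative `vt` is a separate argument. -/
def material (vt v w : VField 𝒯) (E : 𝒯.Cell) : Fin 2 → Poly := vt E + pconv (v E) (w E)

/-- The stabilizing form `∑_E δ_E ∫_E curl(u_t + (∇u) w₁) curl(v_t + (∇v) w₂)`. -/
def CForm (δ : 𝒯.Cell → ℝ) (w₁ w₂ ut u vt v : VField 𝒯) : ℝ :=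
  ∑ E : 𝒯.Cell, δ E * ∫ x in carrier E,
    pval (pcurl (material ut u w₁ E)) x * pval (pcurl (material vt v w₂ E)) x

/-- The stabilizing form `∑_E δ_E ∫_E curl(-ν div ε(u)) curl(v_t + (∇v) w₂)`. -/
def LForm (ν : ℝ) (δ : 𝒯.Cell → ℝ) (w₂ u vt v : VField 𝒯) : ℝ :=
  ∑ E : 𝒯.Cell, δ E * ∫ x in carrier E,
    (-ν * pval (pcurl (pdivT (peps (u E)))) x) * pval (pcurl (material vt v w₂ E)) x

open Classical in
/-- The `i`-th component of the jump of `w` across the edge `e` of `E`, at `x ∈ e`: the trace from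
`E` minus the trace from the neighbour of `E` across `e`, and `0` if `e ⊂ ∂Ω`. (Jumps enter only in
products of two, so the orientation of the normal to `e` is immaterial.) -/
def edgeJump (w : VField 𝒯) (E : 𝒯.Cell) (e : Finset Plane) (x : Plane) (i : Fin 2) : ℝ :=
  if convexHull ℝ (e : Set Plane) ⊆ frontier Ω then 0
  else ∑ E' : 𝒯.Cell with e ⊆ E'.1 ∧ E' ≠ E, (pval (w E i) x - pval (w E' i) x)

/-- `∫_{∂E} ⟦w⟧ · ⟦z⟧ de`, the sum of the integrals over the three edges with respect to length
(one-dimensional Hausdorff measure). -/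
def bdryJumps (w z : VField 𝒯) (E : 𝒯.Cell) : ℝ :=
  ∑ e ∈ E.1.powersetCard 2, ∫ x in convexHull ℝ (e : Set Plane),
    (∑ i, edgeJump w E e x i * edgeJump z E e x i) ∂(Measure.hausdorffMeasure 1)

/-- The field `(∇v) w`, elementwise. -/
def convField (v w : VField 𝒯) : VField 𝒯 := fun E => pconv (v E) (w E)

/-- The stabilizing form `∑_E (h_E²/2) ∫_{∂E} ⟦(∇u) w₁⟧ · ⟦(∇v) w₂⟧ de`. -/
def JForm (w₁ w₂ u v : VField 𝒯) : ℝ :=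
  ∑ E : 𝒯.Cell, diam E ^ 2 / 2 * bdryJumps (convField u w₁) (convField v w₂) E

/-- `K_stab(w₁, w₂; u, v)`. -/
def KForm (ν : ℝ) (δ : 𝒯.Cell → ℝ) (w₁ w₂ ut u vt v : VField 𝒯) : ℝ :=
  ν * aForm u v + cForm w₁ u v + CForm δ w₁ w₂ ut u vt v + LForm ν δ w₂ u vt v + JForm w₁ w₂ u v

/-- The stabilizing right-hand side `∑_E δ_E ∫_E (curl f) curl(v_t + (∇v) w₂)`; `κ` is `curl f` at
the given time. -/
def FForm (δ : 𝒯.Cell → ℝ) (κ : Plane → ℝ) (w₂ vt v : VField 𝒯) : ℝ :=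
  ∑ E : 𝒯.Cell, δ E * ∫ x in carrier E, κ x * pval (pcurl (material vt v w₂ E)) x

/-- `(f, v) = ∫_Ω f · v` for a load `f` and a piecewise polynomial field `v`. -/
def loadForm (f : Plane → Plane) (v : VField 𝒯) : ℝ :=
  ∫ x in Ω, ∑ i, f x i * realize (fun E => v E i) x

/-! ### The discrete kernel problem, the norm and the data term -/

/-- `A_{stab,n}(w₁, w₂; v, z)`. -/
def AStab (ν τ : ℝ) (δ : 𝒯.Cell → ℝ) (n : Fin (N + 1)) (w₁ w₂ v z : DG N (VField 𝒯)) : ℝ :=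
  timeInt τ n (fun j t => inner2 (tder v j) (tval τ z j t)) +
  ∑ j : Fin N with j.succ ≤ n, inner2 (tjump τ v j) (plus z j.succ) +
  inner2 (plus v 0) (plus z 0) +
  timeInt τ n (fun j t => KForm ν δ (tval τ w₁ j t) (tval τ w₂ j t)
    (tder v j) (tval τ v j t) (tder z j) (tval τ z j t))

/-- `R_{stab,n}(σ, w₂; z)`; `f t` and `κ t` are the load and its curl at time `t`. -/
def RStab (τ : ℝ) (δ : 𝒯.Cell → ℝ) (f : ℝ → Plane → Plane) (κ : ℝ → Plane → ℝ)
    (n : Fin (N + 1)) (σ : VField 𝒯) (w₂ z : DG N (VField 𝒯)) : ℝ :=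
  timeInt τ n (fun j t => loadForm (f t) (tval τ z j t)) +
  timeInt τ n (fun j t => FForm δ (κ t) (tval τ w₂ j t) (tder z j) (tval τ z j t)) +
  inner2 σ (plus z 0)

/-- `U` solves the discrete kernel problem: `U ∈ Z_h^τ` and
`A_{stab,N}(U, U; U, V) = R_{stab,N}(U₀, U; V)` for all `V ∈ Z_h^τ`. -/
def IsSolution {k : ℕ} (S : FEPair 𝒯 k) (ν τ : ℝ) (δ : 𝒯.Cell → ℝ) (f : ℝ → Plane → Plane)
    (κ : ℝ → Plane → ℝ) (U₀ : VField 𝒯) (U : DG N (VField 𝒯)) : Prop :=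
  U ∈ S.Zτ N ∧ ∀ V ∈ S.Zτ N,
    AStab ν τ δ (Fin.last N) U U U V = RStab τ δ f κ (Fin.last N) U₀ U V

/-- The squared norm `‖v‖²_{W,n}`. -/
def normSq (ν τ : ℝ) (δ : 𝒯.Cell → ℝ) (n : Fin (N + 1)) (W v : DG N (VField 𝒯)) : ℝ :=
  1 / 2 * (inner2 (minusNext τ v n) (minusNext τ v n) +
    ∑ j : Fin N with j.succ ≤ n, inner2 (tjump τ v j) (tjump τ v j) +
    inner2 (plus v 0) (plus v 0)) +
  ν * timeInt τ n (fun j t => aForm (tval τ v j t) (tval τ v j t)) +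
  ∑ E : 𝒯.Cell, δ E * timeInt τ n (fun j t =>
    l2Sq E (pcurl (material (tder v j) (tval τ v j t) (tval τ W j t) E))) +
  ∑ E : 𝒯.Cell, diam E ^ 2 / 2 * timeInt τ n (fun j t =>
    bdryJumps (convField (tval τ v j t) (tval τ W j t))
      (convField (tval τ v j t) (tval τ W j t)) E)

/-- `DATA(n) = ‖U₀‖² + ‖f‖²_{L²(0,t_{n+1};L²(Ω))} + ∑_E δ_E ‖curl f‖²_{L²(0,t_{n+1};L²(E))}`. -/
def dataTerm (τ : ℝ) (δ : 𝒯.Cell → ℝ) (f : ℝ → Plane → Plane) (κ : ℝ → Plane → ℝ)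
    (U₀ : VField 𝒯) (n : Fin (N + 1)) : ℝ :=
  inner2 U₀ U₀ + (∫ t in (0 : ℝ)..(((n : ℕ) + 1) * τ), ∫ x in Ω, ‖f t x‖ ^ 2) +
  ∑ E : 𝒯.Cell, δ E * ∫ t in (0 : ℝ)..(((n : ℕ) + 1) * τ), ∫ x in carrier E, κ t x ^ 2

end Fields

end

end VortStab

/-! The discrete problem is a nonlinear equation on the finite-dimensional space Z_h^τ. One energy
inequality gives both claims: the a priori bound directly, and existence through a Brouwer-type
theorem for outward-pointing maps. Write E_n for ‖U‖²_{U,n}.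

Coercivity. Because div V_h = Q_h, members of Z_h are exactly divergence-free on each element, so
the convection term vanishes on the diagonal (`cForm_self_eq_zero`). The only remaining term without
a sign is the viscous part of the curl stabilization. The bound on δ_E, fed into the inverse
estimate, dominates it by 7/8 of the curl term and 6/7 of the viscous term (`le_LForm_self`). The
upwind time jumps telescope to the trace part of the norm (`energy_identity`). Hence A_n(U,U;U,U) ≥
E_n/8 (`le_AStab_self`).

The load. Young's inequality leaves a multiple of ∫‖U‖², which E_n does not control uniformly in ν,
since it contains only some of the time traces. All the energies up to level n together do control
every trace, and on each slab ‖U(t)‖² is bounded by its two end traces; so ∫‖U‖² ≤ 10τ ∑_{j≤n} E_j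
(`timeInt_inner2_le`). With the weight 1/(320T) this becomes (32(N+1))⁻¹ ∑_{j≤n} E_j, at most 1/32
of the largest energy. A solution may be tested with itself cut off after any slab
(`residual_trunc`); cutting off at the level of largest energy lets this term be absorbed, with no
Gronwall argument and no restriction on τ (`normSq_le_of_isSolution`).

Existence. The level of largest energy depends on U and cannot be used to define a map. Instead the
residual is tested with the sum of all truncations of V. On the diagonal this gives at least (∑_n
E_n)/32 minus a constant, which is coercive, and V ↦ ∑_n trunc n V merely rescales each slab by a
positive integer, so no test function is lost (`exists_isSolution`). The zero then comes from
`exists_zero_of_inner_pos`, which rests on the absence of a C¹ retraction of a ball onto its sphere.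
Continuous differentiability of the residual is obtained by writing it as finite sums of products
c(x)q(t)m (`Sep`). -/

namespace VortStab

noncomputable section

open Triangulation

/-! ### Zeros of coercive maps -/

section Zeros

variable {E : Type*} [NormedAddCommGroup E] [InnerProductSpace ℝ E] [FiniteDimensional ℝ E]

/-- `det (1 + A)` is an affine combination of the values of `t ↦ det (1 + t A)` at small nodes. -/
lemma exists_det_nodes (E : Type*) [NormedAddCommGroup E] [InnerProductSpace ℝ E]
    [FiniteDimensional ℝ E] {t₀ : ℝ} (ht₀ : 0 < t₀) :
    ∃ (m : ℕ) (s w : Fin m → ℝ), (∀ i, 0 ≤ s i ∧ s i ≤ t₀) ∧ ∑ i, w i = 1 ∧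
      ∀ A : E →L[ℝ] E, (1 + A).det = ∑ i, w i * (1 + s i • A).det := by
  classical
  set d := Module.finrank ℝ E
  let s : Fin (d + 1) → ℝ := fun i => t₀ * ((i : ℕ) / (d + 1))
  have hs : Set.InjOn s (Finset.univ : Finset (Fin (d + 1))) := by
    intro i _ j _ hij
    have h1 : (0 : ℝ) < d + 1 := by positivity
    have h2 : ((i : ℕ) : ℝ) = (j : ℕ) := by
      have := mul_left_cancel₀ ht₀.ne' hij
      field_simp at this
      exact this
    exact Fin.ext (by exact_mod_cast h2)
  -- Lagrange interpolation at d + 1 distinct nodes is exact in degree d, so values at small nodes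
  -- determine the value at 1. The choice p = 1 below gives the sum of the weights.
  have key : ∀ p : Polynomial ℝ, p.natDegree ≤ d →
      p.eval 1 = ∑ i, (Lagrange.basis Finset.univ s i).eval 1 * p.eval (s i) := by
    intro p hp
    have hdeg : p.degree < (Finset.univ : Finset (Fin (d + 1))).card := by
      rw [Finset.card_univ, Fintype.card_fin]
      exact lt_of_le_of_lt (Polynomial.degree_le_of_natDegree_le hp) (by exact_mod_cast Nat.lt_succ_self d)
    have h := Lagrange.eq_interpolate hs hdeg
    conv_lhs => rw [h]
    rw [Lagrange.interpolate_apply, Polynomial.eval_finsetSum]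
    refine Finset.sum_congr rfl fun i _ => ?_
    rw [Polynomial.eval_mul, Polynomial.eval_C, mul_comm]
  refine ⟨d + 1, s, fun i => (Lagrange.basis Finset.univ s i).eval 1, fun i => ⟨by positivity, ?_⟩,
    ?_, fun A => ?_⟩
  · have h1 : ((i : ℕ) : ℝ) / (d + 1) ≤ 1 := by
      rw [div_le_one (by positivity)]
      have := i.2
      exact_mod_cast this.le
    calc s i ≤ t₀ * 1 := mul_le_mul_of_nonneg_left h1 ht₀.le
      _ = t₀ := mul_one _
  · have := key 1 (by simp)
    simpa using this.symm
  · let b := Module.finBasis ℝ E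
    let M : Matrix (Fin d) (Fin d) ℝ := LinearMap.toMatrix b b (A : E →ₗ[ℝ] E)
    have hdet : ∀ t : ℝ, (1 + t • A).det = (Matrix.det ((Polynomial.X : Polynomial ℝ) • M.map Polynomial.C +
        (1 : Matrix (Fin d) (Fin d) ℝ).map Polynomial.C)).eval t := by
      intro t
      rw [← Polynomial.coe_evalRingHom, RingHom.map_det, ContinuousLinearMap.det,
        ← LinearMap.det_toMatrix b]
      congr 1
      ext i j
      rcases eq_or_ne i j with rfl | hij
      · simp [M, LinearMap.toMatrix_apply]
        ring
      · simp [M, LinearMap.toMatrix_apply, hij]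
        ring
    have h1 := key _ ((Polynomial.natDegree_det_X_add_C_le M 1).trans_eq (Fintype.card_fin d))
    rw [← hdet] at h1
    simp only [← hdet] at h1
    simpa using h1

/-- Along the segment from 1 to 1 + B every operator is invertible by the Neumann series, so the
determinant cannot change sign from its initial value 1. -/
lemma det_one_add_pos {B : E →L[ℝ] E} (hB : ‖B‖ < 1) : 0 < (1 + B).det := by
  have hunit : ∀ s ∈ Set.Icc (0 : ℝ) 1, (1 + s • B).det ≠ 0 := by
    intro s hs h0
    have hn : ‖-(s • B)‖ < 1 := by
      rw [norm_neg, norm_smul, Real.norm_of_nonneg hs.1]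
      exact lt_of_le_of_lt (mul_le_of_le_one_left (norm_nonneg _) hs.2) hB
    have hu := isUnit_one_sub_of_norm_lt_one hn
    rw [sub_neg_eq_add] at hu
    have hu' := hu.map (ContinuousLinearMap.toLinearMapRingHom : (E →L[ℝ] E) →+* (E →ₗ[ℝ] E))
    exact (((LinearMap.isUnit_iff_isUnit_det _).1 hu').ne_zero) h0
  have hcont : ContinuousOn (fun s : ℝ => (1 + s • B).det) (Set.Icc 0 1) :=
    (ContinuousLinearMap.continuous_det.comp
      (continuous_const.add (continuous_id.smul continuous_const))).continuousOn
  by_contra hneg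
  have h1 : (1 + (1 : ℝ) • B).det ≤ 0 := by simpa using hneg
  have h0 : (1 + (0 : ℝ) • B).det = 1 := by
    simp [ContinuousLinearMap.det]
  obtain ⟨s, hs, hs0⟩ := intermediate_value_Icc' zero_le_one hcont
    (show (0 : ℝ) ∈ Set.Icc _ _ from ⟨h1, by rw [h0]; exact zero_le_one⟩)
  exact hunit s hs hs0

variable [MeasurableSpace E] [BorelSpace E]

/-- There is no continuously differentiable retraction of a ball onto its boundary. -/
theorem not_exists_retraction {r : E → E} (hr : ContDiff ℝ 1 r) {R : ℝ} (hR : 0 < R)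
    (hnorm : ∀ x, ‖r x‖ = R) (hfix : ∀ x, ‖x‖ = R → r x = x) : False := by
  classical
  set B : Set E := Metric.closedBall 0 R
  have hBc : IsCompact B := isCompact_closedBall 0 R
  let g : E → E := fun x => r x - x
  have hg : ContDiff ℝ 1 g := hr.sub contDiff_id
  -- Extending the displacement r - id by zero makes x + t G(x) a globally defined perturbation of
  -- the identity. The extension is still Lipschitz because the displacement vanishes on the sphere.
  let G : E → E := B.indicator g
  let A : E → E →L[ℝ] E := fun x => fderiv ℝ r x - 1
  have hAc : Continuous A := (hr.continuous_fderiv (by norm_num)).sub continuous_const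
  obtain ⟨M, hM⟩ := hBc.exists_bound_of_continuousOn hAc.continuousOn
  obtain ⟨K, hK⟩ := (hg.contDiffOn (s := B)).exists_lipschitzOnWith (by norm_num)
    (convex_closedBall 0 R) hBc
  have hgb : ∀ x, ‖x‖ = R → g x = 0 := fun x hx => by simp [g, hfix x hx]
  have hGin : ∀ x ∈ B, G x = g x := fun x hx => Set.indicator_of_mem hx g
  have hGout : ∀ x ∉ B, G x = 0 := fun x hx => Set.indicator_of_notMem hx g
  have hmix : ∀ x ∈ B, ∀ y ∉ B, dist (G x) (G y) ≤ K * dist x y := by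
    intro x hx y hy
    have hx' : ‖x‖ ≤ R := by simpa [B] using hx
    have hy' : R ≤ ‖y‖ := by
      have : ¬ ‖y‖ ≤ R := by simpa [B] using hy
      linarith
    -- The segment from inside to outside crosses the sphere at a point where the displacement is
    -- zero; comparing with that point costs no more than the whole segment.
    obtain ⟨s, hs, hsR⟩ := intermediate_value_Icc (zero_le_one (α := ℝ))
      (f := fun s : ℝ => ‖AffineMap.lineMap x y s‖)
      (continuous_norm.comp AffineMap.lineMap_continuous).continuousOn
      (show R ∈ Set.Icc _ _ from ⟨by simpa using hx', by simpa using hy'⟩)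
    set z := AffineMap.lineMap x y s
    have hz : z ∈ B := by simpa [B] using hsR.le
    rw [hGout y hy, hGin x hx, ← hgb z hsR]
    refine (hK.dist_le_mul x hx z hz).trans (mul_le_mul_of_nonneg_left ?_ K.2)
    rw [dist_left_lineMap, Real.norm_of_nonneg hs.1]
    exact mul_le_of_le_one_left dist_nonneg hs.2
  have hGlip : LipschitzWith K G := by
    refine LipschitzWith.of_dist_le_mul fun x y => ?_
    by_cases hx : x ∈ B <;> by_cases hy : y ∈ B
    · rw [hGin x hx, hGin y hy]; exact hK.dist_le_mul x hx y hy
    · exact hmix x hx y hy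
    · rw [dist_comm, dist_comm x]; exact hmix y hy x hx
    · rw [hGout x hx, hGout y hy, dist_self]; positivity
  -- For small t the perturbed identity is a bijection of the space that fixes the complement of the
  -- ball, hence maps the ball onto itself. The change of variables, with a positive Jacobian, then
  -- computes the volume of the ball.
  have hvol : ∀ t : ℝ, 0 ≤ t → t * K < 1 → t * M < 1 →
      ∫ x in B, (1 + t • A x).det = (volume B).toReal := by
    intro t ht htK htM
    let h : E → E := fun x => x + t • G x
    have happ : ApproximatesLinearOn h ((ContinuousLinearEquiv.refl ℝ E : E ≃L[ℝ] E) : E →L[ℝ] E)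
        Set.univ (t.toNNReal * K) := by
      rw [ApproximatesLinearOn.approximatesLinearOn_iff_lipschitzOnWith, lipschitzOnWith_univ]
      have : h - ⇑((ContinuousLinearEquiv.refl ℝ E : E ≃L[ℝ] E) : E →L[ℝ] E) =
          fun x => t • G x := by
        funext x; simp [h]
      rw [this]
      refine LipschitzWith.of_dist_le_mul fun x y => ?_
      rw [dist_smul₀, Real.norm_of_nonneg ht]
      rw [NNReal.coe_mul, Real.coe_toNNReal t ht, mul_assoc]
      exact mul_le_mul_of_nonneg_left (hGlip.dist_le_mul x y) ht
    have hc : Subsingleton E ∨ (t.toNNReal * K : NNReal) <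
        ‖((ContinuousLinearEquiv.refl ℝ E).symm : E →L[ℝ] E)‖₊⁻¹ := by
      rcases subsingleton_or_nontrivial E with hE | hE
      · exact Or.inl hE
      · right
        have : ‖((ContinuousLinearEquiv.refl ℝ E).symm : E →L[ℝ] E)‖₊ = 1 := by
          ext; exact ContinuousLinearMap.norm_id
        rw [this, inv_one, ← NNReal.coe_lt_coe, NNReal.coe_mul, Real.coe_toNNReal t ht]
        exact htK
    have hsurj : Function.Surjective h := happ.surjective hc
    have hinj : Function.Injective h := fun x y hxy =>
      congrArg Subtype.val (happ.injective hc (a₁ := ⟨x, trivial⟩) (a₂ := ⟨y, trivial⟩) hxy)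
    have hout : ∀ x ∉ B, h x = x := fun x hx => by simp [h, hGout x hx]
    have himg : h '' B = B := by
      apply Set.Subset.antisymm
      · rintro _ ⟨x, hx, rfl⟩
        by_contra hn
        exact hn (by rw [hinj (hout _ hn)]; exact hx)
      · intro y hy
        obtain ⟨x, rfl⟩ := hsurj y
        by_cases hx : x ∈ B
        · exact ⟨x, hx, rfl⟩
        · rw [hout x hx] at hy; exact absurd hy hx
    have hder : ∀ x ∈ B, HasFDerivWithinAt h (1 + t • A x) B x := by
      intro x hx
      have h1 : HasFDerivAt (fun y => y + t • g y) (1 + t • A x) x := by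
        have hrx : HasFDerivAt r (fderiv ℝ r x) x :=
          (hr.differentiable (by norm_num) x).hasFDerivAt
        exact (hasFDerivAt_id x).add ((hrx.sub (hasFDerivAt_id x)).const_smul t)
      refine h1.hasFDerivWithinAt.congr (fun y hy => ?_) ?_
      · simp [h, hGin y hy]
      · simp [h, hGin x hx]
    have hpos : ∀ x ∈ B, 0 < (1 + t • A x).det := by
      intro x hx
      apply det_one_add_pos
      rw [norm_smul, Real.norm_of_nonneg ht]
      exact lt_of_le_of_lt (mul_le_mul_of_nonneg_left (hM x hx) ht) htM
    have hcv := integral_image_eq_integral_abs_det_fderiv_smul volume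
      (Metric.isClosed_closedBall.measurableSet : MeasurableSet B) hder hinj.injOn
      (fun _ => (1 : ℝ))
    rw [himg] at hcv
    have : ∫ x in B, (1 + t • A x).det = ∫ x in B, |(1 + t • A x).det| • (1 : ℝ) := by
      refine setIntegral_congr_fun Metric.isClosed_closedBall.measurableSet fun x hx => ?_
      simp [abs_of_pos (hpos x hx)]
    rw [this, ← hcv]
    simp [Measure.real]
  set t₀ : ℝ := 1 / (K + |M| + 1)
  have hden : (0 : ℝ) < K + |M| + 1 := by positivity
  have ht₀ : 0 < t₀ := by positivity
  obtain ⟨m, s, w, hs, hw, hdet⟩ := exists_det_nodes E ht₀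
  have hsmall : ∀ i, s i * K < 1 ∧ s i * M < 1 := by
    intro i
    have h1 : s i * (K + |M| + 1) ≤ 1 := by
      have := (hs i).2
      rwa [le_div_iff₀ hden] at this
    have h2 := (hs i).1
    have h3 := le_abs_self M
    have h4 : (0 : ℝ) ≤ K := K.2
    rcases h2.eq_or_lt with h5 | h5
    · rw [← h5]; simp
    · constructor
      · nlinarith [abs_nonneg M]
      · nlinarith
  -- At t = 1 the map is r itself. Since ‖r‖ is constant, the range of its derivative is orthogonal
  -- to the nonzero vector r(x), so the derivative is not onto.
  have hsing : ∀ x, (1 + A x).det = 0 := by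
    intro x
    have hrx : HasFDerivAt r (fderiv ℝ r x) x :=
      (hr.differentiable (by norm_num) x).hasFDerivAt
    have hinner : ∀ v, inner ℝ (r x) (fderiv ℝ r x v) = 0 := by
      intro v
      have h1 := hrx.inner ℝ hrx
      have h2 : (fun y => inner ℝ (r y) (r y)) = fun _ => R ^ 2 := by
        funext y; rw [real_inner_self_eq_norm_sq, hnorm]
      rw [h2] at h1
      have h3 := congrArg (fun L => L v) (h1.unique (hasFDerivAt_const (R ^ 2) x))
      simp only [ContinuousLinearMap.comp_apply, ContinuousLinearMap.prod_apply,
        fderivInnerCLM_apply, zero_apply] at h3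
      rw [real_inner_comm (r x) (fderiv ℝ r x v)] at h3
      linarith
    have h1 : 1 + A x = fderiv ℝ r x := by simp [A]
    rw [h1]
    by_contra hne
    have hu : IsUnit (LinearMap.det (fderiv ℝ r x : E →ₗ[ℝ] E)) := isUnit_iff_ne_zero.2 hne
    rw [← LinearMap.isUnit_iff_isUnit_det, Module.End.isUnit_iff] at hu
    obtain ⟨v, hv⟩ := hu.2 (r x)
    have h2 := hinner v
    have hv' : fderiv ℝ r x v = r x := hv
    rw [hv', real_inner_self_eq_norm_sq, hnorm] at h2
    exact (pow_pos hR 2).ne' h2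
  have hint : ∀ t : ℝ, IntegrableOn (fun x => (1 + t • A x).det) B := fun t =>
    (ContinuousLinearMap.continuous_det.comp
      (continuous_const.add (hAc.const_smul t))).continuousOn.integrableOn_compact hBc
  -- The volume identity passes from the small nodes to t = 1, as the determinant is a polynomial in
  -- t; the singular Jacobian then forces the ball to have volume zero.
  have h0 : ∫ x in B, (1 + A x).det = (volume B).toReal := by
    rw [funext fun x => hdet (A x)]
    rw [integral_finsetSum _ fun i _ => (hint (s i)).const_mul (w i)]
    simp_rw [integral_const_mul]
    rw [Finset.sum_congr rfl fun i _ => by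
      rw [hvol (s i) (hs i).1 (hsmall i).1 (hsmall i).2], ← Finset.sum_mul, hw, one_mul]
  simp only [hsing, integral_zero] at h0
  have hvpos : 0 < volume B := Metric.measure_closedBall_pos volume 0 hR
  have hvfin : volume B < ⊤ := hBc.measure_lt_top
  exact (ENNReal.toReal_pos hvpos.ne' hvfin.ne).ne h0

/-- A continuously differentiable map that points outwards on and outside a sphere has a zero. -/
theorem exists_zero_of_inner_pos {F : E → E} (hF : ContDiff ℝ 1 F) {R : ℝ} (hR : 0 < R)
    (hpos : ∀ x, R ≤ ‖x‖ → 0 < inner ℝ (F x) x) : ∃ x, F x = 0 := by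
  by_contra! hne
  let χ : ContDiffBump (0 : E) := ⟨R, 2 * R, hR, by linarith⟩
  have hχ : ContDiff ℝ 1 (χ : E → ℝ) := χ.contDiff
  -- Blending with the identity between radii R and 2R creates no zero, since both summands have
  -- nonnegative inner product with x there and one is positive. Normalizing to length 2R would give
  -- a retraction.
  let H : E → E := fun x => χ x • F x + (1 - χ x) • x
  have hH : ContDiff ℝ 1 H := (hχ.smul hF).add ((contDiff_const.sub hχ).smul contDiff_id)
  have hH0 : ∀ x, H x ≠ 0 := by
    intro x h0
    rcases le_total ‖x‖ R with hx | hx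
    · have : χ x = 1 := χ.one_of_mem_closedBall (by simpa using hx)
      simp only [H, this, one_smul, sub_self, zero_smul, add_zero] at h0
      exact hne x h0
    · have h1 := congrArg (fun y => inner ℝ y x) h0
      simp only [H, inner_add_left, inner_smul_left, inner_zero_left,
        real_inner_self_eq_norm_sq] at h1
      have h2 := χ.nonneg' x
      have h3 : χ x ≤ 1 := χ.le_one
      have h4 := hpos x hx
      have h5 : 0 < ‖x‖ ^ 2 := by have := hR.trans_le hx; positivity
      simp at h1
      rcases h2.eq_or_lt with h6 | h6
      · rw [← h6] at h1; linarith
      · nlinarith [mul_pos h6 h4, mul_nonneg (sub_nonneg.2 h3) h5.le]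
  have hHout : ∀ x, ‖x‖ = 2 * R → H x = x := by
    intro x hx
    have : χ x = 0 := χ.zero_of_le_dist (by simp [hx, χ])
    simp [H, this]
  refine not_exists_retraction (r := fun x => (2 * R / ‖H x‖) • H x)
    ((contDiff_const.div (hH.norm ℝ hH0) fun x => norm_ne_zero_iff.2 (hH0 x)).smul hH)
    (R := 2 * R) (by linarith) (fun x => ?_) fun x hx => ?_
  · have h1 : 0 < ‖H x‖ := norm_pos_iff.2 (hH0 x)
    rw [norm_smul, Real.norm_of_nonneg (by positivity)]
    field_simp
  · simp only [hHout x hx, hx]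
    rw [div_self (by positivity), one_smul]

end Zeros

/-! ### Calculus of polynomials on the plane -/

section Polynomials

lemma pval_add (p q : Poly) (x : Plane) : pval (p + q) x = pval p x + pval q x := map_add _ p q

lemma pval_sub (p q : Poly) (x : Plane) : pval (p - q) x = pval p x - pval q x := map_sub _ p q

lemma pval_mul (p q : Poly) (x : Plane) : pval (p * q) x = pval p x * pval q x := map_mul _ p q

lemma pval_smul (c : ℝ) (p : Poly) (x : Plane) : pval (c • p) x = c * pval p x := by
  simp [pval]

lemma pval_sum {ι : Type*} (s : Finset ι) (p : ι → Poly) (x : Plane) :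
    pval (∑ i ∈ s, p i) x = ∑ i ∈ s, pval (p i) x := map_sum _ p s

lemma pval_zero (x : Plane) : pval 0 x = 0 := map_zero _

/-- The bridge between the formal derivatives, in which all the forms are written, and calculus on
the plane. -/
lemma hasFDerivAt_pval (p : Poly) (x : Plane) :
    HasFDerivAt (pval p) (∑ i, pval (pd i p) x • (EuclideanSpace.proj i : Plane →L[ℝ] ℝ)) x := by
  induction p using MvPolynomial.induction_on with
  | C a =>
    have : pval (MvPolynomial.C a) = fun _ => a := by funext y; simp [pval]
    rw [this]
    simpa [pd, pval] using hasFDerivAt_const a x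
  | add p q hp hq =>
    have : pval (p + q) = pval p + pval q := by funext y; exact pval_add p q y
    rw [this]
    refine (hp.add hq).congr_fderiv ?_
    rw [← Finset.sum_add_distrib]
    refine Finset.sum_congr rfl fun i _ => ?_
    rw [← add_smul, pd, pd, pd, map_add, pval_add]
  | mul_X p j hp =>
    have : pval (p * MvPolynomial.X j) = fun y => pval p y * y j := by
      funext y; rw [pval_mul]; simp [pval]
    rw [this]
    have hX : HasFDerivAt (fun y : Plane => y j) (EuclideanSpace.proj j : Plane →L[ℝ] ℝ) x :=
      (EuclideanSpace.proj j : Plane →L[ℝ] ℝ).hasFDerivAt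
    refine (hp.mul hX).congr_fderiv ?_
    ext v
    fin_cases j <;>
    simp [pd, pval, Fin.sum_univ_two, MvPolynomial.pderiv_X, Pi.single_apply] <;> ring

lemma partialD_pval (i : Fin 2) (p : Poly) (x : Plane) :
    partialD i (pval p) x = pval (pd i p) x := by
  rw [partialD, (hasFDerivAt_pval p x).fderiv]
  fin_cases i <;> simp [Fin.sum_univ_two]

lemma differentiable_pval (p : Poly) : Differentiable ℝ (pval p) := fun x =>
  (hasFDerivAt_pval p x).differentiableAt

lemma continuous_pval (p : Poly) : Continuous (pval p) := (differentiable_pval p).continuous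

/-- A polynomial that vanishes on a nonempty open set is zero. -/
lemma eq_zero_of_pval_eq_zero {U : Set Plane} (hU : IsOpen U) (hne : U.Nonempty) {p : Poly}
    (h : ∀ x ∈ U, pval p x = 0) : p = 0 := by
  obtain ⟨x, hx⟩ := hne
  have hU' : IsOpen ((WithLp.toLp 2 : (Fin 2 → ℝ) → Plane) ⁻¹' U) :=
    hU.preimage (PiLp.continuous_toLp 2 _)
  obtain ⟨ε, hε, hsub⟩ := Metric.isOpen_iff.1 hU' (fun i => x i) hx
  rw [ball_pi _ hε] at hsub
  refine MvPolynomial.funext_set (fun i => Metric.ball (x i) ε)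
    (fun i => (infinite_of_mem_nhds (x i) (Metric.ball_mem_nhds _ hε))) fun y hy => ?_
  simpa [pval] using h _ (hsub hy)

lemma totalDegree_pd_le {m : ℕ} (i : Fin 2) {p : Poly} (hp : p.totalDegree ≤ m + 1) :
    (pd i p).totalDegree ≤ m := by
  refine Finset.sup_le fun s hs => ?_
  rw [MvPolynomial.mem_support_iff, pd, MvPolynomial.coeff_pderiv] at hs
  have h := MvPolynomial.le_totalDegree (MvPolynomial.mem_support_iff.2 (left_ne_zero_of_mul hs))
  rw [Finsupp.sum_add_index' (fun _ => rfl) (fun _ _ _ => rfl),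
    Finsupp.sum_single_index rfl] at h
  lia

end Polynomials

/-! ### Geometry of triangulations -/

section Geometry

variable {Ω : Set Plane} {𝒯 : Triangulation Ω}

lemma isCompact_carrier (E : 𝒯.Cell) : IsCompact (carrier E) :=
  E.1.finite_toSet.isCompact_convexHull ℝ

lemma convex_carrier (E : 𝒯.Cell) : Convex ℝ (carrier E) := convex_convexHull ℝ _

lemma interior_carrier_subset (E : 𝒯.Cell) : interior (carrier E) ⊆ Ω :=
  𝒯.interior_subset E.1 E.2.1 E.2.2

lemma affineSpan_eq_top_iff_card {s : Finset Plane} (hs : AffineIndependent ℝ ((↑) : s → Plane)) :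
    affineSpan ℝ (s : Set Plane) = ⊤ ↔ s.card = 3 := by
  have h := hs.affineSpan_eq_top_iff_card_eq_finrank_add_one
  simpa using h

lemma interior_carrier_nonempty (E : 𝒯.Cell) : (interior (carrier E)).Nonempty :=
  interior_convexHull_nonempty_iff_affineSpan_eq_top.2
    ((affineSpan_eq_top_iff_card (𝒯.indep E.2.1)).2 E.2.2)

/-- In a simplicial complex the intersection of two triangles lies in the hull of their common
vertices, which has interior points only if all three vertices are shared. -/
lemma disjoint_interior_carrier {E E' : 𝒯.Cell} (h : E ≠ E') :
    Disjoint (interior (carrier E)) (interior (carrier E')) := by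
  classical
  rw [Set.disjoint_iff_inter_eq_empty, ← Set.not_nonempty_iff_eq_empty]
  intro hne
  apply h
  have hsub : interior (carrier E) ∩ interior (carrier E') ⊆
      interior (convexHull ℝ ((E.1 ∩ E'.1 : Finset Plane) : Set Plane)) := by
    rw [← interior_inter, Finset.coe_inter]
    exact interior_mono (𝒯.inter_subset_convexHull E.2.1 E'.2.1)
  have htop := interior_convexHull_nonempty_iff_affineSpan_eq_top.1 (hne.mono hsub)
  have hind : AffineIndependent ℝ ((↑) : (E.1 ∩ E'.1 : Finset Plane) → Plane) :=
    AffineIndependent.mono (t := (E.1 : Set Plane)) (𝒯.indep E.2.1) (s := ((E.1 ∩ E'.1 : Finset Plane) : Set Plane)) (by simp)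
  have hcard := (affineSpan_eq_top_iff_card hind).1 htop
  have h1 : E.1 ∩ E'.1 = E.1 :=
    Finset.eq_of_subset_of_card_le Finset.inter_subset_left (by rw [hcard, E.2.2])
  have h2 : E.1 ∩ E'.1 = E'.1 :=
    Finset.eq_of_subset_of_card_le Finset.inter_subset_right (by rw [hcard, E'.2.2])
  exact Subtype.ext (h1.symm.trans h2)

/-- The frontier of a convex set is a null set. This reconciles the closed triangles in the forms
with the open ones used by `realize`. -/
lemma interior_carrier_ae_eq (E : 𝒯.Cell) :
    (interior (carrier E) : Set Plane) =ᵐ[volume] carrier E := by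
  have h : (volume : Measure Plane) (frontier (carrier E)) = 0 :=
    (convex_carrier E).addHaar_frontier volume
  exact interior_ae_eq_of_null_frontier h

lemma ae_mem_interior_carrier (hΩ : IsOpen Ω) (𝒯 : Triangulation Ω) :
    ∀ᵐ x ∂(volume.restrict Ω), ∃ E : 𝒯.Cell, x ∈ interior (carrier E) := by
  have h : ∀ᵐ x ∂(volume.restrict Ω), ∀ E : 𝒯.Cell, x ∈ interior (carrier E) ↔ x ∈ carrier E :=
    ae_all_iff.2 fun E => ae_restrict_of_ae ((interior_carrier_ae_eq E).mem_iff)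
  filter_upwards [h, ae_restrict_mem hΩ.measurableSet] with x hx hxΩ
  have hxs : x ∈ 𝒯.space := by rw [𝒯.space_eq]; exact subset_closure hxΩ
  obtain ⟨s, hs, hxs⟩ := 𝒯.mem_space_iff.1 hxs
  obtain ⟨t, ht, hst, hcard⟩ := 𝒯.pure_two s hs
  exact ⟨⟨t, ht, hcard⟩, (hx _).2 (convexHull_mono (Finset.coe_subset.2 hst) hxs)⟩

lemma integrableOn_pval (E : 𝒯.Cell) (p : Poly) : IntegrableOn (pval p) (carrier E) :=
  (continuous_pval p).continuousOn.integrableOn_compact (isCompact_carrier E)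

/-- Integrals over `Ω` of functions that are given elementwise. -/
lemma setIntegral_sum_indicator (F : 𝒯.Cell → Plane → ℝ)
    (hF : ∀ E, IntegrableOn (F E) (interior (carrier E))) :
    ∫ x in Ω, ∑ E, (interior (carrier E)).indicator (F E) x = ∑ E, ∫ x in carrier E, F E x := by
  rw [integral_finsetSum _ fun E _ =>
    (((integrable_indicator_iff isOpen_interior.measurableSet).2 (hF E)).integrableOn)]
  refine Finset.sum_congr rfl fun E _ => ?_
  rw [setIntegral_indicator isOpen_interior.measurableSet,
    Set.inter_eq_self_of_subset_right (interior_carrier_subset E)]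
  exact setIntegral_congr_set (interior_carrier_ae_eq E)

lemma sum_indicator_of_mem (F : 𝒯.Cell → Plane → ℝ) {E : 𝒯.Cell} {x : Plane}
    (hx : x ∈ interior (carrier E)) :
    ∑ E, (interior (carrier E)).indicator (F E) x = F E x := by
  classical
  rw [Finset.sum_eq_single E, Set.indicator_of_mem hx]
  · intro E' _ hne
    exact Set.indicator_of_notMem (fun hx' => (Set.disjoint_left.1
      (disjoint_interior_carrier hne)) hx' hx) _
  · simp

lemma realize_eq_sum_indicator (q : SField 𝒯) (x : Plane) :
    realize q x = ∑ E, (interior (carrier E)).indicator (pval (q E)) x := by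
  classical
  simp only [realize, Set.indicator_apply]

lemma realize_of_mem (q : SField 𝒯) {E : 𝒯.Cell} {x : Plane} (hx : x ∈ interior (carrier E)) :
    realize q x = pval (q E) x := by
  rw [realize_eq_sum_indicator, sum_indicator_of_mem _ hx]

lemma realize_add (p q : SField 𝒯) (x : Plane) : realize (p + q) x = realize p x + realize q x := by
  simp only [realize, ← Finset.sum_add_distrib, Pi.add_apply, pval_add]
  exact Finset.sum_congr rfl fun E _ => by split_ifs <;> simp

lemma realize_smul (c : ℝ) (q : SField 𝒯) (x : Plane) : realize (c • q) x = c * realize q x := by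
  simp only [realize, Finset.mul_sum, Pi.smul_apply, pval_smul]
  exact Finset.sum_congr rfl fun E _ => by split_ifs <;> simp

lemma measurable_realize (q : SField 𝒯) : Measurable (realize q) := by
  rw [funext (realize_eq_sum_indicator q)]
  exact Finset.measurable_sum _ fun E _ =>
    (continuous_pval (q E)).measurable.indicator isOpen_interior.measurableSet

lemma exists_realize_bound (q : SField 𝒯) : ∃ C, 0 ≤ C ∧ ∀ x, |realize q x| ≤ C := by
  have h : ∀ E : 𝒯.Cell, ∃ C, ∀ x ∈ carrier E, |pval (q E) x| ≤ C := fun E =>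
    (isCompact_carrier E).exists_bound_of_continuousOn (continuous_pval (q E)).continuousOn
  choose C hC using h
  refine ⟨∑ E, |C E|, Finset.sum_nonneg fun E _ => abs_nonneg _, fun x => ?_⟩
  rw [realize_eq_sum_indicator]
  refine (Finset.abs_sum_le_sum_abs _ _).trans (Finset.sum_le_sum fun E _ => ?_)
  by_cases hx : x ∈ interior (carrier E)
  · rw [Set.indicator_of_mem hx]
    exact (hC E x (interior_subset hx)).trans (le_abs_self _)
  · rw [Set.indicator_of_notMem hx, abs_zero]; exact abs_nonneg _

lemma memLp_realize (hΩ : volume Ω < ⊤) (q : SField 𝒯) (s : ENNReal) :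
    MemLp (realize q) s (volume.restrict Ω) := by
  obtain ⟨C, -, hC⟩ := exists_realize_bound q
  have : IsFiniteMeasure (volume.restrict Ω) := ⟨by simpa using hΩ⟩
  exact MemLp.of_bound (measurable_realize q).aestronglyMeasurable C (ae_of_all _ hC)

lemma setIntegral_realize_mul (u v : SField 𝒯) :
    ∫ x in Ω, realize u x * realize v x = ∑ E, ∫ x in carrier E, pval (u E) x * pval (v E) x := by
  rw [← setIntegral_sum_indicator (fun E x => pval (u E) x * pval (v E) x) fun E =>
    ((((continuous_pval _).mul (continuous_pval _)).continuousOn.integrableOn_compact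
      (isCompact_carrier E)).mono_set interior_subset)]
  congr 1
  funext x
  by_cases hx : ∃ E : 𝒯.Cell, x ∈ interior (carrier E)
  · obtain ⟨E, hE⟩ := hx
    rw [sum_indicator_of_mem _ hE, realize_of_mem _ hE, realize_of_mem _ hE]
  · push Not at hx
    simp [realize_eq_sum_indicator, hx]

/-- A polynomial whose square has zero integral over an element is zero. -/
lemma eq_zero_of_l2Sq_eq_zero (E : 𝒯.Cell) {p : Poly} (h : l2Sq E p = 0) : p = 0 := by
  have hc : Continuous fun x => pval p x ^ 2 := (continuous_pval p).pow 2
  have hint : IntegrableOn (fun x => pval p x ^ 2) (interior (carrier E)) :=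
    (hc.continuousOn.integrableOn_compact (isCompact_carrier E)).mono_set interior_subset
  have h0 : ∫ x in interior (carrier E), pval p x ^ 2 = 0 := by
    rw [setIntegral_congr_set (interior_carrier_ae_eq E)]; exact h
  rw [setIntegral_eq_zero_iff_of_nonneg_ae (ae_of_all _ fun x => sq_nonneg _) hint] at h0
  have h1 : Set.EqOn (fun x => pval p x ^ 2) 0 (interior (carrier E)) :=
    Measure.eqOn_open_of_ae_eq h0 isOpen_interior hc.continuousOn continuousOn_const
  refine eq_zero_of_pval_eq_zero isOpen_interior (interior_carrier_nonempty E) fun x hx => ?_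
  exact pow_eq_zero_iff (two_ne_zero) |>.1 (h1 hx)

lemma l2Sq_nonneg (E : 𝒯.Cell) (p : Poly) : 0 ≤ l2Sq E p :=
  integral_nonneg fun _ => sq_nonneg _

end Geometry

/-! ### Weak gradients and the convection form -/

section Convection

/-- Continuity of the L² inner product, stated for functions instead of classes; it carries
identities for test functions over to H¹₀. -/
lemma tendsto_integral_mul_of_tendsto_eLpNorm {α : Type*} [MeasurableSpace α] {μ : Measure α}
    {f h : ℕ → α → ℝ} {f₀ h₀ : α → ℝ} (hf : ∀ n, MemLp (f n) 2 μ) (hf₀ : MemLp f₀ 2 μ)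
    (hh : ∀ n, MemLp (h n) 2 μ) (hh₀ : MemLp h₀ 2 μ)
    (hfl : Tendsto (fun n => eLpNorm (f n - f₀) 2 μ) atTop (𝓝 0))
    (hhl : Tendsto (fun n => eLpNorm (h n - h₀) 2 μ) atTop (𝓝 0)) :
    Tendsto (fun n => ∫ x, f n x * h n x ∂μ) atTop (𝓝 (∫ x, f₀ x * h₀ x ∂μ)) := by
  have key : ∀ {u v : α → ℝ} (hu : MemLp u 2 μ) (hv : MemLp v 2 μ),
      inner ℝ (hv.toLp v) (hu.toLp u) = ∫ x, u x * v x ∂μ := by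
    intro u v hu hv
    rw [L2.inner_def]
    refine integral_congr_ae ?_
    filter_upwards [hu.coeFn_toLp, hv.coeFn_toLp] with x h1 h2
    rw [h1, h2]
    simp
  have h1 := (Lp.tendsto_Lp_iff_tendsto_eLpNorm'' f hf f₀ hf₀).2 hfl
  have h2 := (Lp.tendsto_Lp_iff_tendsto_eLpNorm'' h hh h₀ hh₀).2 hhl
  have h3 := h2.inner (𝕜 := ℝ) h1
  rw [key hf₀ hh₀] at h3
  exact h3.congr fun n => key (hf n) (hh n)

lemma continuous_partialD {φ : Plane → ℝ} (hφ : ContDiff ℝ 1 φ) (j : Fin 2) :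
    Continuous (partialD j φ) :=
  (hφ.continuous_fderiv (by norm_num)).clm_apply continuous_const

lemma hasCompactSupport_partialD {φ : Plane → ℝ} (hφ : HasCompactSupport φ) (j : Fin 2) :
    HasCompactSupport (partialD j φ) :=
  hφ.fderiv_apply (𝕜 := ℝ) _

lemma partialD_eq_zero {φ : Plane → ℝ} {x : Plane} (hx : x ∉ tsupport φ) (j : Fin 2) :
    partialD j φ x = 0 := by
  rw [partialD, fderiv_of_notMem_tsupport (𝕜 := ℝ) hx]; rfl

lemma integral_mul_partialD {f φ : Plane → ℝ} (hf : ContDiff ℝ 1 f) (hφ : ContDiff ℝ 1 φ)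
    (hc : HasCompactSupport φ) (j : Fin 2) :
    ∫ x, f x * partialD j φ x = -∫ x, partialD j f x * φ x := by
  refine integral_mul_fderiv_eq_neg_fderiv_mul_of_integrable ?_ ?_ ?_
    (fun x _ => hf.differentiable (by norm_num) x) (fun x _ => hφ.differentiable (by norm_num) x)
  · exact ((continuous_partialD hf j).mul hφ.continuous).integrable_of_hasCompactSupport hc.mul_left
  · exact (hf.continuous.mul (continuous_partialD hφ j)).integrable_of_hasCompactSupport
      (hasCompactSupport_partialD hc j).mul_left
  · exact (hf.continuous.mul hφ.continuous).integrable_of_hasCompactSupport hc.mul_left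

lemma contDiff_pval (p : Poly) : ContDiff ℝ 1 (pval p) := by
  rw [contDiff_one_iff_fderiv]
  refine ⟨differentiable_pval p, ?_⟩
  have : fderiv ℝ (pval p) =
      fun x => ∑ i, pval (pd i p) x • (EuclideanSpace.proj i : Plane →L[ℝ] ℝ) :=
    funext fun x => (hasFDerivAt_pval p x).fderiv
  rw [this]
  exact continuous_finsetSum _ fun i _ => (continuous_pval _).smul continuous_const

variable {Ω : Set Plane}

lemma IsTestFunction.contDiff_one {φ : Plane → ℝ} (h : IsTestFunction Ω φ) : ContDiff ℝ 1 φ :=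
  h.1.of_le (by exact_mod_cast le_top)

lemma IsTestFunction.memLp {φ : Plane → ℝ} (h : IsTestFunction Ω φ) (μ : Measure Plane)
    [IsFiniteMeasureOnCompacts μ] : MemLp φ 2 μ :=
  h.1.continuous.memLp_of_hasCompactSupport h.2.1

lemma IsTestFunction.memLp_partialD {φ : Plane → ℝ} (h : IsTestFunction Ω φ) (j : Fin 2)
    (μ : Measure Plane) [IsFiniteMeasureOnCompacts μ] : MemLp (partialD j φ) 2 μ :=
  (continuous_partialD h.contDiff_one j).memLp_of_hasCompactSupport
    (hasCompactSupport_partialD h.2.1 j)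

lemma IsTestFunction.mono {Ω' : Set Plane} (hs : Ω ⊆ Ω') {φ : Plane → ℝ}
    (h : IsTestFunction Ω φ) : IsTestFunction Ω' φ := ⟨h.1, h.2.1, h.2.2.trans hs⟩

lemma IsTestFunction.mul {φ ψ : Plane → ℝ} (h : IsTestFunction Ω φ) (h' : IsTestFunction Ω ψ) :
    IsTestFunction Ω fun x => φ x * ψ x :=
  ⟨h.1.mul h'.1, h.2.1.mul_right, (tsupport_mul_subset_left).trans h.2.2⟩

lemma IsTestFunction.setIntegral_eq {φ : Plane → ℝ} (h : IsTestFunction Ω φ) {F : Plane → ℝ}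
    (hF : ∀ x, x ∉ tsupport φ → F x = 0) : ∫ x in Ω, F x = ∫ x, F x :=
  setIntegral_eq_integral_of_forall_compl_eq_zero fun x hx => hF x fun hx' => hx (h.2.2 hx')

/-- `φ n` are test functions that converge to `v` in `H¹(Ω)`, and `g` is the weak gradient. -/
structure H10Approx (Ω : Set Plane) (v : Plane → ℝ) (φ : ℕ → Plane → ℝ)
    (g : Fin 2 → Plane → ℝ) : Prop where
  memLp : MemLp v 2 (volume.restrict Ω)
  test : ∀ n, IsTestFunction Ω (φ n)
  memLp_grad : ∀ i, MemLp (g i) 2 (volume.restrict Ω)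
  tendsto : Tendsto (fun n => eLpNorm (φ n - v) 2 (volume.restrict Ω)) atTop (𝓝 0)
  tendsto_grad : ∀ i,
    Tendsto (fun n => eLpNorm (partialD i (φ n) - g i) 2 (volume.restrict Ω)) atTop (𝓝 0)

lemma MemH10.exists_approx {v : Plane → ℝ} (h : MemH10 Ω v) : ∃ φ g, H10Approx Ω v φ g := by
  obtain ⟨h1, φ, g, h2, h3, h4, h5⟩ := h
  exact ⟨φ, g, h1, h2, h3, h4, h5⟩

lemma tendsto_eLpNorm_self {α : Type*} [MeasurableSpace α] {μ : Measure α} (f : α → ℝ) :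
    Tendsto (fun _ : ℕ => eLpNorm (f - f) 2 μ) atTop (𝓝 0) := by
  simp

/-- Integration by parts holds for the approximating test functions, and both sides pass to the
limit in L². -/
lemma H10Approx.setIntegral_mul_partialD {v : Plane → ℝ} {φ : ℕ → Plane → ℝ}
    {g : Fin 2 → Plane → ℝ} (h : H10Approx Ω v φ g) {η : Plane → ℝ} (hη : IsTestFunction Ω η)
    (j : Fin 2) : ∫ x in Ω, v x * partialD j η x = -∫ x in Ω, g j x * η x := by
  have h1 := tendsto_integral_mul_of_tendsto_eLpNorm (fun n => (h.test n).memLp _) h.memLp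
    (fun _ => hη.memLp_partialD j (volume.restrict Ω)) (hη.memLp_partialD j _) h.tendsto
    (tendsto_eLpNorm_self _)
  have h2 := tendsto_integral_mul_of_tendsto_eLpNorm (fun n => (h.test n).memLp_partialD j _)
    (h.memLp_grad j) (fun _ => hη.memLp (volume.restrict Ω)) (hη.memLp _) (h.tendsto_grad j)
    (tendsto_eLpNorm_self _)
  refine tendsto_nhds_unique h1 (h2.neg.congr fun n => ?_)
  rw [hη.setIntegral_eq fun x hx => by rw [image_eq_zero_of_notMem_tsupport hx, mul_zero],
    hη.setIntegral_eq fun x hx => by rw [partialD_eq_zero hx, mul_zero],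
    integral_mul_partialD (h.test n).contDiff_one hη.contDiff_one hη.2.1]

variable {𝒯 : Triangulation Ω}

/-- Test functions supported in one open triangle see a single polynomial, so the fundamental lemma
of the calculus of variations identifies the weak gradient there. Thus conformity turns elementwise
derivatives into a global weak gradient, without any edge terms. -/
lemma H10Approx.grad_ae_eq (hΩ : volume Ω < ⊤) {q : SField 𝒯} {φ : ℕ → Plane → ℝ}
    {g : Fin 2 → Plane → ℝ} (h : H10Approx Ω (realize q) φ g) (E : 𝒯.Cell) (j : Fin 2) :
    ∀ᵐ x, x ∈ interior (carrier E) → g j x = pval (pd j (q E)) x := by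
  have : IsFiniteMeasure (volume.restrict Ω) := ⟨by simpa using hΩ⟩
  have hgint : IntegrableOn (g j) Ω := (h.memLp_grad j).integrable (by norm_num)
  have hpint : IntegrableOn (pval (pd j (q E))) (interior (carrier E)) :=
    (integrableOn_pval E _).mono_set interior_subset
  have h0 := isOpen_interior.ae_eq_zero_of_integral_contDiff_smul_eq_zero (μ := volume)
    (f := fun x => g j x - pval (pd j (q E)) x) (U := interior (carrier E))
    (((hgint.mono_set (interior_carrier_subset E)).sub hpint).locallyIntegrableOn) ?_
  · filter_upwards [h0] with x hx hxE
    exact sub_eq_zero.1 (hx hxE)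
  intro ψ hψ hψc hψs
  have hψE : IsTestFunction (interior (carrier E)) ψ := ⟨hψ, hψc, hψs⟩
  have hψΩ : IsTestFunction Ω ψ := hψE.mono (interior_carrier_subset E)
  have h1 := h.setIntegral_mul_partialD hψΩ j
  have h2 : ∫ x in Ω, realize q x * partialD j ψ x =
      -∫ x in Ω, pval (pd j (q E)) x * ψ x := by
    rw [hψΩ.setIntegral_eq fun x hx => by rw [partialD_eq_zero hx, mul_zero],
      hψΩ.setIntegral_eq fun x hx => by rw [image_eq_zero_of_notMem_tsupport hx, mul_zero]]
    have h3 := integral_mul_partialD (contDiff_pval (q E)) hψE.contDiff_one hψc j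
    simp only [partialD_pval] at h3
    rw [← h3]
    congr 1
    funext x
    by_cases hx : x ∈ tsupport ψ
    · rw [realize_of_mem _ (hψs hx)]
    · rw [partialD_eq_zero hx, mul_zero, mul_zero]
  have hi1 : IntegrableOn (fun x => g j x * ψ x) Ω :=
    (h.memLp_grad j).integrable_mul (hψΩ.memLp (volume.restrict Ω))
  have hi2 : IntegrableOn (fun x => pval (pd j (q E)) x * ψ x) Ω :=
    (((continuous_pval _).mul hψ.continuous).integrable_of_hasCompactSupport
      hψc.mul_left).integrableOn
  calc ∫ x, ψ x • (g j x - pval (pd j (q E)) x)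
      = ∫ x in Ω, ψ x • (g j x - pval (pd j (q E)) x) :=
        (hψΩ.setIntegral_eq fun x hx => by
          rw [image_eq_zero_of_notMem_tsupport hx, zero_smul]).symm
    _ = ∫ x in Ω, (g j x * ψ x - pval (pd j (q E)) x * ψ x) := by
        congr 1; funext x; rw [smul_eq_mul]; ring
    _ = 0 := by rw [integral_sub hi1 hi2]; linarith

/-- Since div V_h = Q_h, the divergence of w is itself an admissible pressure; testing with it makes
its L² norm vanish. -/
lemma pdiv_eq_zero_of_mem_Z {k : ℕ} {S : FEPair 𝒯 k} {w : VField 𝒯} (hw : w ∈ S.Z) (E : 𝒯.Cell) :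
    pdiv (w E) = 0 := by
  have hQ : divh 𝒯 w ∈ S.Q := by
    rw [← S.div_range]; exact Submodule.mem_map_of_mem hw.1
  have h := hw.2 _ hQ
  have h' : ∑ E : 𝒯.Cell, l2Sq E (pdiv (w E)) = 0 := by
    rw [← h]
    refine Finset.sum_congr rfl fun E _ => ?_
    simp only [l2Sq, sq]
    rfl
  exact eq_zero_of_l2Sq_eq_zero E
    ((Finset.sum_eq_zero_iff_of_nonneg fun E _ => l2Sq_nonneg E _).1 h' E (Finset.mem_univ E))

/-- Discretely divergence-free fields are weakly divergence-free. -/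
lemma sum_setIntegral_realize_mul_partialD (hΩ : IsOpen Ω) (hv : volume Ω < ⊤) {k : ℕ}
    {S : FEPair 𝒯 k} {w : VField 𝒯} (hw : w ∈ S.Z) {η : Plane → ℝ} (hη : IsTestFunction Ω η) :
    ∑ j, ∫ x in Ω, realize (fun E => w E j) x * partialD j η x = 0 := by
  have happ := fun j => (S.conforming w hw.1 j).exists_approx
  choose φ g h using happ
  have h1 : ∀ j, ∫ x in Ω, realize (fun E => w E j) x * partialD j η x =
      -∫ x in Ω, g j j x * η x := fun j => (h j).setIntegral_mul_partialD hη j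
  simp_rw [h1]
  have hint : ∀ j, Integrable (fun x => g j j x * η x) (volume.restrict Ω) := fun j =>
    ((h j).memLp_grad j).integrable_mul (hη.memLp (volume.restrict Ω))
  rw [Finset.sum_neg_distrib, ← integral_finsetSum _ fun j _ => hint j, neg_eq_zero]
  refine integral_eq_zero_of_ae ?_
  have h2 : ∀ᵐ x ∂(volume.restrict Ω), ∀ (E : 𝒯.Cell) (j : Fin 2),
      x ∈ interior (carrier E) → g j j x = pval (pd j (w E j)) x :=
    ae_all_iff.2 fun E => ae_all_iff.2 fun j => ae_restrict_of_ae ((h j).grad_ae_eq hv E j)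
  filter_upwards [h2, ae_mem_interior_carrier hΩ 𝒯] with x hx ⟨E, hE⟩
  have h3 := congrArg (fun p => pval p x) (pdiv_eq_zero_of_mem_Z hw E)
  simp only [pdiv, pval_sum, pval_zero] at h3
  rw [← Finset.sum_mul, Finset.sum_congr rfl fun j _ => hx E j hE, h3, zero_mul]
  rfl

/-- The convection form is skew-symmetric for discretely divergence-free transport fields. -/
lemma cForm_self_eq_zero (hΩ : IsOpen Ω) (hv : volume Ω < ⊤) {k : ℕ} {S : FEPair 𝒯 k}
    {w u : VField 𝒯} (hw : w ∈ S.Z) (hu : u ∈ S.V) : cForm w u u = 0 := by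
  have happ := fun i => (S.conforming u hu i).exists_approx
  choose φ g h using happ
  have hbound := fun j => exists_realize_bound fun E => w E j
  choose C hC0 hC using hbound
  -- The transport field is bounded, so multiplication by it preserves L² and L² convergence; the
  -- trilinear integral becomes a pairing of two L² limits.
  have hmul : ∀ j (v : Plane → ℝ), MemLp v 2 (volume.restrict Ω) →
      MemLp (fun x => realize (fun E => w E j) x * v x) 2 (volume.restrict Ω) := by
    intro j v hv'
    refine hv'.of_le_mul (c := C j) ((measurable_realize _).aestronglyMeasurable.mul hv'.1)
      (ae_of_all _ fun x => ?_)
    rw [norm_mul]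
    exact mul_le_mul_of_nonneg_right (hC j x) (norm_nonneg _)
  have hlim : ∀ i, ∑ j, ∫ x in Ω, (realize (fun E => w E j) x * realize (fun E => u E i) x) *
      g i j x = 0 := by
    intro i
    have ht : ∀ j, Tendsto (fun n => ∫ x in Ω, (realize (fun E => w E j) x * φ i n x) *
        partialD j (φ i n) x) atTop
        (𝓝 (∫ x in Ω, (realize (fun E => w E j) x * realize (fun E => u E i) x) * g i j x)) := by
      intro j
      refine tendsto_integral_mul_of_tendsto_eLpNorm
        (f := fun n x => realize (fun E => w E j) x * φ i n x)
        (fun n => hmul j _ (((h i).test n).memLp _)) (hmul j _ (h i).memLp)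
        (fun n => ((h i).test n).memLp_partialD j _) ((h i).memLp_grad j) ?_
        ((h i).tendsto_grad j)
      have hz : Tendsto (fun n => ENNReal.ofReal (C j) *
          eLpNorm (φ i n - realize fun E => u E i) 2 (volume.restrict Ω)) atTop (𝓝 0) := by
        have := ENNReal.Tendsto.const_mul (a := ENNReal.ofReal (C j)) (h i).tendsto
          (Or.inr ENNReal.ofReal_ne_top)
        simpa using this
      refine tendsto_of_tendsto_of_tendsto_of_le_of_le tendsto_const_nhds hz
        (fun _ => zero_le) fun n => ?_
      refine eLpNorm_le_mul_eLpNorm_of_ae_le_mul (ae_of_all _ fun x => ?_) _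
      simp only [Pi.sub_apply, ← mul_sub, norm_mul]
      exact mul_le_mul_of_nonneg_right (hC j x) (norm_nonneg _)
    -- Here φ ∂_jφ is half of ∂_j(φ²), and φ² is again a test function, against which w is weakly
    -- divergence-free.
    have hz : ∀ n, ∑ j, ∫ x in Ω, (realize (fun E => w E j) x * φ i n x) *
        partialD j (φ i n) x = 0 := by
      intro n
      have h1 := sum_setIntegral_realize_mul_partialD hΩ hv hw
        (((h i).test n).mul ((h i).test n))
      have h2 : ∀ j x, partialD j (fun x => φ i n x * φ i n x) x =
          2 * (φ i n x * partialD j (φ i n) x) := by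
        intro j x
        have hd := ((h i).test n).contDiff_one.differentiable (by norm_num) x
        rw [partialD, fderiv_fun_mul hd hd]
        simp [partialD]
        ring
      have h3 : ∀ j, ∫ x in Ω, realize (fun E => w E j) x *
          partialD j (fun x => φ i n x * φ i n x) x =
          2 * ∫ x in Ω, (realize (fun E => w E j) x * φ i n x) * partialD j (φ i n) x := by
        intro j
        rw [← integral_const_mul]
        congr 1
        funext x
        rw [h2]
        ring
      simp_rw [h3] at h1
      rw [← Finset.mul_sum] at h1
      linarith
    exact tendsto_nhds_unique (tendsto_finsetSum _ fun j _ => ht j)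
      (by simp_rw [hz]; exact tendsto_const_nhds)
  have hgrad : ∀ᵐ x ∂(volume.restrict Ω), ∀ (E : 𝒯.Cell) (i j : Fin 2),
      x ∈ interior (carrier E) → g i j x = pval (pd j (u E i)) x :=
    ae_all_iff.2 fun E => ae_all_iff.2 fun i => ae_all_iff.2 fun j =>
      ae_restrict_of_ae ((h i).grad_ae_eq hv E j)
  have hsum : cForm w u u = ∫ x in Ω, ∑ i, ∑ j,
      (realize (fun E => w E j) x * realize (fun E => u E i) x) * g i j x := by
    rw [cForm, ← setIntegral_sum_indicator
      (fun E x => ∑ i, pval (pconv (u E) (w E) i) x * pval (u E i) x) fun E =>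
      ((continuous_finsetSum _ fun i _ =>
        (continuous_pval _).mul (continuous_pval _)).continuousOn.integrableOn_compact
          (isCompact_carrier E)).mono_set interior_subset]
    refine integral_congr_ae ?_
    filter_upwards [hgrad, ae_mem_interior_carrier hΩ 𝒯] with x hx ⟨E, hE⟩
    rw [sum_indicator_of_mem _ hE]
    refine Finset.sum_congr rfl fun i _ => ?_
    rw [pconv, pval_sum, Finset.sum_mul]
    refine Finset.sum_congr rfl fun j _ => ?_
    rw [hx E i j hE, realize_of_mem _ hE, realize_of_mem _ hE, pval_mul]
    ring
  have hint : ∀ i j, Integrable (fun x => (realize (fun E => w E j) x *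
      realize (fun E => u E i) x) * g i j x) (volume.restrict Ω) := fun i j =>
    (hmul j _ (h i).memLp).integrable_mul ((h i).memLp_grad j)
  rw [hsum, integral_finsetSum _ fun i _ => integrable_finsetSum _ fun j _ => hint i j]
  refine Finset.sum_eq_zero fun i _ => ?_
  rw [integral_finsetSum _ fun j _ => hint i j]
  exact hlim i

end Convection

/-! ### Separated families -/

section Separated

/-- Families `Φ x t` that are finite sums of terms `c(x) q(t) m` with `c` continuously
differentiable and `q` continuous. -/
inductive Sep {X M : Type*} [NormedAddCommGroup X] [NormedSpace ℝ X] [AddCommGroup M]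
    [Module ℝ M] : (X → ℝ → M) → Prop
  | smul (c : X → ℝ) (q : ℝ → ℝ) (m : M) : ContDiff ℝ 1 c → Continuous q →
      Sep fun x t => (c x * q t) • m
  | add {Φ Ψ : X → ℝ → M} : Sep Φ → Sep Ψ → Sep fun x t => Φ x t + Ψ x t

namespace Sep

variable {X M N P : Type*} [NormedAddCommGroup X] [NormedSpace ℝ X] [AddCommGroup M] [Module ℝ M]
  [AddCommGroup N] [Module ℝ N] [AddCommGroup P] [Module ℝ P] {Φ Ψ : X → ℝ → M}

lemma const (m : M) : Sep fun (_ : X) (_ : ℝ) => m := by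
  have h := Sep.smul (X := X) (fun _ => 1) (fun _ => 1) m contDiff_const continuous_const
  simpa using h

lemma zero : Sep fun (_ : X) (_ : ℝ) => (0 : M) := const 0

lemma sum {ι : Type*} (s : Finset ι) {Φ : ι → X → ℝ → M} (h : ∀ i ∈ s, Sep (Φ i)) :
    Sep fun x t => ∑ i ∈ s, Φ i x t := by
  classical
  induction s using Finset.induction_on with
  | empty => simpa using zero
  | insert i s hi ih =>
    simp only [Finset.sum_insert hi]
    exact (h i (Finset.mem_insert_self i s)).add (ih fun j hj => h j (Finset.mem_insert_of_mem hj))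

lemma map (L : M →ₗ[ℝ] N) (h : Sep Φ) : Sep fun x t => L (Φ x t) := by
  induction h with
  | smul c q m hc hq => simpa using Sep.smul c q (L m) hc hq
  | add _ _ h1 h2 => simpa using h1.add h2

lemma neg (h : Sep Φ) : Sep fun x t => -Φ x t := h.map (-LinearMap.id)

lemma sub (h : Sep Φ) (h' : Sep Ψ) : Sep fun x t => Φ x t - Ψ x t := by
  simpa [sub_eq_add_neg] using h.add h'.neg

lemma time_smul {r : ℝ → ℝ} (hr : Continuous r) (h : Sep Φ) : Sep fun x t => r t • Φ x t := by
  induction h with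
  | smul c q m hc hq =>
    have := Sep.smul c (fun t => r t * q t) m hc (hr.mul hq)
    simpa [smul_smul, mul_left_comm] using this
  | add _ _ h1 h2 => simpa using h1.add h2

lemma bilin (B : M →ₗ[ℝ] N →ₗ[ℝ] P) {Θ : X → ℝ → N} (h : Sep Φ) (h' : Sep Θ) :
    Sep fun x t => B (Φ x t) (Θ x t) := by
  induction h with
  | smul c q m hc hq =>
    induction h' with
    | smul c' q' m' hc' hq' =>
      have := Sep.smul _ _ (B m m') (hc'.mul hc) (hq'.mul hq)
      simpa [smul_smul, mul_mul_mul_comm] using this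
    | add _ _ h1 h2 => simpa using h1.add h2
  | add _ _ h1 h2 => simpa using h1.add h2

lemma mul {p q : X → ℝ → Poly} (h : Sep p) (h' : Sep q) : Sep fun x t => p x t * q x t :=
  h.bilin (LinearMap.mul ℝ Poly) h'

lemma linear {m : ℕ} (L : EuclideanSpace ℝ (Fin m) →ₗ[ℝ] M) :
    Sep fun (x : EuclideanSpace ℝ (Fin m)) (_ : ℝ) => L x := by
  have h : ∀ x, L x = ∑ i, (x i * 1) • L (EuclideanSpace.basisFun (Fin m) ℝ i) := by
    intro x
    conv_lhs => rw [← (EuclideanSpace.basisFun (Fin m) ℝ).sum_repr x]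
    simp
  rw [funext fun x => funext fun _ : ℝ => h x]
  exact sum _ fun i _ => Sep.smul (fun x : EuclideanSpace ℝ (Fin m) => x i) (fun _ => 1) _
    (EuclideanSpace.proj i : EuclideanSpace ℝ (Fin m) →L[ℝ] ℝ).contDiff continuous_const

/-- For each term c(x)q(t)m the factor c(x) leaves the integral, so smoothness in x needs no
differentiation under the integral sign and no topology on M. The functionals Λ t need only be
integrable in time against fixed vectors, which suits data that are merely L². -/
lemma integral_functional {Λ : ℝ → M →ₗ[ℝ] ℝ} {a b : ℝ}
    (hΛ : ∀ m, IntervalIntegrable (fun t => Λ t m) volume a b) (h : Sep Φ) :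
    (∀ x, IntervalIntegrable (fun t => Λ t (Φ x t)) volume a b) ∧
      ContDiff ℝ 1 fun x => ∫ t in a..b, Λ t (Φ x t) := by
  induction h with
  | smul c q m hc hq =>
    have h1 : IntervalIntegrable (fun t => q t * Λ t m) volume a b :=
      (hΛ m).continuousOn_mul hq.continuousOn
    have h2 : ∀ x t, Λ t ((c x * q t) • m) = c x * (q t * Λ t m) := fun x t => by
      rw [map_smul, smul_eq_mul, mul_assoc]
    simp only [h2, intervalIntegral.integral_const_mul]
    exact ⟨fun x => h1.const_mul _, hc.mul contDiff_const⟩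
  | add _ _ h1 h2 =>
    simp only [map_add]
    refine ⟨fun x => (h1.1 x).add (h2.1 x), ?_⟩
    rw [funext fun x => intervalIntegral.integral_add (h1.1 x) (h2.1 x)]
    exact h1.2.add h2.2

lemma continuous {c : X → ℝ → ℝ} (h : Sep c) (x : X) : Continuous (c x) := by
  induction h with
  | smul c q m hc hq => exact (continuous_const.mul hq).mul continuous_const
  | add _ _ h1 h2 => exact h1.add h2

lemma contDiff {c : X → ℝ → ℝ} (h : Sep c) (t : ℝ) : ContDiff ℝ 1 fun x => c x t := by
  induction h with
  | smul c q m hc hq => exact (hc.mul contDiff_const).mul contDiff_const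
  | add _ _ h1 h2 => exact h1.add h2

lemma contDiff_integral {c : X → ℝ → ℝ} (h : Sep c) (a b : ℝ) :
    ContDiff ℝ 1 fun x => ∫ t in a..b, c x t :=
  (h.integral_functional (Λ := fun _ => LinearMap.id) fun m => by
    simp).2

end Sep

end Separated

/-! ### The forms as polynomial expressions -/

section Forms

variable {Ω : Set Plane} {𝒯 : Triangulation Ω}

lemma pd_add (i : Fin 2) (p q : Poly) : pd i (p + q) = pd i p + pd i q := map_add _ p q

lemma pd_smul (i : Fin 2) (c : ℝ) (p : Poly) : pd i (c • p) = c • pd i p :=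
  Derivation.map_smul _ c p

/-- Integration of polynomials over an element. -/
def intE (E : 𝒯.Cell) : Poly →ₗ[ℝ] ℝ where
  toFun p := ∫ x in carrier E, pval p x
  map_add' p q := by
    simp only [pval_add]
    exact integral_add (integrableOn_pval E p) (integrableOn_pval E q)
  map_smul' c p := by
    simp only [pval_smul]
    exact integral_const_mul _ _

/-- An edge is a compact segment whose one-dimensional Hausdorff measure is its finite length. -/
lemma integrableOn_pval_edge {e : Finset Plane} (he : e.card = 2) (p : Poly) :
    IntegrableOn (pval p) (convexHull ℝ (e : Set Plane)) (Measure.hausdorffMeasure 1) := by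
  classical
  obtain ⟨a, b, -, rfl⟩ := Finset.card_eq_two.1 he
  have hs : convexHull ℝ ((({a, b} : Finset Plane)) : Set Plane) = segment ℝ a b := by
    rw [Finset.coe_insert, Finset.coe_singleton, convexHull_pair]
  rw [hs]
  have hc : IsCompact (segment ℝ a b) := by
    rw [← hs]
    exact ({a, b} : Finset Plane).finite_toSet.isCompact_convexHull ℝ
  exact (continuous_pval p).continuousOn.integrableOn_of_subset_isCompact hc hc.measurableSet
    subset_rfl (by rw [hausdorffMeasure_segment]; exact edist_ne_top a b)

/-- Integration of polynomials over an edge. -/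
def intEdge (e : Finset Plane) : Poly →ₗ[ℝ] ℝ :=
  if he : e.card = 2 then
    { toFun := fun p => ∫ x in convexHull ℝ (e : Set Plane), pval p x ∂(Measure.hausdorffMeasure 1)
      map_add' := fun p q => by
        simp only [pval_add]
        exact integral_add (integrableOn_pval_edge he p) (integrableOn_pval_edge he q)
      map_smul' := fun c p => by
        simp only [pval_smul]
        exact integral_const_mul _ _ }
  else 0

open Classical in
/-- The polynomial whose values are the jump across an edge. -/
def jumpPoly (w : VField 𝒯) (E : 𝒯.Cell) (e : Finset Plane) (i : Fin 2) : Poly :=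
  if convexHull ℝ (e : Set Plane) ⊆ frontier Ω then 0
  else ∑ E' : 𝒯.Cell with e ⊆ E'.1 ∧ E' ≠ E, (w E i - w E' i)

lemma edgeJump_eq (w : VField 𝒯) (E : 𝒯.Cell) (e : Finset Plane) (x : Plane) (i : Fin 2) :
    edgeJump w E e x i = pval (jumpPoly w E e i) x := by
  classical
  unfold edgeJump jumpPoly
  split_ifs
  · exact (pval_zero x).symm
  · simp only [pval_sum, pval_sub]

lemma inner2_eq (u v : VField 𝒯) : inner2 u v = ∑ E, intE E (∑ i, u E i * v E i) := by
  simp only [inner2, intE, LinearMap.coe_mk, AddHom.coe_mk, pval_sum, pval_mul]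

lemma aForm_eq (u v : VField 𝒯) :
    aForm u v = ∑ E, intE E (∑ i, ∑ j, peps (u E) i j * peps (v E) i j) := by
  simp only [aForm, intE, LinearMap.coe_mk, AddHom.coe_mk, pval_sum, pval_mul]

lemma cForm_eq (w u v : VField 𝒯) :
    cForm w u v = ∑ E, intE E (∑ i, pconv (u E) (w E) i * v E i) := by
  simp only [cForm, intE, LinearMap.coe_mk, AddHom.coe_mk, pval_sum, pval_mul]

lemma CForm_eq (δ : 𝒯.Cell → ℝ) (w₁ w₂ ut u vt v : VField 𝒯) :
    CForm δ w₁ w₂ ut u vt v = ∑ E, δ E * intE E (pcurl (material ut u w₁ E) *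
      pcurl (material vt v w₂ E)) := by
  simp only [CForm, intE, LinearMap.coe_mk, AddHom.coe_mk, pval_mul]

lemma LForm_eq (ν : ℝ) (δ : 𝒯.Cell → ℝ) (w₂ u vt v : VField 𝒯) :
    LForm ν δ w₂ u vt v = ∑ E, δ E * intE E ((-ν) • pcurl (pdivT (peps (u E))) *
      pcurl (material vt v w₂ E)) := by
  simp only [LForm, intE, LinearMap.coe_mk, AddHom.coe_mk, pval_mul, pval_smul]

lemma bdryJumps_eq (w z : VField 𝒯) (E : 𝒯.Cell) :
    bdryJumps w z E = ∑ e ∈ E.1.powersetCard 2,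
      intEdge e (∑ i, jumpPoly w E e i * jumpPoly z E e i) := by
  refine Finset.sum_congr rfl fun e he => ?_
  rw [intEdge, dif_pos (Finset.mem_powersetCard.1 he).2]
  simp only [LinearMap.coe_mk, AddHom.coe_mk, pval_sum, pval_mul, edgeJump_eq]

lemma peps_add (u v : Fin 2 → Poly) (i j : Fin 2) :
    peps (u + v) i j = peps u i j + peps v i j := by
  simp only [peps, Pi.add_apply, pd_add]; ring

lemma peps_smul (c : ℝ) (v : Fin 2 → Poly) (i j : Fin 2) :
    peps (c • v) i j = c • peps v i j := by
  simp only [peps, Pi.smul_apply, pd_smul, ← smul_add, mul_smul_comm]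

lemma pcurl_add (u v : Fin 2 → Poly) : pcurl (u + v) = pcurl u + pcurl v := by
  simp only [pcurl, Pi.add_apply, pd_add]; ring

lemma pcurl_smul (c : ℝ) (v : Fin 2 → Poly) : pcurl (c • v) = c • pcurl v := by
  simp only [pcurl, Pi.smul_apply, pd_smul, ← smul_sub]

lemma pconv_add (u v w : Fin 2 → Poly) : pconv (u + v) w = pconv u w + pconv v w := by
  funext i
  simp only [pconv, Pi.add_apply, pd_add, add_mul, Finset.sum_add_distrib]

lemma pconv_smul (c : ℝ) (v w : Fin 2 → Poly) : pconv (c • v) w = c • pconv v w := by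
  funext i
  simp only [pconv, Pi.smul_apply, pd_smul, smul_mul_assoc, Finset.smul_sum]

lemma material_add (vt vt' v v' w : VField 𝒯) (E : 𝒯.Cell) :
    material (vt + vt') (v + v') w E = material vt v w E + material vt' v' w E := by
  simp only [material, Pi.add_apply, pconv_add]; abel

lemma material_smul (c : ℝ) (vt v w : VField 𝒯) (E : 𝒯.Cell) :
    material (c • vt) (c • v) w E = c • material vt v w E := by
  simp only [material, Pi.smul_apply, pconv_smul, smul_add]

lemma convField_add (u v w : VField 𝒯) : convField (u + v) w = convField u w + convField v w := by
  funext E; simp only [convField, Pi.add_apply, pconv_add]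

lemma convField_smul (c : ℝ) (v w : VField 𝒯) : convField (c • v) w = c • convField v w := by
  funext E; simp only [convField, Pi.smul_apply, pconv_smul]

lemma jumpPoly_add (w z : VField 𝒯) (E : 𝒯.Cell) (e : Finset Plane) (i : Fin 2) :
    jumpPoly (w + z) E e i = jumpPoly w E e i + jumpPoly z E e i := by
  classical
  unfold jumpPoly
  split_ifs
  · simp
  · rw [← Finset.sum_add_distrib]
    refine Finset.sum_congr rfl fun E' _ => ?_
    simp only [Pi.add_apply]; ring

lemma jumpPoly_smul (c : ℝ) (w : VField 𝒯) (E : 𝒯.Cell) (e : Finset Plane) (i : Fin 2) :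
    jumpPoly (c • w) E e i = c • jumpPoly w E e i := by
  classical
  unfold jumpPoly
  split_ifs
  · simp
  · rw [Finset.smul_sum]
    refine Finset.sum_congr rfl fun E' _ => ?_
    simp only [Pi.smul_apply, smul_sub]

lemma inner2_comm (u v : VField 𝒯) : inner2 u v = inner2 v u := by
  simp only [inner2_eq, mul_comm]

lemma inner2_add_right (u v v' : VField 𝒯) : inner2 u (v + v') = inner2 u v + inner2 u v' := by
  simp only [inner2_eq, Pi.add_apply, mul_add, Finset.sum_add_distrib, map_add]

lemma inner2_smul_right (c : ℝ) (u v : VField 𝒯) : inner2 u (c • v) = c * inner2 u v := by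
  simp only [inner2_eq, Pi.smul_apply, mul_smul_comm, ← Finset.smul_sum, map_smul, smul_eq_mul,
    Finset.mul_sum]

lemma inner2_add_left (u u' v : VField 𝒯) : inner2 (u + u') v = inner2 u v + inner2 u' v := by
  rw [inner2_comm, inner2_add_right, inner2_comm v, inner2_comm v]

lemma inner2_smul_left (c : ℝ) (u v : VField 𝒯) : inner2 (c • u) v = c * inner2 u v := by
  rw [inner2_comm, inner2_smul_right, inner2_comm v]

lemma inner2_self_eq (u : VField 𝒯) : inner2 u u = ∑ E, ∑ i, l2Sq E (u E i) := by
  rw [inner2_eq]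
  refine Finset.sum_congr rfl fun E _ => ?_
  rw [map_sum]
  refine Finset.sum_congr rfl fun i _ => ?_
  simp only [intE, LinearMap.coe_mk, AddHom.coe_mk, pval_mul, l2Sq, sq]

lemma inner2_self_nonneg (u : VField 𝒯) : 0 ≤ inner2 u u := by
  rw [inner2_self_eq]
  exact Finset.sum_nonneg fun E _ => Finset.sum_nonneg fun i _ => l2Sq_nonneg E _

lemma eq_zero_of_inner2_self {u : VField 𝒯} (h : inner2 u u = 0) : u = 0 := by
  rw [inner2_self_eq, Finset.sum_eq_zero_iff_of_nonneg fun E _ =>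
    Finset.sum_nonneg fun i _ => l2Sq_nonneg E _] at h
  funext E i
  exact eq_zero_of_l2Sq_eq_zero E ((Finset.sum_eq_zero_iff_of_nonneg fun i _ =>
    l2Sq_nonneg E _).1 (h E (Finset.mem_univ E)) i (Finset.mem_univ i))

/-- The test function enters the stabilization together with its time derivative, so linearity
concerns the pair (vt, v) with the transport field w₂ frozen. -/
lemma KForm_add (ν : ℝ) (δ : 𝒯.Cell → ℝ) (w₁ w₂ ut u vt vt' v v' : VField 𝒯) :
    KForm ν δ w₁ w₂ ut u (vt + vt') (v + v') =
      KForm ν δ w₁ w₂ ut u vt v + KForm ν δ w₁ w₂ ut u vt' v' := by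
  simp only [KForm, aForm_eq, cForm_eq, CForm_eq, LForm_eq, JForm, bdryJumps_eq, Pi.add_apply,
    peps_add, material_add, pcurl_add, convField_add, jumpPoly_add, mul_add,
    Finset.sum_add_distrib, map_add]
  ring

lemma KForm_smul (ν : ℝ) (δ : 𝒯.Cell → ℝ) (c : ℝ) (w₁ w₂ ut u vt v : VField 𝒯) :
    KForm ν δ w₁ w₂ ut u (c • vt) (c • v) = c * KForm ν δ w₁ w₂ ut u vt v := by
  simp only [KForm, aForm_eq, cForm_eq, CForm_eq, LForm_eq, JForm, bdryJumps_eq, Pi.smul_apply,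
    peps_smul, material_smul, pcurl_smul, convField_smul, jumpPoly_smul, mul_smul_comm,
    ← Finset.smul_sum, map_smul, smul_eq_mul, ← Finset.mul_sum, mul_left_comm _ c, ← mul_add]

/-! ### Smooth dependence of the forms on the coefficients of the discrete functions. -/

section SepForms

variable {X : Type*} [NormedAddCommGroup X] [NormedSpace ℝ X]
  {u v w w₁ w₂ ut vt : X → ℝ → VField 𝒯}

lemma Sep.comp_apply (h : Sep u) (E : 𝒯.Cell) (i : Fin 2) : Sep fun x t => u x t E i :=
  h.map ((LinearMap.proj i : (Fin 2 → Poly) →ₗ[ℝ] Poly) ∘ₗ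
    (LinearMap.proj E : VField 𝒯 →ₗ[ℝ] (Fin 2 → Poly)))

lemma Sep.pd {p : X → ℝ → Poly} (h : Sep p) (i : Fin 2) : Sep fun x t => pd i (p x t) :=
  h.map (MvPolynomial.pderiv i : Derivation ℝ Poly Poly).toLinearMap

lemma Sep.peps (h : Sep u) (E : 𝒯.Cell) (i j : Fin 2) : Sep fun x t => peps (u x t E) i j :=
  (Sep.const _).mul (((h.comp_apply E i).pd j).add ((h.comp_apply E j).pd i))

lemma Sep.pconv (h : Sep u) (hw : Sep w) (E : 𝒯.Cell) (i : Fin 2) :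
    Sep fun x t => pconv (u x t E) (w x t E) i :=
  Sep.sum _ fun j _ => ((h.comp_apply E i).pd j).mul (hw.comp_apply E j)

lemma Sep.pcurl_material (ht : Sep ut) (h : Sep u) (hw : Sep w) (E : 𝒯.Cell) :
    Sep fun x t => pcurl (material (ut x t) (u x t) (w x t) E) :=
  (((ht.comp_apply E 1).add (h.pconv hw E 1)).pd 0).sub
    (((ht.comp_apply E 0).add (h.pconv hw E 0)).pd 1)

lemma Sep.pcurl_pdivT_peps (h : Sep u) (E : 𝒯.Cell) :
    Sep fun x t => pcurl (pdivT (VortStab.peps (u x t E))) :=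
  ((Sep.sum _ fun j _ => (h.peps E 1 j).pd j).pd 0).sub
    ((Sep.sum _ fun j _ => (h.peps E 0 j).pd j).pd 1)

lemma Sep.jumpPoly_convField (h : Sep u) (hw : Sep w) (E : 𝒯.Cell) (e : Finset Plane)
    (i : Fin 2) : Sep fun x t => jumpPoly (convField (u x t) (w x t)) E e i := by
  classical
  unfold jumpPoly
  split_ifs
  · exact Sep.zero
  · exact Sep.sum _ fun E' _ => (h.pconv hw E i).sub (h.pconv hw E' i)

lemma Sep.inner2 (h : Sep u) (h' : Sep v) : Sep fun x t => inner2 (u x t) (v x t) := by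
  simp only [inner2_eq]
  exact Sep.sum _ fun E _ =>
    (Sep.sum _ fun i _ => (h.comp_apply E i).mul (h'.comp_apply E i)).map (intE E)

lemma Sep.aForm (h : Sep u) (h' : Sep v) : Sep fun x t => aForm (u x t) (v x t) := by
  simp only [aForm_eq]
  exact Sep.sum _ fun E _ => (Sep.sum _ fun i _ => Sep.sum _ fun j _ =>
    (h.peps E i j).mul (h'.peps E i j)).map (intE E)

lemma Sep.real_mul {c : X → ℝ → ℝ} (a : ℝ) (h : Sep c) : Sep fun x t => a * c x t :=
  h.map (LinearMap.lsmul ℝ ℝ a)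

lemma Sep.bdryJumps (h : Sep u) (hw : Sep w₁) (h' : Sep v) (hw' : Sep w₂) (E : 𝒯.Cell) :
    Sep fun x t => bdryJumps (convField (u x t) (w₁ x t)) (convField (v x t) (w₂ x t)) E := by
  simp only [bdryJumps_eq]
  exact Sep.sum _ fun e _ => (Sep.sum _ fun i _ =>
    (h.jumpPoly_convField hw E e i).mul (h'.jumpPoly_convField hw' E e i)).map (intEdge e)

lemma Sep.KForm (ν : ℝ) (δ : 𝒯.Cell → ℝ) (hw₁ : Sep w₁) (hw₂ : Sep w₂) (hut : Sep ut)
    (hu : Sep u) (hvt : Sep vt) (hv : Sep v) :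
    Sep fun x t => KForm ν δ (w₁ x t) (w₂ x t) (ut x t) (u x t) (vt x t) (v x t) := by
  simp only [VortStab.KForm, cForm_eq, CForm_eq, LForm_eq, JForm]
  refine ((((Sep.real_mul ν (hu.aForm hv)).add ?_).add ?_).add ?_).add ?_
  · exact Sep.sum _ fun E _ => (Sep.sum _ fun i _ =>
      (hu.pconv hw₁ E i).mul (hv.comp_apply E i)).map (intE E)
  · exact Sep.sum _ fun E _ => Sep.real_mul _
      (((hut.pcurl_material hu hw₁ E).mul (hvt.pcurl_material hv hw₂ E)).map (intE E))
  · exact Sep.sum _ fun E _ => Sep.real_mul _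
      ((((hu.pcurl_pdivT_peps E).map (LinearMap.lsmul ℝ Poly (-ν))).mul
        (hvt.pcurl_material hv hw₂ E)).map (intE E))
  · exact Sep.sum _ fun E _ => Sep.real_mul _ (hu.bdryJumps hw₁ hv hw₂ E)

variable {N : ℕ}

/-- The coefficients of a family of discrete functions of time are separated. -/
def SepDG (U : X → DG N (VField 𝒯)) : Prop :=
  ∀ j, (Sep fun x (_ : ℝ) => (U x j).1) ∧ Sep fun x (_ : ℝ) => (U x j).2

lemma SepDG.const (U : DG N (VField 𝒯)) : SepDG fun _ : X => U :=
  fun _ => ⟨Sep.const _, Sep.const _⟩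

lemma SepDG.tval {U : X → DG N (VField 𝒯)} (h : SepDG U) (τ : ℝ) (j : Fin (N + 1)) :
    Sep fun x t => tval τ (U x) j t :=
  (h j).1.add ((h j).2.time_smul (continuous_id.sub continuous_const))

lemma SepDG.tder {U : X → DG N (VField 𝒯)} (h : SepDG U) (j : Fin (N + 1)) :
    Sep fun x (_ : ℝ) => tder (U x) j := (h j).2

lemma SepDG.minusNext {U : X → DG N (VField 𝒯)} (h : SepDG U) (τ : ℝ) (j : Fin (N + 1)) :
    Sep fun x (_ : ℝ) => minusNext τ (U x) j :=
  (h j).1.add ((h j).2.time_smul continuous_const)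

lemma SepDG.tjump {U : X → DG N (VField 𝒯)} (h : SepDG U) (τ : ℝ) (j : Fin N) :
    Sep fun x (_ : ℝ) => tjump τ (U x) j :=
  (h j.succ).1.sub (h.minusNext τ j.castSucc)

lemma contDiff_timeInt {τ : ℝ} {n : Fin (N + 1)} {g : X → Fin (N + 1) → ℝ → ℝ}
    (h : ∀ j, Sep fun x t => g x j t) : ContDiff ℝ 1 fun x => timeInt τ n (g x) :=
  ContDiff.sum fun j _ => (h j).contDiff_integral _ _

lemma contDiff_AStab (ν τ : ℝ) (δ : 𝒯.Cell → ℝ) (n : Fin (N + 1)) {U Z : X → DG N (VField 𝒯)}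
    (hU : SepDG U) (hZ : SepDG Z) :
    ContDiff ℝ 1 fun x => AStab ν τ δ n (U x) (U x) (U x) (Z x) := by
  refine ((ContDiff.add ?_ ?_).add ?_).add ?_
  · exact contDiff_timeInt fun j => (hU.tder j).inner2 (hZ.tval τ j)
  · exact ContDiff.sum fun j _ => ((hU.tjump τ j).inner2 (hZ j.succ).1).contDiff 0
  · exact ((hU 0).1.inner2 (hZ 0).1).contDiff 0
  · exact contDiff_timeInt fun j => Sep.KForm ν δ (hU.tval τ j) (hU.tval τ j) (hU.tder j)
      (hU.tval τ j) (hZ.tder j) (hZ.tval τ j)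

end SepForms

end Forms

/-! ### Coercivity of the stabilized form -/

section Coercivity

variable {Ω : Set Plane} {𝒯 : Triangulation Ω}

lemma intE_mul_self (E : 𝒯.Cell) (p : Poly) : intE E (p * p) = l2Sq E p := by
  simp only [intE, LinearMap.coe_mk, AddHom.coe_mk, pval_mul, l2Sq, sq]

lemma intE_mono (E : 𝒯.Cell) {p q : Poly} (h : ∀ x, pval p x ≤ pval q x) :
    intE E p ≤ intE E q :=
  setIntegral_mono (integrableOn_pval E p) (integrableOn_pval E q) h

lemma h2Sq_nonneg (E : 𝒯.Cell) (p : Poly) : 0 ≤ h2Sq E p := by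
  have h := l2Sq_nonneg E
  exact add_nonneg (add_nonneg (h _) (Finset.sum_nonneg fun i _ => h _))
    (add_nonneg (add_nonneg (h _) (h _)) (h _))

/-- The inverse estimate, in the form in which the bound on `δ_E` uses it. -/
lemma mul_h2Sq_le_l2Sq {m : ℕ} {E : 𝒯.Cell} {ν d : ℝ} (hν : 0 < ν) (hd : 0 ≤ d)
    (hdle : d ≤ diam E ^ 4 / (ν * gammaE m E ^ 2)) {p : Poly} (hp : p.totalDegree ≤ m) :
    d * ν * h2Sq E p ≤ l2Sq E p := by
  rcases hd.eq_or_lt with rfl | hd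
  · simpa using l2Sq_nonneg E p
  set γ := gammaE m E
  have hγ0 : 0 ≤ γ := Real.sInf_nonneg fun x hx => hx.1.le
  -- If γ were 0, the quotient bounding d would be 0 by the convention for division by zero,
  -- contrary to d > 0. As the infimum of the empty set is also 0, positivity of γ yields an
  -- admissible constant, so no inverse estimate has to be proved.
  have hγ : 0 < γ := by
    refine hγ0.lt_of_ne fun h0 => ?_
    rw [← h0] at hdle
    simp at hdle
    linarith
  have hne : {γ : ℝ | 0 < γ ∧ ∀ p : Poly, p.totalDegree ≤ m →
      √(h2Sq E p) ≤ γ * (diam E ^ 2)⁻¹ * √(l2Sq E p)}.Nonempty := by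
    by_contra hempty
    rw [Set.not_nonempty_iff_eq_empty] at hempty
    have : γ = 0 := by
      change sInf _ = 0
      rw [hempty, Real.sInf_empty]
    exact hγ.ne' this
  set a := (diam E ^ 2)⁻¹ * √(l2Sq E p)
  have ha : 0 ≤ a := by positivity
  -- The infimum is itself admissible: divide by a when a > 0; when a = 0, any admissible constant
  -- already forces the left side to vanish.
  have hle : √(h2Sq E p) ≤ γ * a := by
    rcases ha.eq_or_lt with h0 | hpos
    · obtain ⟨γ', hγ'⟩ := hne
      have := hγ'.2 p hp
      rw [mul_assoc] at this
      change _ ≤ γ' * a at this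
      rw [← h0] at this ⊢
      linarith
    · rw [← div_le_iff₀ hpos]
      refine le_csInf hne fun γ' hγ' => ?_
      rw [div_le_iff₀ hpos]
      have := hγ'.2 p hp
      rwa [mul_assoc] at this
  have hsq : h2Sq E p ≤ γ ^ 2 * ((diam E ^ 4)⁻¹ * l2Sq E p) := by
    have h1 := pow_le_pow_left₀ (Real.sqrt_nonneg _) hle 2
    rw [Real.sq_sqrt (h2Sq_nonneg E p)] at h1
    refine h1.trans_eq ?_
    simp only [a]
    rw [mul_pow, mul_pow, Real.sq_sqrt (l2Sq_nonneg E p), inv_pow, ← pow_mul]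
  have hdν : d * ν * γ ^ 2 ≤ diam E ^ 4 := by
    rw [le_div_iff₀ (by positivity)] at hdle
    linarith
  calc d * ν * h2Sq E p ≤ d * ν * (γ ^ 2 * ((diam E ^ 4)⁻¹ * l2Sq E p)) :=
        mul_le_mul_of_nonneg_left hsq (by positivity)
    _ = d * ν * γ ^ 2 * (diam E ^ 4)⁻¹ * l2Sq E p := by ring
    _ ≤ diam E ^ 4 * (diam E ^ 4)⁻¹ * l2Sq E p := by
        have := l2Sq_nonneg E p
        gcongr
    _ ≤ 1 * l2Sq E p := mul_le_mul_of_nonneg_right mul_inv_le_one (l2Sq_nonneg E p)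
    _ = l2Sq E p := one_mul _

lemma pd_comm (i j : Fin 2) (p : Poly) : pd i (pd j p) = pd j (pd i p) := by
  ext m
  simp only [pd, MvPolynomial.coeff_pderiv]
  rcases eq_or_ne i j with rfl | hij
  · rfl
  · rw [add_right_comm]
    simp [hij, hij.symm]
    ring

lemma peps_comm (v : Fin 2 → Poly) (i j : Fin 2) : peps v i j = peps v j i := by
  simp only [peps, add_comm]

lemma totalDegree_peps_le {m : ℕ} {v : Fin 2 → Poly} (h : ∀ i, (v i).totalDegree ≤ m + 1)
    (i j : Fin 2) : (peps v i j).totalDegree ≤ m := by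
  refine (MvPolynomial.totalDegree_mul _ _).trans ?_
  rw [MvPolynomial.totalDegree_C, zero_add]
  exact (MvPolynomial.totalDegree_add _ _).trans
    (max_le (totalDegree_pd_le j (h i)) (totalDegree_pd_le i (h j)))

lemma pcurl_pdivT_peps (v : Fin 2 → Poly) :
    pcurl (pdivT (peps v)) = pd 0 (pd 0 (peps v 0 1)) - pd 1 (pd 1 (peps v 0 1)) +
      pd 0 (pd 1 (peps v 1 1)) - pd 0 (pd 1 (peps v 0 0)) := by
  simp only [pcurl, pdivT, Fin.sum_univ_two, pd_add]
  rw [peps_comm v 1 0, pd_comm 1 0 (peps v 0 0)]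
  ring

lemma aForm_self_eq (u : VField 𝒯) : aForm u u = ∑ E, ∑ i, ∑ j, l2Sq E (peps (u E) i j) := by
  rw [aForm_eq]
  refine Finset.sum_congr rfl fun E _ => ?_
  simp only [map_sum, intE_mul_self]

lemma aForm_self_nonneg (u : VField 𝒯) : 0 ≤ aForm u u := by
  rw [aForm_self_eq]
  exact Finset.sum_nonneg fun E _ => Finset.sum_nonneg fun i _ =>
    Finset.sum_nonneg fun j _ => l2Sq_nonneg E _

/-- The quantity curl div ε(v) is a sum of four second derivatives of the entries of ε(v), each
controlled by the inverse estimate. The weights 6, 6, 3, 3 have reciprocals summing to 1, so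
Cauchy–Schwarz applies. Both terms of weight 6 come from ε₁₂, which occurs twice in the Frobenius
norm, and this gives the overall factor 3. -/
lemma mul_l2Sq_pcurl_pdivT_peps_le {m : ℕ} {E : 𝒯.Cell} {ν d : ℝ} (hν : 0 < ν) (hd : 0 ≤ d)
    (hdle : d ≤ diam E ^ 4 / (ν * gammaE m E ^ 2)) {v : Fin 2 → Poly}
    (hv : ∀ i, (v i).totalDegree ≤ m + 1) :
    d * ν * l2Sq E (pcurl (pdivT (peps v))) ≤ 3 * ∑ i, ∑ j, l2Sq E (peps v i j) := by
  have hinv := fun i j => mul_h2Sq_le_l2Sq hν hd hdle (totalDegree_peps_le hv i j)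
  have hpt : l2Sq E (pcurl (pdivT (peps v))) ≤ 6 * l2Sq E (pd 0 (pd 0 (peps v 0 1))) +
      6 * l2Sq E (pd 1 (pd 1 (peps v 0 1))) + 3 * l2Sq E (pd 0 (pd 1 (peps v 1 1))) +
      3 * l2Sq E (pd 0 (pd 1 (peps v 0 0))) := by
    rw [pcurl_pdivT_peps]
    set X := pd 0 (pd 0 (peps v 0 1))
    set Y := pd 1 (pd 1 (peps v 0 1))
    set D := pd 0 (pd 1 (peps v 1 1))
    set A := pd 0 (pd 1 (peps v 0 0))
    have h := intE_mono E (p := (X - Y + D - A) * (X - Y + D - A))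
      (q := (6 : ℝ) • (X * X) + (6 : ℝ) • (Y * Y) + (3 : ℝ) • (D * D) + (3 : ℝ) • (A * A))
      fun x => by
        simp only [pval_mul, pval_add, pval_sub, pval_smul]
        nlinarith [sq_nonneg (pval X x + pval Y x), sq_nonneg (pval D x + pval A x),
          sq_nonneg (2 * (pval X x - pval Y x) - (pval D x - pval A x))]
    simpa only [map_add, map_smul, smul_eq_mul, intE_mul_self] using h
  have hb := hinv 0 1
  have ha := hinv 0 0
  have hdd := hinv 1 1
  have hn := l2Sq_nonneg E
  have hdν : 0 ≤ d * ν := by positivity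
  have hs : ∀ p, l2Sq E (pd 0 (pd 0 p)) + l2Sq E (pd 0 (pd 1 p)) + l2Sq E (pd 1 (pd 1 p)) ≤
      h2Sq E p := by
    intro p
    have h1 : 0 ≤ ∑ i, l2Sq E (pd i p) := Finset.sum_nonneg fun i _ => hn _
    have h2 := hn p
    unfold h2Sq
    linarith
  have h01 : ∀ p, l2Sq E (pd 0 (pd 1 p)) ≤ h2Sq E p := fun p => by
    linarith [hs p, hn (pd 0 (pd 0 p)), hn (pd 1 (pd 1 p))]
  have hb' : d * ν * (l2Sq E (pd 0 (pd 0 (peps v 0 1))) + l2Sq E (pd 1 (pd 1 (peps v 0 1)))) ≤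
      l2Sq E (peps v 0 1) :=
    (mul_le_mul_of_nonneg_left (by linarith [hs (peps v 0 1), hn (pd 0 (pd 1 (peps v 0 1)))])
      hdν).trans hb
  have ha' : d * ν * l2Sq E (pd 0 (pd 1 (peps v 0 0))) ≤ l2Sq E (peps v 0 0) :=
    (mul_le_mul_of_nonneg_left (h01 (peps v 0 0)) hdν).trans ha
  have hd' : d * ν * l2Sq E (pd 0 (pd 1 (peps v 1 1))) ≤ l2Sq E (peps v 1 1) :=
    (mul_le_mul_of_nonneg_left (h01 (peps v 1 1)) hdν).trans hdd
  have := mul_le_mul_of_nonneg_left hpt hdν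
  simp only [Fin.sum_univ_two]
  rw [peps_comm v 1 0]
  linarith

lemma bdryJumps_self_nonneg (w : VField 𝒯) (E : 𝒯.Cell) : 0 ≤ bdryJumps w w E :=
  Finset.sum_nonneg fun _ _ => integral_nonneg fun _ =>
    Finset.sum_nonneg fun _ _ => mul_self_nonneg _

/-- The part of the stability norm that is integrated in time. -/
def stabDensity (ν : ℝ) (δ : 𝒯.Cell → ℝ) (w ut u : VField 𝒯) : ℝ :=
  ν * aForm u u + ∑ E, δ E * l2Sq E (pcurl (material ut u w E)) +
    ∑ E, diam E ^ 2 / 2 * bdryJumps (convField u w) (convField u w) E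

/-- Young's inequality with weights 7/8 and 2/7, whose product is 1/4; the factor 3 of the inverse
estimate turns 2/7 into 6/7. Both fractions must be below 1, which requires a curl weight between
3/4 and 1. -/
lemma le_LForm_self {k : ℕ} {ν : ℝ} {δ : 𝒯.Cell → ℝ} (hν : 0 < ν) (hδ : ∀ E, 0 ≤ δ E)
    (hδle : ∀ E, δ E ≤ diam E ^ 4 / (ν * gammaE (k + 2) E ^ 2)) {w ut u : VField 𝒯}
    (hu : ∀ E i, (u E i).totalDegree ≤ k + 3) :
    -(7 / 8 * ∑ E, δ E * l2Sq E (pcurl (material ut u w E))) - 6 / 7 * (ν * aForm u u) ≤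
      LForm ν δ w u ut u := by
  rw [LForm_eq, aForm_self_eq, Finset.mul_sum, Finset.mul_sum, Finset.mul_sum,
    ← Finset.sum_neg_distrib, ← Finset.sum_sub_distrib]
  refine Finset.sum_le_sum fun E _ => ?_
  set c := pcurl (pdivT (peps (u E)))
  set p := pcurl (material ut u w E)
  have h1 := mul_l2Sq_pcurl_pdivT_peps_le hν (hδ E) (hδle E) (hu E)
  change δ E * ν * l2Sq E c ≤ _ at h1
  have h2 := intE_mono E (p := (-(7 / 8) : ℝ) • (p * p) + (-(2 / 7 * ν ^ 2) : ℝ) • (c * c))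
    (q := (-ν) • c * p) fun x => by
      simp only [pval_mul, pval_add, pval_smul]
      nlinarith [sq_nonneg (7 / 4 * pval p x - ν * pval c x)]
  simp only [map_add, map_smul, smul_eq_mul, intE_mul_self] at h2
  have h3 := mul_le_mul_of_nonneg_left h2 (hδ E)
  have h4 := mul_le_mul_of_nonneg_left h1 hν.le
  linarith

/-- After convection drops out and `LForm` is absorbed, 1/7 of the viscous term, 1/8 of the curl
term and the whole jump term survive; 1/8 is the common lower bound. -/
lemma le_KForm_self (hΩ : IsOpen Ω) (hv : volume Ω < ⊤) {k : ℕ} {S : FEPair 𝒯 k} {ν : ℝ}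
    {δ : 𝒯.Cell → ℝ} (hν : 0 < ν) (hδ : ∀ E, 0 ≤ δ E)
    (hδle : ∀ E, δ E ≤ diam E ^ 4 / (ν * gammaE (k + 2) E ^ 2)) {w u : VField 𝒯} (hw : w ∈ S.Z)
    (hu : u ∈ S.Z) (ut : VField 𝒯) :
    1 / 8 * stabDensity ν δ w ut u ≤ KForm ν δ w w ut u ut u := by
  have hL := le_LForm_self (w := w) (ut := ut) hν hδ hδle (S.degree_le u hu.1)
  have hC : CForm δ w w ut u ut u = ∑ E, δ E * l2Sq E (pcurl (material ut u w E)) := by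
    simp only [CForm_eq, intE_mul_self]
  have hJ : 0 ≤ ∑ E, diam E ^ 2 / 2 * bdryJumps (convField u w) (convField u w) E :=
    Finset.sum_nonneg fun E _ => mul_nonneg (by positivity) (bdryJumps_self_nonneg _ E)
  have ha := mul_nonneg hν.le (aForm_self_nonneg u)
  unfold stabDensity
  rw [KForm, cForm_self_eq_zero hΩ hv hw hu.1, hC, JForm]
  linarith

end Coercivity

/-! ### Integration over the time slabs and the energy identity -/

section Time

variable {N : ℕ}

lemma sum_Iic_zero (F : Fin (N + 1) → ℝ) : ∑ j ∈ Finset.Iic (0 : Fin (N + 1)), F j = F 0 := by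
  have : Finset.Iic (0 : Fin (N + 1)) = {0} := by ext j; simp
  rw [this, Finset.sum_singleton]

lemma sum_Iic_succ (i : Fin N) (F : Fin (N + 1) → ℝ) :
    ∑ j ∈ Finset.Iic i.succ, F j = ∑ j ∈ Finset.Iic i.castSucc, F j + F i.succ := by
  have h : Finset.Iic i.succ = insert i.succ (Finset.Iic i.castSucc) := by
    ext j
    simp only [Finset.mem_Iic, Finset.mem_insert, Fin.le_def, Fin.ext_iff, Fin.val_succ,
      Fin.val_castSucc]
    lia
  rw [h, Finset.sum_insert (by simp [Fin.le_def]), add_comm]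

lemma sum_succ_le_zero (F : Fin N → ℝ) :
    ∑ j : Fin N with j.succ ≤ (0 : Fin (N + 1)), F j = 0 := by
  refine Finset.sum_eq_zero fun j hj => ?_
  simp at hj

lemma sum_succ_le_succ (i : Fin N) (F : Fin N → ℝ) :
    ∑ j : Fin N with j.succ ≤ i.succ, F j =
      ∑ j : Fin N with j.succ ≤ i.castSucc, F j + F i := by
  have h : Finset.univ.filter (fun j : Fin N => j.succ ≤ i.succ) =
      insert i (Finset.univ.filter fun j : Fin N => j.succ ≤ i.castSucc) := by
    ext j
    simp only [Finset.mem_filter, Finset.mem_univ, true_and, Finset.mem_insert, Fin.le_def,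
      Fin.ext_iff, Fin.val_succ, Fin.val_castSucc]
    lia
  rw [h, Finset.sum_insert (by simp [Fin.le_def]), add_comm]

/-- Integrability on every time slab. -/
def SlabIntegrable (τ : ℝ) (g : Fin (N + 1) → ℝ → ℝ) : Prop :=
  ∀ j : Fin (N + 1), IntervalIntegrable (g j) volume ((j : ℕ) * τ) (((j : ℕ) + 1) * τ)

lemma SlabIntegrable.of_continuous {τ : ℝ} {g : Fin (N + 1) → ℝ → ℝ}
    (h : ∀ j, Continuous (g j)) : SlabIntegrable τ g := fun j => (h j).intervalIntegrable _ _

lemma SlabIntegrable.add {τ : ℝ} {g h : Fin (N + 1) → ℝ → ℝ} (hg : SlabIntegrable τ g)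
    (hh : SlabIntegrable τ h) : SlabIntegrable τ fun j t => g j t + h j t :=
  fun j => (hg j).add (hh j)

lemma SlabIntegrable.const_mul {τ : ℝ} {g : Fin (N + 1) → ℝ → ℝ} (hg : SlabIntegrable τ g)
    (c : ℝ) : SlabIntegrable τ fun j t => c * g j t := fun j => (hg j).const_mul c

lemma SlabIntegrable.sum {τ : ℝ} {ι : Type*} (s : Finset ι) {g : ι → Fin (N + 1) → ℝ → ℝ}
    (hg : ∀ i ∈ s, SlabIntegrable τ (g i)) : SlabIntegrable τ fun j t => ∑ i ∈ s, g i j t := by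
  intro j
  have := IntervalIntegrable.sum s fun i hi => hg i hi j
  simpa only [Finset.sum_fn] using this

lemma timeInt_add {τ : ℝ} (n : Fin (N + 1)) {g h : Fin (N + 1) → ℝ → ℝ}
    (hg : SlabIntegrable τ g) (hh : SlabIntegrable τ h) :
    timeInt τ n (fun j t => g j t + h j t) = timeInt τ n g + timeInt τ n h := by
  simp only [timeInt, ← Finset.sum_add_distrib]
  exact Finset.sum_congr rfl fun j _ => intervalIntegral.integral_add (hg j) (hh j)

lemma timeInt_const_mul (τ : ℝ) (n : Fin (N + 1)) (c : ℝ) (g : Fin (N + 1) → ℝ → ℝ) :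
    timeInt τ n (fun j t => c * g j t) = c * timeInt τ n g := by
  simp only [timeInt, Finset.mul_sum, intervalIntegral.integral_const_mul]

lemma timeInt_sum {τ : ℝ} (n : Fin (N + 1)) {ι : Type*} (s : Finset ι)
    {g : ι → Fin (N + 1) → ℝ → ℝ} (hg : ∀ i ∈ s, SlabIntegrable τ (g i)) :
    timeInt τ n (fun j t => ∑ i ∈ s, g i j t) = ∑ i ∈ s, timeInt τ n (g i) := by
  simp only [timeInt]
  rw [Finset.sum_comm]
  exact Finset.sum_congr rfl fun j _ =>
    intervalIntegral.integral_finsetSum fun i hi => hg i hi j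

lemma timeInt_mono {τ : ℝ} (hτ : 0 ≤ τ) (n : Fin (N + 1)) {g h : Fin (N + 1) → ℝ → ℝ}
    (hg : SlabIntegrable τ g) (hh : SlabIntegrable τ h)
    (hle : ∀ j : Fin (N + 1), ∀ᵐ t ∂(volume.restrict
      (Set.Icc ((j : ℕ) * τ) (((j : ℕ) + 1) * τ))), g j t ≤ h j t) :
    timeInt τ n g ≤ timeInt τ n h :=
  Finset.sum_le_sum fun j _ =>
    intervalIntegral.integral_mono_ae_restrict (by nlinarith) (hg j) (hh j) (hle j)

lemma timeInt_last_eq {τ : ℝ} {n : Fin (N + 1)} {g h : Fin (N + 1) → ℝ → ℝ}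
    (heq : ∀ j ≤ n, ∀ t, h j t = g j t) (hzero : ∀ j, n < j → ∀ t, h j t = 0) :
    timeInt τ (Fin.last N) h = timeInt τ n g := by
  unfold timeInt
  have hsub : Finset.Iic n ⊆ Finset.Iic (Fin.last N) :=
    Finset.Iic_subset_Iic.2 (Fin.le_last n)
  rw [← Finset.sum_subset hsub]
  · refine Finset.sum_congr rfl fun j hj => ?_
    rw [funext (heq j (Finset.mem_Iic.1 hj))]
  · intro j _ hj
    rw [Finset.mem_Iic, not_le] at hj
    rw [funext (hzero j hj), intervalIntegral.integral_zero]

lemma timeInt_eq_integral {τ : ℝ} {g : ℝ → ℝ}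
    (hg : SlabIntegrable τ fun (_ : Fin (N + 1)) => g) (n : Fin (N + 1)) :
    IntervalIntegrable g volume 0 (((n : ℕ) + 1) * τ) ∧
      timeInt τ n (fun _ => g) = ∫ t in (0 : ℝ)..(((n : ℕ) + 1) * τ), g t := by
  induction n using Fin.induction with
  | zero =>
    have h0 := hg 0
    rw [timeInt, sum_Iic_zero]
    simp only [Fin.val_zero, Nat.cast_zero, zero_mul] at h0 ⊢
    exact ⟨h0, trivial⟩
  | succ i ih =>
    have h1 := hg i.succ
    rw [timeInt, sum_Iic_succ]
    simp only [Fin.val_succ, Fin.val_castSucc, Nat.cast_add, Nat.cast_one] at h1 ih ⊢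
    refine ⟨ih.1.trans h1, ?_⟩
    rw [← intervalIntegral.integral_add_adjacent_intervals ih.1 h1, ← ih.2]
    rfl

/-- The telescoping behind the energy identity: m and a are the squared left and right traces and J
the squared jumps. Interior traces cancel between a slab and the jump next to it. -/
lemma sum_slab_energy (n : Fin (N + 1)) (m a : Fin (N + 1) → ℝ) (J : Fin N → ℝ) :
    ∑ j ∈ Finset.Iic n, 1 / 2 * (m j - a j) +
      ∑ j : Fin N with j.succ ≤ n, 1 / 2 * (a j.succ + J j - m j.castSucc) + a 0 =
    1 / 2 * (m n + ∑ j : Fin N with j.succ ≤ n, J j + a 0) := by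
  induction n using Fin.induction with
  | zero => rw [sum_Iic_zero, sum_succ_le_zero, sum_succ_le_zero]; ring
  | succ i ih => rw [sum_Iic_succ, sum_succ_le_succ, sum_succ_le_succ]; linarith

variable {Ω : Set Plane} {𝒯 : Triangulation Ω}

lemma inner2_sub_self (u v : VField 𝒯) :
    inner2 (u - v) u = 1 / 2 * (inner2 u u + inner2 (u - v) (u - v) - inner2 v v) := by
  have h : u - v = u + (-1 : ℝ) • v := by simp [sub_eq_add_neg]
  simp only [h, inner2_add_left, inner2_add_right, inner2_smul_left, inner2_smul_right]
  rw [inner2_comm v u]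
  ring

lemma integral_inner2_tder_tval (τ : ℝ) (U : DG N (VField 𝒯)) (j : Fin (N + 1)) :
    ∫ t in ((j : ℕ) * τ)..(((j : ℕ) + 1) * τ), inner2 (tder U j) (tval τ U j t) =
      1 / 2 * (inner2 (minusNext τ U j) (minusNext τ U j) - inner2 (plus U j) (plus U j)) := by
  have h : ∀ t, inner2 (tder U j) (tval τ U j t) =
      inner2 (U j).2 (U j).1 + (t - (j : ℕ) * τ) * inner2 (U j).2 (U j).2 := fun t => by
    rw [tder, tval, inner2_add_right, inner2_smul_right]
  simp only [h]
  rw [intervalIntegral.integral_add (by simp) (Continuous.intervalIntegrable (by fun_prop) _ _),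
    intervalIntegral.integral_const, intervalIntegral.integral_mul_const,
    intervalIntegral.integral_sub (by simp) (by simp), integral_id,
    intervalIntegral.integral_const]
  simp only [minusNext, plus, inner2_add_left, inner2_add_right, inner2_smul_left,
    inner2_smul_right, smul_eq_mul]
  rw [inner2_comm (U j).1 (U j).2]
  ring

lemma energy_identity (τ : ℝ) (n : Fin (N + 1)) (U : DG N (VField 𝒯)) :
    timeInt τ n (fun j t => inner2 (tder U j) (tval τ U j t)) +
      ∑ j : Fin N with j.succ ≤ n, inner2 (tjump τ U j) (plus U j.succ) +
      inner2 (plus U 0) (plus U 0) =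
    1 / 2 * (inner2 (minusNext τ U n) (minusNext τ U n) +
      ∑ j : Fin N with j.succ ≤ n, inner2 (tjump τ U j) (tjump τ U j) +
      inner2 (plus U 0) (plus U 0)) := by
  rw [← sum_slab_energy n (fun j => inner2 (minusNext τ U j) (minusNext τ U j))
    (fun j => inner2 (plus U j) (plus U j)) fun j => inner2 (tjump τ U j) (tjump τ U j)]
  simp only [timeInt, integral_inner2_tder_tval]
  congr 2
  exact Finset.sum_congr rfl fun j _ => inner2_sub_self _ _

/-- The discrete kernel as a subspace. -/
def FEPair.kernel {k : ℕ} (S : FEPair 𝒯 k) : Submodule ℝ (VField 𝒯) where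
  carrier := S.Z
  zero_mem' := ⟨S.V.zero_mem, fun q _ => by simp [bForm, pdiv, pd, pval]⟩
  add_mem' {u v} hu hv := by
    refine ⟨S.V.add_mem hu.1 hv.1, fun q hq => ?_⟩
    have h : ∀ w, bForm w q = ∑ E : 𝒯.Cell, intE E (q E * pdiv (w E)) := fun w => by
      simp only [bForm, intE, LinearMap.coe_mk, AddHom.coe_mk, pval_mul]
    have h1 := hu.2 q hq
    have h2 := hv.2 q hq
    rw [h] at h1 h2 ⊢
    simp only [pdiv, Pi.add_apply, pd_add, Finset.sum_add_distrib, mul_add, map_add] at h1 h2 ⊢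
    linarith
  smul_mem' c v hv := by
    refine ⟨S.V.smul_mem c hv.1, fun q hq => ?_⟩
    have h : ∀ w, bForm w q = ∑ E : 𝒯.Cell, intE E (q E * pdiv (w E)) := fun w => by
      simp only [bForm, intE, LinearMap.coe_mk, AddHom.coe_mk, pval_mul]
    have h1 := hv.2 q hq
    rw [h] at h1 ⊢
    simp only [pdiv, Pi.smul_apply, pd_smul, ← Finset.smul_sum, mul_smul_comm, map_smul] at h1 ⊢
    rw [h1, smul_zero]

lemma tval_mem_Z {k : ℕ} {S : FEPair 𝒯 k} {U : DG N (VField 𝒯)} (hU : U ∈ S.Zτ N) (τ : ℝ)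
    (j : Fin (N + 1)) (t : ℝ) : tval τ U j t ∈ S.Z :=
  S.kernel.add_mem (hU j).1 (S.kernel.smul_mem _ (hU j).2)

/-- Constant families, for continuity in time. -/
lemma sepDG_self (U : DG N (VField 𝒯)) : SepDG fun _ : ℝ => U := SepDG.const U

lemma slabIntegrable_KForm (ν τ : ℝ) (δ : 𝒯.Cell → ℝ) (U V : DG N (VField 𝒯)) :
    SlabIntegrable τ fun j t => KForm ν δ (tval τ U j t) (tval τ U j t) (tder U j) (tval τ U j t)
      (tder V j) (tval τ V j t) :=
  SlabIntegrable.of_continuous fun j => (Sep.KForm ν δ ((sepDG_self U).tval τ j)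
    ((sepDG_self U).tval τ j) ((sepDG_self U).tder j) ((sepDG_self U).tval τ j)
    ((sepDG_self V).tder j) ((sepDG_self V).tval τ j)).continuous 0

lemma slabIntegrable_aForm (τ : ℝ) (U : DG N (VField 𝒯)) :
    SlabIntegrable τ fun j t => aForm (tval τ U j t) (tval τ U j t) :=
  SlabIntegrable.of_continuous fun j =>
    (((sepDG_self U).tval τ j).aForm ((sepDG_self U).tval τ j)).continuous 0

lemma slabIntegrable_inner2 (τ : ℝ) (U : DG N (VField 𝒯)) :
    SlabIntegrable τ fun j t => inner2 (tval τ U j t) (tval τ U j t) :=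
  SlabIntegrable.of_continuous fun j =>
    (((sepDG_self U).tval τ j).inner2 ((sepDG_self U).tval τ j)).continuous 0

lemma slabIntegrable_l2Sq (τ : ℝ) (U : DG N (VField 𝒯)) (E : 𝒯.Cell) :
    SlabIntegrable τ fun j t =>
      l2Sq E (pcurl (material (tder U j) (tval τ U j t) (tval τ U j t) E)) := by
  refine SlabIntegrable.of_continuous fun j => ?_
  have h := ((sepDG_self U).tder j).pcurl_material ((sepDG_self U).tval τ j)
    ((sepDG_self U).tval τ j) E
  have := ((h.mul h).map (intE E)).continuous 0
  simpa only [intE_mul_self] using this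

lemma slabIntegrable_bdryJumps (τ : ℝ) (U : DG N (VField 𝒯)) (E : 𝒯.Cell) :
    SlabIntegrable τ fun j t => bdryJumps (convField (tval τ U j t) (tval τ U j t))
      (convField (tval τ U j t) (tval τ U j t)) E :=
  SlabIntegrable.of_continuous fun j => (Sep.bdryJumps ((sepDG_self U).tval τ j)
    ((sepDG_self U).tval τ j) ((sepDG_self U).tval τ j) ((sepDG_self U).tval τ j) E).continuous 0

lemma slabIntegrable_stabDensity (ν τ : ℝ) (δ : 𝒯.Cell → ℝ) (U : DG N (VField 𝒯)) :
    SlabIntegrable τ fun j t => stabDensity ν δ (tval τ U j t) (tder U j) (tval τ U j t) :=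
  (((slabIntegrable_aForm τ U).const_mul ν).add
    (SlabIntegrable.sum _ fun E _ => (slabIntegrable_l2Sq τ U E).const_mul _)).add
    (SlabIntegrable.sum _ fun E _ => (slabIntegrable_bdryJumps τ U E).const_mul _)

lemma normSq_eq (ν τ : ℝ) (δ : 𝒯.Cell → ℝ) (n : Fin (N + 1)) (U : DG N (VField 𝒯)) :
    normSq ν τ δ n U U = 1 / 2 * (inner2 (minusNext τ U n) (minusNext τ U n) +
      ∑ j : Fin N with j.succ ≤ n, inner2 (tjump τ U j) (tjump τ U j) +
      inner2 (plus U 0) (plus U 0)) +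
      timeInt τ n fun j t => stabDensity ν δ (tval τ U j t) (tder U j) (tval τ U j t) := by
  have h1 := (slabIntegrable_aForm τ U).const_mul ν
  have h2 := fun E => (slabIntegrable_l2Sq τ U E).const_mul (δ E)
  have h3 := fun E => (slabIntegrable_bdryJumps τ U E).const_mul (diam E ^ 2 / 2)
  have hs2 := SlabIntegrable.sum Finset.univ fun E _ => h2 E
  have hs3 := SlabIntegrable.sum Finset.univ fun E _ => h3 E
  simp only [stabDensity]
  rw [timeInt_add n (h1.add hs2) hs3, timeInt_add n h1 hs2, timeInt_sum n _ fun E _ => h2 E,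
    timeInt_sum n _ fun E _ => h3 E, timeInt_const_mul, normSq]
  simp only [timeInt_const_mul]
  ring

lemma stabDensity_nonneg {ν : ℝ} {δ : 𝒯.Cell → ℝ} (hν : 0 < ν) (hδ : ∀ E, 0 ≤ δ E)
    (w ut u : VField 𝒯) : 0 ≤ stabDensity ν δ w ut u :=
  add_nonneg (add_nonneg (mul_nonneg hν.le (aForm_self_nonneg u))
    (Finset.sum_nonneg fun E _ => mul_nonneg (hδ E) (l2Sq_nonneg E _)))
    (Finset.sum_nonneg fun E _ => mul_nonneg (by positivity) (bdryJumps_self_nonneg _ E))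

lemma timeInt_nonneg {τ : ℝ} (hτ : 0 ≤ τ) (n : Fin (N + 1)) {g : Fin (N + 1) → ℝ → ℝ}
    (hg : ∀ j t, 0 ≤ g j t) : 0 ≤ timeInt τ n g :=
  Finset.sum_nonneg fun j _ => intervalIntegral.integral_nonneg (by nlinarith) fun t _ => hg j t

/-- Coercivity of the full space-time form. -/
lemma le_AStab_self (hΩ : IsOpen Ω) (hv : volume Ω < ⊤) {k : ℕ} {S : FEPair 𝒯 k} {ν τ : ℝ}
    {δ : 𝒯.Cell → ℝ} (hν : 0 < ν) (hτ : 0 ≤ τ) (hδ : ∀ E, 0 ≤ δ E)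
    (hδle : ∀ E, δ E ≤ diam E ^ 4 / (ν * gammaE (k + 2) E ^ 2)) {U : DG N (VField 𝒯)}
    (hU : U ∈ S.Zτ N) (n : Fin (N + 1)) :
    1 / 8 * normSq ν τ δ n U U ≤ AStab ν τ δ n U U U U := by
  rw [AStab, energy_identity, normSq_eq]
  have h := timeInt_mono hτ n ((slabIntegrable_stabDensity ν τ δ U).const_mul (1 / 8))
    (slabIntegrable_KForm ν τ δ U U) fun j => ae_of_all _ fun t =>
      le_KForm_self hΩ hv hν hδ hδle (tval_mem_Z hU τ j t) (tval_mem_Z hU τ j t) (tder U j)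
  rw [timeInt_const_mul] at h
  have h1 := inner2_self_nonneg (minusNext τ U n)
  have h2 := inner2_self_nonneg (plus U 0)
  have h3 : 0 ≤ ∑ j : Fin N with j.succ ≤ n, inner2 (tjump τ U j) (tjump τ U j) :=
    Finset.sum_nonneg fun j _ => inner2_self_nonneg _
  linarith

/-- A right trace is the preceding left trace plus a jump, so it costs 4 E_i + 4 E_{i+1}. The extra
4 E_n on the left is the reserve that pays for the first of these in the next induction step;
including m_{i+1} and the new reserve, the step costs 10 E_{i+1}. -/
lemma sum_traces_le {E a m : Fin (N + 1) → ℝ} {J : Fin N → ℝ} (hm : ∀ n, m n ≤ 2 * E n)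
    (h0 : a 0 ≤ 2 * E 0) (hJ : ∀ i : Fin N, J i ≤ 2 * E i.succ)
    (ha : ∀ i : Fin N, a i.succ ≤ 2 * m i.castSucc + 2 * J i) (hE : ∀ n, 0 ≤ E n)
    (n : Fin (N + 1)) :
    ∑ j ∈ Finset.Iic n, (a j + m j) + 4 * E n ≤ 10 * ∑ j ∈ Finset.Iic n, E j := by
  induction n using Fin.induction with
  | zero => rw [sum_Iic_zero, sum_Iic_zero]; linarith [hm 0, hE 0]
  | succ i ih =>
    rw [sum_Iic_succ, sum_Iic_succ]
    linarith [ha i, hm i.castSucc, hm i.succ, hJ i]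

lemma inner2_add_self_le (u v : VField 𝒯) :
    inner2 (u + v) (u + v) ≤ 2 * inner2 u u + 2 * inner2 v v := by
  have h := inner2_self_nonneg (u + (-1 : ℝ) • v)
  simp only [inner2_add_left, inner2_add_right, inner2_smul_left, inner2_smul_right] at h ⊢
  linarith [inner2_comm u v]

/-- The energies control the traces of `U` from both sides of all time levels. -/
lemma sum_inner2_traces_le {ν τ : ℝ} {δ : 𝒯.Cell → ℝ} (hν : 0 < ν) (hτ : 0 ≤ τ)
    (hδ : ∀ E, 0 ≤ δ E) (U : DG N (VField 𝒯)) (n : Fin (N + 1)) :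
    ∑ j ∈ Finset.Iic n, (inner2 (plus U j) (plus U j) +
      inner2 (minusNext τ U j) (minusNext τ U j)) ≤
      10 * ∑ j ∈ Finset.Iic n, normSq ν τ δ j U U := by
  have hd := fun n : Fin (N + 1) => timeInt_nonneg hτ n fun j t =>
    stabDensity_nonneg hν hδ (tval τ U j t) (tder U j) (tval τ U j t)
  have hm := fun n => inner2_self_nonneg (minusNext τ U n)
  have hp := fun n => inner2_self_nonneg (plus U n)
  have hj := fun n => inner2_self_nonneg (tjump τ U n)
  have hs := fun n : Fin (N + 1) => Finset.sum_nonneg (s := Finset.univ.filter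
    (fun j : Fin N => j.succ ≤ n)) fun j _ => hj j
  have hE : ∀ n, 0 ≤ normSq ν τ δ n U U := fun n => by
    rw [normSq_eq]; linarith [hd n, hm n, hp 0, hs n]
  have h := sum_traces_le (E := fun n => normSq ν τ δ n U U)
    (a := fun j => inner2 (plus U j) (plus U j))
    (m := fun j => inner2 (minusNext τ U j) (minusNext τ U j))
    (J := fun j => inner2 (tjump τ U j) (tjump τ U j))
    (fun n => by simp only [normSq_eq]; linarith [hd n, hm n, hp 0, hs n])
    (by simp only [normSq_eq]; linarith [hd 0, hm 0, hp 0, hs 0])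
    (fun i => by
      simp only [normSq_eq]
      have h1 := Finset.single_le_sum (f := fun j => inner2 (tjump τ U j) (tjump τ U j))
        (s := Finset.univ.filter (fun j : Fin N => j.succ ≤ i.succ)) (fun j _ => hj j)
        (Finset.mem_filter.2 ⟨Finset.mem_univ i, le_rfl⟩)
      linarith [hd i.succ, hm i.succ, hp 0])
    (fun i => by
      have h1 := inner2_add_self_le (minusNext τ U i.castSucc) (tjump τ U i)
      rwa [show minusNext τ U i.castSucc + tjump τ U i = plus U i.succ from
        add_sub_cancel _ _] at h1) hE n
  linarith [hE n]

lemma inner2_tval_le {τ : ℝ} (hτ : 0 < τ) (U : DG N (VField 𝒯)) (j : Fin (N + 1)) {t : ℝ}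
    (ht : t ∈ Set.Icc ((j : ℕ) * τ) (((j : ℕ) + 1) * τ)) :
    inner2 (tval τ U j t) (tval τ U j t) ≤
      inner2 (plus U j) (plus U j) + inner2 (minusNext τ U j) (minusNext τ U j) := by
  obtain ⟨s, hs⟩ : ∃ s, t - (j : ℕ) * τ = s * τ := ⟨(t - (j : ℕ) * τ) / τ, by field_simp⟩
  have hs0 : 0 ≤ s := by
    by_contra hneg
    nlinarith [ht.1]
  have hs1 : s ≤ 1 := by
    by_contra hgt
    nlinarith [ht.2]
  have h1 := inner2_self_nonneg (U j).1
  have h2 := inner2_self_nonneg ((U j).1 + τ • (U j).2)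
  have h3 := inner2_self_nonneg (U j).2
  rw [tval, plus, minusNext, hs]
  simp only [inner2_add_left, inner2_add_right, inner2_smul_left, inner2_smul_right] at h2 ⊢
  rw [inner2_comm (U j).2 (U j).1] at h2 ⊢
  -- Convexity of the squared norm between the two end traces: the first product is the convexity
  -- defect s(1 - s)τ²‖U_t‖², the other two are the unused shares of the end values.
  nlinarith [mul_nonneg (mul_nonneg hs0 (sub_nonneg.2 hs1)) (mul_nonneg (sq_nonneg τ) h3),
    mul_nonneg (sub_nonneg.2 hs1) h2, mul_nonneg hs0 h1]

lemma timeInt_inner2_le {ν τ : ℝ} {δ : 𝒯.Cell → ℝ} (hν : 0 < ν) (hτ : 0 < τ)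
    (hδ : ∀ E, 0 ≤ δ E) (U : DG N (VField 𝒯)) (n : Fin (N + 1)) :
    timeInt τ n (fun j t => inner2 (tval τ U j t) (tval τ U j t)) ≤
      10 * τ * ∑ j ∈ Finset.Iic n, normSq ν τ δ j U U := by
  have h := timeInt_mono hτ.le n (slabIntegrable_inner2 τ U) (h := fun j _ =>
    inner2 (plus U j) (plus U j) + inner2 (minusNext τ U j) (minusNext τ U j))
    (fun j => by simp) fun j => by
      filter_upwards [ae_restrict_mem measurableSet_Icc] with t ht
      exact inner2_tval_le hτ U j ht
  refine h.trans ?_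
  have h1 := mul_le_mul_of_nonneg_left (sum_inner2_traces_le hν hτ.le hδ U n) hτ.le
  simp only [timeInt, intervalIntegral.integral_const, smul_eq_mul]
  rw [Finset.mul_sum] at h1
  refine le_trans (le_of_eq ?_) (h1.trans_eq (by ring))
  exact Finset.sum_congr rfl fun j _ => by ring

end Time

/-! ### The load and its curl -/

section Data

variable {Ω : Set Plane} {𝒯 : Triangulation Ω}

lemma ae_memLp_slice {G : Type*} [NormedAddCommGroup G] {T : ℝ} {g : ℝ → Plane → G}
    (hg : MemLp (fun z : ℝ × Plane => g z.1 z.2) 2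
      ((volume.restrict (Set.Ioo 0 T)).prod (volume.restrict Ω))) :
    ∀ᵐ t ∂(volume.restrict (Set.Ioo 0 T)), MemLp (g t) 2 (volume.restrict Ω) := by
  filter_upwards [hg.1.prodMk_left,
    ((memLp_two_iff_integrable_sq_norm hg.1).1 hg).prod_right_ae] with t h1 h2
  exact (memLp_two_iff_integrable_sq_norm h1).2 h2

/-- Young's inequality under the integral; the condition 4cd ≥ 1 makes the quadratic form
nonnegative. -/
lemma integral_mul_le {α : Type*} [MeasurableSpace α] {μ : Measure α} {f h : α → ℝ} {c d : ℝ}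
    (hc : 0 < c) (hcd : 1 ≤ 4 * c * d) (hf : MemLp f 2 μ) (hh : MemLp h 2 μ) :
    ∫ x, f x * h x ∂μ ≤ c * ∫ x, f x ^ 2 ∂μ + d * ∫ x, h x ^ 2 ∂μ := by
  rw [← integral_const_mul, ← integral_const_mul,
    ← integral_add (hf.integrable_sq.const_mul c) (hh.integrable_sq.const_mul d)]
  refine integral_mono (hf.integrable_mul hh)
    ((hf.integrable_sq.const_mul c).add (hh.integrable_sq.const_mul d)) fun x => ?_
  have h1 : 0 ≤ 4 * c * (c * f x ^ 2 + d * h x ^ 2 - f x * h x) := by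
    nlinarith [sq_nonneg (2 * c * f x - h x), mul_nonneg (sub_nonneg.2 hcd) (sq_nonneg (h x))]
  have h2 := nonneg_of_mul_nonneg_right h1 (by positivity)
  linarith

open Classical in
/-- The pairing of a square integrable function with piecewise polynomials. -/
def pairing (𝒯 : Triangulation Ω) (g : Plane → ℝ) : SField 𝒯 →ₗ[ℝ] ℝ :=
  -- The value 0 for bad g makes the pairing linear for every time slice, although slices of the
  -- data lie in L²(Ω) only for almost every time.
  if h : MemLp g 2 (volume.restrict Ω) ∧ volume Ω < ⊤ then
    { toFun := fun q => ∫ x in Ω, g x * realize q x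
      map_add' := fun p q => by
        simp only [realize_add, mul_add]
        exact integral_add (h.1.integrable_mul (memLp_realize h.2 p 2))
          (h.1.integrable_mul (memLp_realize h.2 q 2))
      map_smul' := fun c q => by
        simp only [realize_smul, mul_left_comm]
        exact integral_const_mul _ _ }
  else 0

lemma pairing_apply (hv : volume Ω < ⊤) {g : Plane → ℝ} (hg : MemLp g 2 (volume.restrict Ω))
    (q : SField 𝒯) : pairing 𝒯 g q = ∫ x in Ω, g x * realize q x := by
  rw [pairing, dif_pos ⟨hg, hv⟩]; rfl

lemma memLp_pval (E : 𝒯.Cell) (p : Poly) : MemLp (pval p) 2 (volume.restrict (carrier E)) :=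
  (memLp_two_iff_integrable_sq (continuous_pval p).aestronglyMeasurable).2
    (((continuous_pval p).pow 2).continuousOn.integrableOn_compact (isCompact_carrier E))

/-- A closed triangle may touch the boundary and leave the open set Ω, but only in a null set. -/
lemma memLp_carrier {g : Plane → ℝ} (hg : MemLp g 2 (volume.restrict Ω)) (E : 𝒯.Cell) :
    MemLp g 2 (volume.restrict (carrier E)) := by
  rw [← Measure.restrict_congr_set (interior_carrier_ae_eq E)]
  exact hg.mono_measure (Measure.restrict_mono (interior_carrier_subset E) le_rfl)

lemma setIntegral_mul_realize {g : Plane → ℝ} (hg : MemLp g 2 (volume.restrict Ω))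
    (q : SField 𝒯) :
    ∫ x in Ω, g x * realize q x = ∑ E, ∫ x in carrier E, g x * pval (q E) x := by
  rw [← setIntegral_sum_indicator (fun E x => g x * pval (q E) x) fun E =>
    IntegrableOn.mono_set ((memLp_carrier hg E).integrable_mul (memLp_pval E (q E)))
      interior_subset]
  congr 1
  funext x
  rw [realize_eq_sum_indicator, Finset.mul_sum]
  exact Finset.sum_congr rfl fun E _ => by
    by_cases hx : x ∈ interior (carrier E) <;> simp [hx]

/-- The load as a functional on piecewise polynomial fields. -/
def loadLin (𝒯 : Triangulation Ω) (f : Plane → Plane) : VField 𝒯 →ₗ[ℝ] ℝ :=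
  ∑ i, pairing 𝒯 (fun x => f x i) ∘ₗ
    LinearMap.pi fun E => (LinearMap.proj i : (Fin 2 → Poly) →ₗ[ℝ] Poly) ∘ₗ
      (LinearMap.proj E : VField 𝒯 →ₗ[ℝ] (Fin 2 → Poly))

lemma memLp_coord {α : Type*} [MeasurableSpace α] {μ : Measure α} {f : α → Plane}
    (hf : MemLp f 2 μ) (i : Fin 2) : MemLp (fun x => f x i) 2 μ :=
  hf.of_le ((EuclideanSpace.proj i : Plane →L[ℝ] ℝ).continuous.comp_aestronglyMeasurable hf.1)
    (ae_of_all _ fun x => PiLp.norm_apply_le (f x) i)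

lemma loadForm_eq_sum (hv : volume Ω < ⊤) {f : Plane → Plane}
    (hf : MemLp f 2 (volume.restrict Ω)) (v : VField 𝒯) :
    loadForm f v = ∑ i, ∫ x in Ω, f x i * realize (fun E => v E i) x :=
  integral_finsetSum _ fun i _ => (memLp_coord hf i).integrable_mul (memLp_realize hv _ 2)

lemma loadForm_eq (hv : volume Ω < ⊤) {f : Plane → Plane} (hf : MemLp f 2 (volume.restrict Ω))
    (v : VField 𝒯) : loadForm f v = loadLin 𝒯 f v := by
  rw [loadForm_eq_sum hv hf, loadLin, LinearMap.sum_apply]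
  refine Finset.sum_congr rfl fun i _ => ?_
  rw [LinearMap.comp_apply, pairing_apply hv (memLp_coord hf i)]
  rfl

lemma setIntegral_realize_sq (q : SField 𝒯) :
    ∫ x in Ω, realize q x ^ 2 = ∑ E, l2Sq E (q E) := by
  simp only [sq, setIntegral_realize_mul, l2Sq]

lemma loadForm_le (hv : volume Ω < ⊤) {f : Plane → Plane} (hf : MemLp f 2 (volume.restrict Ω))
    {c d : ℝ} (hc : 0 < c) (hcd : 1 ≤ 4 * c * d) (v : VField 𝒯) :
    loadForm f v ≤ c * (∫ x in Ω, ‖f x‖ ^ 2) + d * inner2 v v := by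
  rw [loadForm_eq_sum hv hf]
  have h1 : ∫ x in Ω, ‖f x‖ ^ 2 = ∑ i, ∫ x in Ω, f x i ^ 2 := by
    rw [← integral_finsetSum _ fun i _ => (memLp_coord hf i).integrable_sq]
    congr 1
    funext x
    rw [EuclideanSpace.norm_sq_eq]
    simp
  rw [h1, inner2_self_eq, Finset.sum_comm, Finset.mul_sum, Finset.mul_sum,
    ← Finset.sum_add_distrib]
  refine Finset.sum_le_sum fun i _ => ?_
  have h2 := integral_mul_le hc hcd (memLp_coord hf i)
    (memLp_realize hv (fun E : 𝒯.Cell => v E i) 2)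
  rwa [setIntegral_realize_sq] at h2

/-- The test field of the stabilizing right-hand side. -/
def stabField (δ : 𝒯.Cell → ℝ) (w ut u : VField 𝒯) : SField 𝒯 :=
  fun E => δ E • pcurl (material ut u w E)

lemma FForm_eq (hv : volume Ω < ⊤) {κ : Plane → ℝ} (hκ : MemLp κ 2 (volume.restrict Ω))
    (δ : 𝒯.Cell → ℝ) (w ut u : VField 𝒯) :
    FForm δ κ w ut u = pairing 𝒯 κ (stabField δ w ut u) := by
  rw [pairing_apply hv hκ, setIntegral_mul_realize hκ]
  refine Finset.sum_congr rfl fun E _ => ?_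
  rw [← integral_const_mul]
  congr 1
  funext x
  rw [stabField, pval_smul]
  ring

lemma FForm_le {κ : Plane → ℝ} (hκ : MemLp κ 2 (volume.restrict Ω)) {δ : 𝒯.Cell → ℝ}
    (hδ : ∀ E, 0 ≤ δ E) (w ut u : VField 𝒯) :
    FForm δ κ w ut u ≤ 4 * (∑ E : 𝒯.Cell, δ E * ∫ x in carrier E, κ x ^ 2) +
      1 / 16 * ∑ E, δ E * l2Sq E (pcurl (material ut u w E)) := by
  rw [Finset.mul_sum, Finset.mul_sum, ← Finset.sum_add_distrib]
  refine Finset.sum_le_sum fun E _ => ?_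
  have h := integral_mul_le (c := 4) (d := 1 / 16) (by norm_num) (by norm_num)
    (memLp_carrier hκ E) (memLp_pval E (pcurl (material ut u w E)))
  have h' := mul_le_mul_of_nonneg_left h (hδ E)
  unfold l2Sq
  linarith

/-! ### Time-dependent data and their integrals over the slabs. -/

section Slabs

variable {N : ℕ} {T τ : ℝ}

lemma integrable_pairing (hv : volume Ω < ⊤) {g : ℝ → Plane → ℝ}
    (hg : MemLp (fun z : ℝ × Plane => g z.1 z.2) 2
      ((volume.restrict (Set.Ioo 0 T)).prod (volume.restrict Ω))) (q : SField 𝒯) :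
    IntegrableOn (fun t => pairing 𝒯 (g t) q) (Set.Ioo 0 T) := by
  have h1 : MemLp (fun z : ℝ × Plane => realize q z.2) 2
      ((volume.restrict (Set.Ioo 0 T)).prod (volume.restrict Ω)) :=
    (memLp_realize hv q 2).comp_snd _
  have h2 : Integrable (fun z : ℝ × Plane => g z.1 z.2 * realize q z.2)
    ((volume.restrict (Set.Ioo 0 T)).prod (volume.restrict Ω)) := hg.integrable_mul h1
  refine h2.integral_prod_left.congr ?_
  filter_upwards [ae_memLp_slice hg] with t ht
  exact (pairing_apply hv ht q).symm

lemma integrable_loadLin (hv : volume Ω < ⊤) {f : ℝ → Plane → Plane}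
    (hf : MemLp (fun z : ℝ × Plane => f z.1 z.2) 2
      ((volume.restrict (Set.Ioo 0 T)).prod (volume.restrict Ω))) (v : VField 𝒯) :
    IntegrableOn (fun t => loadLin 𝒯 (f t) v) (Set.Ioo 0 T) := by
  simp only [loadLin, LinearMap.sum_apply, LinearMap.comp_apply]
  exact integrable_finsetSum _ fun i _ =>
    integrable_pairing (g := fun t x => f t x i) hv (memLp_coord hf i) _

lemma integrable_carrier {G : ℝ × Plane → ℝ}
    (hG : Integrable G ((volume.restrict (Set.Ioo 0 T)).prod (volume.restrict Ω))) (E : 𝒯.Cell) :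
    IntegrableOn (fun t => ∫ x in carrier E, G (t, x)) (Set.Ioo 0 T) := by
  have h := (hG.indicator
    (MeasurableSet.univ.prod (isOpen_interior (s := carrier E)).measurableSet)).integral_prod_left
  refine h.congr (ae_of_all _ fun t => ?_)
  have h1 : ∀ x, (Set.univ ×ˢ interior (carrier E)).indicator G (t, x) =
      (interior (carrier E)).indicator (fun x => G (t, x)) x := fun x => by
    by_cases hx : x ∈ interior (carrier E) <;> simp [hx]
  simp only [h1]
  rw [setIntegral_indicator isOpen_interior.measurableSet,
    Set.inter_eq_self_of_subset_right (interior_carrier_subset E)]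
  exact setIntegral_congr_set (interior_carrier_ae_eq E)

lemma slab_subset (hτ : 0 ≤ τ) (hT : ((N : ℝ) + 1) * τ = T)
    (j : Fin (N + 1)) :
    Set.Icc ((j : ℕ) * τ) (((j : ℕ) + 1) * τ) ⊆ Set.Icc 0 T := by
  have h1 : ((j : ℕ) : ℝ) + 1 ≤ N + 1 := by exact_mod_cast j.2
  refine Set.Icc_subset_Icc (by positivity) ?_
  rw [← hT]
  exact mul_le_mul_of_nonneg_right h1 hτ

lemma slab_le (hτ : 0 ≤ τ) (j : Fin (N + 1)) : ((j : ℕ) : ℝ) * τ ≤ ((j : ℕ) + 1) * τ := by nlinarith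

lemma ae_slab (hτ : 0 ≤ τ) (hT : ((N : ℝ) + 1) * τ = T)
    {p : ℝ → Prop} (h : ∀ᵐ t ∂(volume.restrict (Set.Ioo 0 T)), p t)
    (j : Fin (N + 1)) :
    ∀ᵐ t ∂(volume.restrict (Set.Icc ((j : ℕ) * τ) (((j : ℕ) + 1) * τ))), p t := by
  rw [Measure.restrict_congr_set Ioo_ae_eq_Icc] at h
  exact ae_mono (Measure.restrict_mono (slab_subset hτ hT j) le_rfl) h

lemma slabIntegrable_of_integrableOn (hτ : 0 ≤ τ) (hT : ((N : ℝ) + 1) * τ = T)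
    {g : ℝ → ℝ} (hg : IntegrableOn g (Set.Ioo 0 T))
    (j : Fin (N + 1)) :
    IntervalIntegrable g volume ((j : ℕ) * τ) (((j : ℕ) + 1) * τ) := by
  rw [intervalIntegrable_iff_integrableOn_Icc_of_le (slab_le hτ j)]
  exact ((integrableOn_Icc_iff_integrableOn_Ioo).2 hg).mono_set (slab_subset hτ hT j)

lemma timeInt_congr_ae (hτ : 0 ≤ τ) (hT : ((N : ℝ) + 1) * τ = T)
    (n : Fin (N + 1)) {g h : Fin (N + 1) → ℝ → ℝ}
    (heq : ∀ᵐ t ∂(volume.restrict (Set.Ioo 0 T)), ∀ j, g j t = h j t) :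
    timeInt τ n g = timeInt τ n h := by
  refine Finset.sum_congr rfl fun j _ => ?_
  refine intervalIntegral.integral_congr_ae_restrict ?_
  rw [Set.uIoc_of_le (slab_le hτ j)]
  filter_upwards [ae_mono (Measure.restrict_mono Set.Ioc_subset_Icc_self le_rfl)
    (ae_slab hτ hT heq j)] with t ht
  exact ht j

/-- The right-hand side through linear functionals. -/
lemma RStab_eq (hτ : 0 ≤ τ) (hT : ((N : ℝ) + 1) * τ = T)
    (hv : volume Ω < ⊤) {f : ℝ → Plane → Plane} {κ : ℝ → Plane → ℝ}
    (hf : MemLp (fun z : ℝ × Plane => f z.1 z.2) 2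
      ((volume.restrict (Set.Ioo 0 T)).prod (volume.restrict Ω)))
    (hκ : MemLp (fun z : ℝ × Plane => κ z.1 z.2) 2
      ((volume.restrict (Set.Ioo 0 T)).prod (volume.restrict Ω)))
    (δ : 𝒯.Cell → ℝ) (n : Fin (N + 1)) (σ : VField 𝒯) (W Z : DG N (VField 𝒯)) :
    RStab τ δ f κ n σ W Z = timeInt τ n (fun j t => loadLin 𝒯 (f t) (tval τ Z j t)) +
      timeInt τ n (fun j t => pairing 𝒯 (κ t)
        (stabField δ (tval τ W j t) (tder Z j) (tval τ Z j t))) + inner2 σ (plus Z 0) := by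
  rw [RStab]
  congr 2
  · refine timeInt_congr_ae hτ hT n ?_
    filter_upwards [ae_memLp_slice hf] with t ht j
    exact loadForm_eq hv ht _
  · refine timeInt_congr_ae hτ hT n ?_
    filter_upwards [ae_memLp_slice hκ] with t ht j
    exact FForm_eq hv ht _ _ _ _

section SepData

variable {X : Type*} [NormedAddCommGroup X] [NormedSpace ℝ X]

lemma SepDG.stabField {W Z : X → DG N (VField 𝒯)} (hW : SepDG W) (hZ : SepDG Z) (τ : ℝ)
    (δ : 𝒯.Cell → ℝ) (j : Fin (N + 1)) :
    Sep fun x t => stabField δ (VortStab.tval τ (W x) j t) (VortStab.tder (Z x) j)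
      (VortStab.tval τ (Z x) j t) := by
  classical
  have h : Sep fun x t => ∑ E : 𝒯.Cell, LinearMap.single ℝ (fun _ : 𝒯.Cell => Poly) E
      (δ E • pcurl (material (VortStab.tder (Z x) j) (VortStab.tval τ (Z x) j t)
        (VortStab.tval τ (W x) j t) E)) :=
    -- A piecewise field is the sum of its one-element pieces, each the image of a separated
    -- polynomial family under a linear inclusion.
    Sep.sum _ fun E _ => (((hZ.tder j).pcurl_material (hZ.tval τ j) (hW.tval τ j) E).map
      (LinearMap.lsmul ℝ Poly (δ E))).map (LinearMap.single ℝ (fun _ : 𝒯.Cell => Poly) E)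
  convert h using 3 with x t
  funext E
  simp [VortStab.stabField, Finset.sum_apply, Pi.single_apply]

lemma slabIntegrable_functional (hτ : 0 ≤ τ) (hT : ((N : ℝ) + 1) * τ = T)
    {M : Type*} [AddCommGroup M] [Module ℝ M]
    {Λ : ℝ → M →ₗ[ℝ] ℝ} (hΛ : ∀ m, IntegrableOn (fun t => Λ t m) (Set.Ioo 0 T))
    {Φ : Fin (N + 1) → X → ℝ → M} (hΦ : ∀ j, Sep (Φ j)) (x : X) :
    SlabIntegrable τ fun j t => Λ t (Φ j x t) := fun j =>
  ((hΦ j).integral_functional fun m => slabIntegrable_of_integrableOn hτ hT (hΛ m) j).1 x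

lemma contDiff_timeInt_functional (hτ : 0 ≤ τ) (hT : ((N : ℝ) + 1) * τ = T)
    {M : Type*} [AddCommGroup M] [Module ℝ M]
    {Λ : ℝ → M →ₗ[ℝ] ℝ} (hΛ : ∀ m, IntegrableOn (fun t => Λ t m) (Set.Ioo 0 T))
    {Φ : Fin (N + 1) → X → ℝ → M} (hΦ : ∀ j, Sep (Φ j)) (n : Fin (N + 1)) :
    ContDiff ℝ 1 fun x => timeInt τ n fun j t => Λ t (Φ j x t) :=
  ContDiff.sum fun j _ =>
    ((hΦ j).integral_functional fun m => slabIntegrable_of_integrableOn hτ hT (hΛ m) j).2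

lemma contDiff_RStab (hτ : 0 ≤ τ) (hT : ((N : ℝ) + 1) * τ = T)
    (hv : volume Ω < ⊤) {f : ℝ → Plane → Plane} {κ : ℝ → Plane → ℝ}
    (hf : MemLp (fun z : ℝ × Plane => f z.1 z.2) 2
      ((volume.restrict (Set.Ioo 0 T)).prod (volume.restrict Ω)))
    (hκ : MemLp (fun z : ℝ × Plane => κ z.1 z.2) 2
      ((volume.restrict (Set.Ioo 0 T)).prod (volume.restrict Ω)))
    (δ : 𝒯.Cell → ℝ) (n : Fin (N + 1)) (σ : VField 𝒯) {W Z : X → DG N (VField 𝒯)}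
    (hW : SepDG W) (hZ : SepDG Z) :
    ContDiff ℝ 1 fun x => RStab τ δ f κ n σ (W x) (Z x) := by
  simp only [RStab_eq hτ hT hv hf hκ]
  refine (ContDiff.add ?_ ?_).add ?_
  · exact contDiff_timeInt_functional hτ hT (integrable_loadLin hv hf)
      (fun j => hZ.tval τ j) n
  · exact contDiff_timeInt_functional hτ hT (integrable_pairing hv hκ)
      (fun j => hW.stabField hZ τ δ j) n
  · exact ((Sep.const σ).inner2 (hZ 0).1).contDiff 0

end SepData

/-- The data control the right-hand side up to a small part of the energy. -/
lemma RStab_le (hτ : 0 ≤ τ) (hT : ((N : ℝ) + 1) * τ = T)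
    (hv : volume Ω < ⊤) (hTpos : 0 < T) {f : ℝ → Plane → Plane}
    {κ : ℝ → Plane → ℝ}
    (hf : MemLp (fun z : ℝ × Plane => f z.1 z.2) 2
      ((volume.restrict (Set.Ioo 0 T)).prod (volume.restrict Ω)))
    (hκ : MemLp (fun z : ℝ × Plane => κ z.1 z.2) 2
      ((volume.restrict (Set.Ioo 0 T)).prod (volume.restrict Ω)))
    {ν : ℝ} (hν : 0 < ν) {δ : 𝒯.Cell → ℝ} (hδ : ∀ E, 0 ≤ δ E) (n : Fin (N + 1)) (U₀ : VField 𝒯)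
    (U : DG N (VField 𝒯)) :
    RStab τ δ f κ n U₀ U U ≤ (8 + 80 * T) * dataTerm τ δ f κ U₀ n +
      1 / (320 * T) * timeInt τ n (fun j t => inner2 (tval τ U j t) (tval τ U j t)) +
      1 / 16 * normSq ν τ δ n U U := by
  have hF : IntegrableOn (fun t => ∫ x in Ω, ‖f t x‖ ^ 2) (Set.Ioo 0 T) :=
    ((memLp_two_iff_integrable_sq_norm hf.1).1 hf).integral_prod_left
  have hK : ∀ E : 𝒯.Cell, IntegrableOn (fun t => ∫ x in carrier E, κ t x ^ 2) (Set.Ioo 0 T) :=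
    fun E => integrable_carrier (G := fun z => κ z.1 z.2 ^ 2) hκ.integrable_sq E
  have hFs : SlabIntegrable τ fun (_ : Fin (N + 1)) t => ∫ x in Ω, ‖f t x‖ ^ 2 :=
    slabIntegrable_of_integrableOn hτ hT hF
  have hKs : ∀ E : 𝒯.Cell, SlabIntegrable τ fun (_ : Fin (N + 1)) t =>
      ∫ x in carrier E, κ t x ^ 2 := fun E => slabIntegrable_of_integrableOn hτ hT (hK E)
  have hsep := sepDG_self U
  have hload : timeInt τ n (fun j t => loadForm (f t) (tval τ U j t)) ≤
      80 * T * (∫ t in (0 : ℝ)..(((n : ℕ) + 1) * τ), ∫ x in Ω, ‖f t x‖ ^ 2) +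
      1 / (320 * T) * timeInt τ n (fun j t => inner2 (tval τ U j t) (tval τ U j t)) := by
    -- Integrability in time is available for the linear functional, which agrees with the load form
    -- at almost every time. The Young weights 80T and 1/(320T) have product 1/4.
    rw [timeInt_congr_ae hτ hT n (h := fun j t => loadLin 𝒯 (f t) (tval τ U j t)) (by
      filter_upwards [ae_memLp_slice hf] with t ht j
      exact loadForm_eq hv ht _), ← (timeInt_eq_integral hFs n).2, ← timeInt_const_mul,
      ← timeInt_const_mul, ← timeInt_add n (hFs.const_mul _)
        ((slabIntegrable_inner2 τ U).const_mul _)]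
    refine timeInt_mono hτ n
      (slabIntegrable_functional hτ hT (integrable_loadLin hv hf) (fun j => hsep.tval τ j) 0)
      ((hFs.const_mul _).add ((slabIntegrable_inner2 τ U).const_mul _)) fun j => ?_
    filter_upwards [ae_slab hτ hT (ae_memLp_slice hf) j] with t ht
    rw [← loadForm_eq hv ht]
    refine loadForm_le hv ht (by positivity) (le_of_eq ?_) _
    field_simp
    norm_num
  have hl2 := fun E => (slabIntegrable_l2Sq τ U E).const_mul (δ E)
  have hl2s := (SlabIntegrable.sum Finset.univ fun E _ => hl2 E).const_mul (1 / 16)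
  have hKδ := fun E => (hKs E).const_mul (δ E)
  have hKδs := (SlabIntegrable.sum Finset.univ fun E _ => hKδ E).const_mul 4
  have hcurl : timeInt τ n (fun j t => FForm δ (κ t) (tval τ U j t) (tder U j) (tval τ U j t)) ≤
      4 * (∑ E : 𝒯.Cell, δ E * ∫ t in (0 : ℝ)..(((n : ℕ) + 1) * τ),
        ∫ x in carrier E, κ t x ^ 2) +
      1 / 16 * timeInt τ n (fun j t =>
        ∑ E, δ E * l2Sq E (pcurl (material (tder U j) (tval τ U j t) (tval τ U j t) E))) := by
    have h1 : ∑ E : 𝒯.Cell, δ E * ∫ t in (0 : ℝ)..(((n : ℕ) + 1) * τ),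
        ∫ x in carrier E, κ t x ^ 2 =
        timeInt τ n fun _ t => ∑ E : 𝒯.Cell, δ E * ∫ x in carrier E, κ t x ^ 2 := by
      rw [timeInt_sum n _ fun E _ => hKδ E]
      refine Finset.sum_congr rfl fun E _ => ?_
      rw [timeInt_const_mul, ← (timeInt_eq_integral (hKs E) n).2]
    rw [timeInt_congr_ae hτ hT n (h := fun j t => pairing 𝒯 (κ t)
        (stabField δ (tval τ U j t) (tder U j) (tval τ U j t))) (by
      filter_upwards [ae_memLp_slice hκ] with t ht j
      exact FForm_eq hv ht _ _ _ _), h1, ← timeInt_const_mul, ← timeInt_const_mul,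
      ← timeInt_add n hKδs hl2s]
    refine timeInt_mono hτ n (slabIntegrable_functional hτ hT (integrable_pairing hv hκ)
      (fun j => hsep.stabField hsep τ δ j) 0) (hKδs.add hl2s) fun j => ?_
    filter_upwards [ae_slab hτ hT (ae_memLp_slice hκ) j] with t ht
    rw [← FForm_eq hv ht]
    exact FForm_le ht hδ _ _ _
  -- The weight 1/32 is exactly the share of the initial trace in 1/16 of the energy, where that
  -- trace carries the factor 1/2.
  have hinit : inner2 U₀ (plus U 0) ≤
      8 * inner2 U₀ U₀ + 1 / 32 * inner2 (plus U 0) (plus U 0) := by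
    have h := inner2_self_nonneg ((16 : ℝ) • U₀ + (-1 : ℝ) • plus U 0)
    simp only [inner2_add_left, inner2_add_right, inner2_smul_left, inner2_smul_right] at h
    linarith [inner2_comm (plus U 0) U₀]
  have hden : timeInt τ n (fun j t =>
      ∑ E, δ E * l2Sq E (pcurl (material (tder U j) (tval τ U j t) (tval τ U j t) E))) ≤
      timeInt τ n fun j t => stabDensity ν δ (tval τ U j t) (tder U j) (tval τ U j t) :=
    timeInt_mono hτ n (SlabIntegrable.sum Finset.univ fun E _ => hl2 E)
      (slabIntegrable_stabDensity ν τ δ U) fun j => ae_of_all _ fun t => by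
        have h1 := mul_nonneg hν.le (aForm_self_nonneg (tval τ U j t))
        have h2 : 0 ≤ ∑ E, diam E ^ 2 / 2 * bdryJumps (convField (tval τ U j t) (tval τ U j t))
            (convField (tval τ U j t) (tval τ U j t)) E :=
          Finset.sum_nonneg fun E _ => mul_nonneg (by positivity) (bdryJumps_self_nonneg _ E)
        unfold stabDensity
        linarith
  have hm := inner2_self_nonneg (minusNext τ U n)
  have hp := inner2_self_nonneg (plus U 0)
  have hj : 0 ≤ ∑ j : Fin N with j.succ ≤ n, inner2 (tjump τ U j) (tjump τ U j) :=
    Finset.sum_nonneg fun j _ => inner2_self_nonneg _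
  have hU0 := inner2_self_nonneg U₀
  have hn : (0 : ℝ) ≤ ((n : ℕ) + 1) * τ := by positivity
  have hFn : 0 ≤ ∫ t in (0 : ℝ)..(((n : ℕ) + 1) * τ), ∫ x in Ω, ‖f t x‖ ^ 2 :=
    intervalIntegral.integral_nonneg hn fun t _ => integral_nonneg fun x => by positivity
  have hKn : 0 ≤ ∑ E : 𝒯.Cell, δ E * ∫ t in (0 : ℝ)..(((n : ℕ) + 1) * τ),
      ∫ x in carrier E, κ t x ^ 2 :=
    Finset.sum_nonneg fun E _ => mul_nonneg (hδ E) (intervalIntegral.integral_nonneg hn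
      fun t _ => integral_nonneg fun x => by positivity)
  rw [normSq_eq, RStab, dataTerm]
  nlinarith [mul_nonneg hTpos.le hU0, mul_nonneg hTpos.le hKn]

lemma dataTerm_mono (hτ : 0 ≤ τ) (hT : ((N : ℝ) + 1) * τ = T)
    {f : ℝ → Plane → Plane} {κ : ℝ → Plane → ℝ}
    (hf : MemLp (fun z : ℝ × Plane => f z.1 z.2) 2
      ((volume.restrict (Set.Ioo 0 T)).prod (volume.restrict Ω)))
    (hκ : MemLp (fun z : ℝ × Plane => κ z.1 z.2) 2
      ((volume.restrict (Set.Ioo 0 T)).prod (volume.restrict Ω)))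
    {δ : 𝒯.Cell → ℝ} (hδ : ∀ E, 0 ≤ δ E) (U₀ : VField 𝒯) {j n : Fin (N + 1)} (hjn : j ≤ n) :
    dataTerm τ δ f κ U₀ j ≤ dataTerm τ δ f κ U₀ n := by
  have hF : IntegrableOn (fun t => ∫ x in Ω, ‖f t x‖ ^ 2) (Set.Ioo 0 T) :=
    ((memLp_two_iff_integrable_sq_norm hf.1).1 hf).integral_prod_left
  have hK : ∀ E : 𝒯.Cell, IntegrableOn (fun t => ∫ x in carrier E, κ t x ^ 2) (Set.Ioo 0 T) :=
    fun E => integrable_carrier (G := fun z => κ z.1 z.2 ^ 2) hκ.integrable_sq E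
  have hjn' : ((j : ℕ) + 1 : ℝ) * τ ≤ ((n : ℕ) + 1) * τ := by
    have : ((j : ℕ) : ℝ) ≤ (n : ℕ) := by exact_mod_cast hjn
    exact mul_le_mul_of_nonneg_right (by linarith) hτ
  have key : ∀ g : ℝ → ℝ, (∀ t, 0 ≤ g t) → IntegrableOn g (Set.Ioo 0 T) →
      ∫ t in (0 : ℝ)..(((j : ℕ) + 1) * τ), g t ≤ ∫ t in (0 : ℝ)..(((n : ℕ) + 1) * τ), g t :=
    fun g hg hi => intervalIntegral.integral_mono_interval le_rfl (by positivity) hjn'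
      (ae_of_all _ hg) (timeInt_eq_integral (N := N)
        (slabIntegrable_of_integrableOn hτ hT hi) n).1
  unfold dataTerm
  refine add_le_add (add_le_add le_rfl (key _ (fun t => integral_nonneg fun x => by positivity) hF))
    (Finset.sum_le_sum fun E _ => mul_le_mul_of_nonneg_left
      (key _ (fun t => integral_nonneg fun x => by positivity) (hK E)) (hδ E))

end Slabs

end Data

/-! ### The residual, truncated test functions and the main theorem -/

section Residual

variable {Ω : Set Plane} {𝒯 : Triangulation Ω} {N : ℕ} {T τ ν : ℝ} {δ : 𝒯.Cell → ℝ}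
  {f : ℝ → Plane → Plane} {κ : ℝ → Plane → ℝ} {U₀ : VField 𝒯}

/-- The residual of the discrete kernel problem. -/
def residual (ν τ : ℝ) (δ : 𝒯.Cell → ℝ) (f : ℝ → Plane → Plane) (κ : ℝ → Plane → ℝ)
    (U₀ : VField 𝒯) (U V : DG N (VField 𝒯)) : ℝ :=
  AStab ν τ δ (Fin.last N) U U U V - RStab τ δ f κ (Fin.last N) U₀ U V

lemma tval_add (τ : ℝ) (U V : DG N (VField 𝒯)) (j : Fin (N + 1)) (t : ℝ) :
    tval τ (U + V) j t = tval τ U j t + tval τ V j t := by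
  simp only [tval, Pi.add_apply, Prod.fst_add, Prod.snd_add, smul_add]; abel

lemma tval_smul (τ c : ℝ) (V : DG N (VField 𝒯)) (j : Fin (N + 1)) (t : ℝ) :
    tval τ (c • V) j t = c • tval τ V j t := by
  simp only [tval, Pi.smul_apply, Prod.smul_fst, Prod.smul_snd, smul_add, smul_comm c]

lemma tder_add (U V : DG N (VField 𝒯)) (j : Fin (N + 1)) :
    tder (U + V) j = tder U j + tder V j := rfl

lemma tder_smul (c : ℝ) (V : DG N (VField 𝒯)) (j : Fin (N + 1)) :
    tder (c • V) j = c • tder V j := rfl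

lemma plus_add (U V : DG N (VField 𝒯)) (j : Fin (N + 1)) :
    plus (U + V) j = plus U j + plus V j := rfl

lemma plus_smul (c : ℝ) (V : DG N (VField 𝒯)) (j : Fin (N + 1)) :
    plus (c • V) j = c • plus V j := rfl

lemma AStab_add (n : Fin (N + 1)) (U V V' : DG N (VField 𝒯)) :
    AStab ν τ δ n U U U (V + V') = AStab ν τ δ n U U U V + AStab ν τ δ n U U U V' := by
  have hi : ∀ V : DG N (VField 𝒯), SlabIntegrable τ fun j t => inner2 (tder U j) (tval τ V j t) :=
    fun V => SlabIntegrable.of_continuous fun j =>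
      (((sepDG_self U).tder j).inner2 ((sepDG_self V).tval τ j)).continuous 0
  simp only [AStab, tval_add, tder_add, plus_add, inner2_add_right, KForm_add,
    Finset.sum_add_distrib]
  rw [timeInt_add n (hi V) (hi V'),
    timeInt_add n (slabIntegrable_KForm ν τ δ U V) (slabIntegrable_KForm ν τ δ U V')]
  ring

lemma AStab_smul (n : Fin (N + 1)) (c : ℝ) (U V : DG N (VField 𝒯)) :
    AStab ν τ δ n U U U (c • V) = c * AStab ν τ δ n U U U V := by
  simp only [AStab, tval_smul, tder_smul, plus_smul, inner2_smul_right, KForm_smul,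
    timeInt_const_mul, ← Finset.mul_sum]
  ring

lemma stabField_add (w ut ut' u u' : VField 𝒯) :
    stabField δ w (ut + ut') (u + u') = stabField δ w ut u + stabField δ w ut' u' := by
  funext E; simp only [stabField, material_add, pcurl_add, smul_add, Pi.add_apply]

lemma stabField_smul (c : ℝ) (w ut u : VField 𝒯) :
    stabField δ w (c • ut) (c • u) = c • stabField δ w ut u := by
  funext E; simp only [stabField, material_smul, pcurl_smul, Pi.smul_apply, smul_comm c]

/-- Linearity of the residual in the test function. -/
lemma exists_residual_linear (hτ : 0 ≤ τ) (hT : ((N : ℝ) + 1) * τ = T) (hv : volume Ω < ⊤)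
    (hf : MemLp (fun z : ℝ × Plane => f z.1 z.2) 2
      ((volume.restrict (Set.Ioo 0 T)).prod (volume.restrict Ω)))
    (hκ : MemLp (fun z : ℝ × Plane => κ z.1 z.2) 2
      ((volume.restrict (Set.Ioo 0 T)).prod (volume.restrict Ω))) (U : DG N (VField 𝒯)) :
    ∃ L : DG N (VField 𝒯) →ₗ[ℝ] ℝ, ∀ V, L V = residual ν τ δ f κ U₀ U V := by
  have h1 : ∀ V : DG N (VField 𝒯), SlabIntegrable τ fun j t => loadLin 𝒯 (f t) (tval τ V j t) :=
    fun V => slabIntegrable_functional hτ hT (integrable_loadLin hv hf)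
      (fun j => (sepDG_self V).tval τ j) 0
  have h2 : ∀ V : DG N (VField 𝒯), SlabIntegrable τ fun j t =>
      pairing 𝒯 (κ t) (stabField δ (tval τ U j t) (tder V j) (tval τ V j t)) :=
    fun V => slabIntegrable_functional hτ hT (integrable_pairing hv hκ)
      (fun j => (sepDG_self U).stabField (sepDG_self V) τ δ j) 0
  refine ⟨⟨⟨residual ν τ δ f κ U₀ U, fun V V' => ?_⟩, fun c V => ?_⟩, fun V => rfl⟩
  · simp only [residual, AStab_add, RStab_eq hτ hT hv hf hκ, tval_add, tder_add, plus_add,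
      stabField_add, map_add, inner2_add_right]
    rw [timeInt_add _ (h1 V) (h1 V'), timeInt_add _ (h2 V) (h2 V')]
    ring
  · simp only [residual, AStab_smul, RStab_eq hτ hT hv hf hκ, tval_smul, tder_smul, plus_smul,
      stabField_smul, map_smul, inner2_smul_right, smul_eq_mul, timeInt_const_mul,
      RingHom.id_apply]
    ring

/-- Restriction of a discrete function of time to the first time slabs. -/
def trunc (n : Fin (N + 1)) : DG N (VField 𝒯) →ₗ[ℝ] DG N (VField 𝒯) :=
  LinearMap.pi fun j => if j ≤ n then LinearMap.proj j else 0

lemma trunc_apply (n : Fin (N + 1)) (U : DG N (VField 𝒯)) (j : Fin (N + 1)) :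
    trunc n U j = if j ≤ n then U j else 0 := by
  simp only [trunc, LinearMap.pi_apply]
  split_ifs <;> rfl

lemma KForm_zero_right (ν : ℝ) (δ : 𝒯.Cell → ℝ) (w₁ w₂ ut u : VField 𝒯) :
    KForm ν δ w₁ w₂ ut u 0 0 = 0 := by
  have h := KForm_smul ν δ 0 w₁ w₂ ut u 0 0
  simpa using h

lemma inner2_zero_right (u : VField 𝒯) : inner2 u 0 = 0 := by
  have h := inner2_smul_right 0 u 0
  simpa using h

lemma FForm_zero_right (δ : 𝒯.Cell → ℝ) (κ : Plane → ℝ) (w : VField 𝒯) :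
    FForm δ κ w 0 0 = 0 := by
  have h : ∀ E : 𝒯.Cell, pcurl (material 0 0 w E) = 0 := fun E => by
    have h1 := material_smul 0 0 0 w E
    have h2 := pcurl_smul 0 (material 0 0 w E)
    simp only [smul_zero, zero_smul] at h1 h2
    rw [h1]
    exact h2
  simp [FForm, h, pval_zero]

lemma loadForm_zero_right (f : Plane → Plane) : loadForm f (0 : VField 𝒯) = 0 := by
  simp [loadForm, realize, pval_zero]

/-- The discontinuous test space admits a cutoff in time. The jump at the cutoff level is paired
with the right trace of the test function, which is zero, so the cutoff leaves no boundary term and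
the forms up to level n reappear. -/
lemma residual_trunc (n : Fin (N + 1)) (U : DG N (VField 𝒯)) :
    residual ν τ δ f κ U₀ U (trunc n U) =
      AStab ν τ δ n U U U U - RStab τ δ f κ n U₀ U U := by
  have hin : ∀ j ≤ n, trunc n U j = U j := fun j hj => by rw [trunc_apply, if_pos hj]
  have hout : ∀ j, n < j → trunc n U j = 0 := fun j hj => by
    rw [trunc_apply, if_neg (not_le.2 hj)]
  have hv0 : ∀ j, n < j → ∀ t, tval τ (trunc n U) j t = 0 := fun j hj t => by
    rw [tval, hout j hj]; simp
  have hd0 : ∀ j, n < j → tder (trunc n U) j = 0 := fun j hj => by rw [tder, hout j hj]; rfl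
  have hv1 : ∀ j ≤ n, ∀ t, tval τ (trunc n U) j t = tval τ U j t := fun j hj t => by
    rw [tval, hin j hj, tval]
  have hd1 : ∀ j ≤ n, tder (trunc n U) j = tder U j := fun j hj => by rw [tder, hin j hj, tder]
  have hjump : ∑ j : Fin N with j.succ ≤ Fin.last N, inner2 (tjump τ U j)
      (plus (trunc n U) j.succ) =
      ∑ j : Fin N with j.succ ≤ n, inner2 (tjump τ U j) (plus U j.succ) := by
    simp only [Finset.sum_filter, Fin.le_last, if_true]
    refine Finset.sum_congr rfl fun j _ => ?_
    split_ifs with hj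
    · rw [plus, hin _ hj, plus]
    · rw [plus, hout _ (not_le.1 hj)]; exact inner2_zero_right _
  have h0 : plus (trunc n U) 0 = plus U 0 := by rw [plus, hin 0 (Fin.zero_le n), plus]
  rw [residual, AStab, RStab, AStab, RStab, hjump, h0,
    timeInt_last_eq (n := n) (g := fun j t => inner2 (tder U j) (tval τ U j t))
      (fun j hj t => by rw [hv1 j hj]) (fun j hj t => by rw [hv0 j hj, inner2_zero_right]),
    timeInt_last_eq (n := n) (g := fun j t => KForm ν δ (tval τ U j t) (tval τ U j t) (tder U j)
      (tval τ U j t) (tder U j) (tval τ U j t))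
      (fun j hj t => by rw [hv1 j hj, hd1 j hj])
      (fun j hj t => by rw [hv0 j hj, hd0 j hj, KForm_zero_right]),
    timeInt_last_eq (n := n) (g := fun j t => loadForm (f t) (tval τ U j t))
      (fun j hj t => by rw [hv1 j hj]) (fun j hj t => by rw [hv0 j hj, loadForm_zero_right]),
    timeInt_last_eq (n := n) (g := fun j t =>
      FForm δ (κ t) (tval τ U j t) (tder U j) (tval τ U j t))
      (fun j hj t => by rw [hv1 j hj, hd1 j hj])
      (fun j hj t => by rw [hv0 j hj, hd0 j hj, FForm_zero_right])]

lemma normSq_nonneg (hν : 0 < ν) (hτ : 0 ≤ τ) (hδ : ∀ E, 0 ≤ δ E) (n : Fin (N + 1))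
    (U : DG N (VField 𝒯)) : 0 ≤ normSq ν τ δ n U U := by
  rw [normSq_eq]
  have h1 := timeInt_nonneg hτ n fun j t =>
    stabDensity_nonneg hν hδ (tval τ U j t) (tder U j) (tval τ U j t)
  have h2 := inner2_self_nonneg (minusNext τ U n)
  have h3 := inner2_self_nonneg (plus U 0)
  have h4 : 0 ≤ ∑ j : Fin N with j.succ ≤ n, inner2 (tjump τ U j) (tjump τ U j) :=
    Finset.sum_nonneg fun j _ => inner2_self_nonneg _
  linarith

/-- The common source of estimate and existence: 1/8 from coercivity minus 1/16 spent on the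
right-hand side. The coefficient of the energy sum is 10τ/(320T) with T = (N + 1)τ. -/
lemma le_residual_trunc (hΩ : IsOpen Ω) (hv : volume Ω < ⊤) {k : ℕ} {S : FEPair 𝒯 k}
    (hν : 0 < ν) (hτ : 0 < τ) (hT : ((N : ℝ) + 1) * τ = T) (hδ : ∀ E, 0 ≤ δ E)
    (hδle : ∀ E, δ E ≤ diam E ^ 4 / (ν * gammaE (k + 2) E ^ 2))
    (hf : MemLp (fun z : ℝ × Plane => f z.1 z.2) 2
      ((volume.restrict (Set.Ioo 0 T)).prod (volume.restrict Ω)))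
    (hκ : MemLp (fun z : ℝ × Plane => κ z.1 z.2) 2
      ((volume.restrict (Set.Ioo 0 T)).prod (volume.restrict Ω)))
    {U : DG N (VField 𝒯)} (hU : U ∈ S.Zτ N) (n : Fin (N + 1)) :
    1 / 16 * normSq ν τ δ n U U - (8 + 80 * T) * dataTerm τ δ f κ U₀ n -
      1 / (32 * (N + 1)) * ∑ j ∈ Finset.Iic n, normSq ν τ δ j U U ≤
      residual ν τ δ f κ U₀ U (trunc n U) := by
  have hTpos : 0 < T := by rw [← hT]; positivity
  have h1 := le_AStab_self hΩ hv hν hτ.le hδ hδle hU n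
  have h2 := RStab_le hτ.le hT hv hTpos hf hκ hν hδ n U₀ U
  have h3 := mul_le_mul_of_nonneg_left (timeInt_inner2_le hν hτ hδ U n)
    (show 0 ≤ 1 / (320 * T) by positivity)
  have h4 : 1 / (320 * T) * (10 * τ * ∑ j ∈ Finset.Iic n, normSq ν τ δ j U U) =
      1 / (32 * (N + 1)) * ∑ j ∈ Finset.Iic n, normSq ν τ δ j U U := by
    rw [← hT]
    field_simp
    ring
  rw [residual_trunc]
  linarith

/-- The a priori estimate. -/
theorem normSq_le_of_isSolution (hΩ : IsOpen Ω) (hv : volume Ω < ⊤) {k : ℕ} {S : FEPair 𝒯 k}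
    (hν : 0 < ν) (hτ : 0 < τ) (hT : ((N : ℝ) + 1) * τ = T) (hδ : ∀ E, 0 ≤ δ E)
    (hδle : ∀ E, δ E ≤ diam E ^ 4 / (ν * gammaE (k + 2) E ^ 2))
    (hf : MemLp (fun z : ℝ × Plane => f z.1 z.2) 2
      ((volume.restrict (Set.Ioo 0 T)).prod (volume.restrict Ω)))
    (hκ : MemLp (fun z : ℝ × Plane => κ z.1 z.2) 2
      ((volume.restrict (Set.Ioo 0 T)).prod (volume.restrict Ω)))
    {U : DG N (VField 𝒯)} (hU : IsSolution S ν τ δ f κ U₀ U) (n : Fin (N + 1)) :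
    normSq ν τ δ n U U ≤ 32 * (8 + 80 * T) * dataTerm τ δ f κ U₀ n := by
  have hTpos : 0 < T := by rw [← hT]; positivity
  -- Truncating at the level of largest energy bounds the energy sum by (N + 1) times that energy,
  -- so half of the coefficient 1/16 remains.
  obtain ⟨j, hj, hmax⟩ := Finset.exists_max_image (Finset.Iic n)
    (fun j => normSq ν τ δ j U U) ⟨n, Finset.mem_Iic.2 le_rfl⟩
  have hjn : j ≤ n := Finset.mem_Iic.1 hj
  have htr : trunc j U ∈ S.Zτ N := fun i => by
    rw [trunc_apply]
    split_ifs
    · exact hU.1 i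
    · exact ⟨S.kernel.zero_mem, S.kernel.zero_mem⟩
  have hres : residual ν τ δ f κ U₀ U (trunc j U) = 0 := sub_eq_zero.2 (hU.2 _ htr)
  have h1 := le_residual_trunc (U₀ := U₀) hΩ hv hν hτ hT hδ hδle hf hκ hU.1 j
  rw [hres] at h1
  have hE := normSq_nonneg hν hτ.le hδ j U
  have hsum : ∑ i ∈ Finset.Iic j, normSq ν τ δ i U U ≤ (N + 1) * normSq ν τ δ j U U := by
    have h2 := Finset.sum_le_card_nsmul (Finset.Iic j) (fun i => normSq ν τ δ i U U)
      (normSq ν τ δ j U U) fun i hi =>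
        hmax i (Finset.mem_Iic.2 ((Finset.mem_Iic.1 hi).trans hjn))
    rw [nsmul_eq_mul] at h2
    refine h2.trans (mul_le_mul_of_nonneg_right ?_ hE)
    have h3 : (Finset.Iic j).card ≤ N + 1 := by
      simpa using Finset.card_le_univ (Finset.Iic j)
    exact_mod_cast h3
  have hN : (0 : ℝ) < N + 1 := by positivity
  have h4 : 1 / (32 * ((N : ℝ) + 1)) * ∑ i ∈ Finset.Iic j, normSq ν τ δ i U U ≤
      1 / 32 * normSq ν τ δ j U U := by
    refine (mul_le_mul_of_nonneg_left hsum (by positivity)).trans_eq ?_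
    field_simp
  have h5 := mul_le_mul_of_nonneg_left (dataTerm_mono hτ.le hT hf hκ hδ U₀ hjn)
    (show 0 ≤ 8 + 80 * T by positivity)
  have h6 := hmax n (Finset.mem_Iic.2 le_rfl)
  linarith

/-! ### Finite dimension and existence. -/

/-- The space `Z_h^τ`. -/
def FEPair.kernelDG {k : ℕ} (S : FEPair 𝒯 k) (N : ℕ) : Submodule ℝ (DG N (VField 𝒯)) where
  carrier := S.Zτ N
  zero_mem' _ := ⟨S.kernel.zero_mem, S.kernel.zero_mem⟩
  add_mem' hu hv n := ⟨S.kernel.add_mem (hu n).1 (hv n).1, S.kernel.add_mem (hu n).2 (hv n).2⟩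
  smul_mem' c _ hv n := ⟨S.kernel.smul_mem c (hv n).1, S.kernel.smul_mem c (hv n).2⟩

/-- The ambient space of all piecewise polynomials is infinite-dimensional; the uniform degree bound
on the finitely many elements gives finiteness. -/
lemma finiteDimensional_kernel {k : ℕ} (S : FEPair 𝒯 k) : FiniteDimensional ℝ S.kernel := by
  let D := MvPolynomial.restrictTotalDegree (Fin 2) ℝ (k + 3)
  let F : S.kernel →ₗ[ℝ] (𝒯.Cell → Fin 2 → D) :=
    { toFun := fun v E i => ⟨v.1 E i, (MvPolynomial.mem_restrictTotalDegree _ _ _).2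
        (S.degree_le v.1 v.2.1 E i)⟩
      map_add' := fun _ _ => rfl
      map_smul' := fun _ _ => rfl }
  refine FiniteDimensional.of_injective F fun u v huv => Subtype.ext ?_
  funext E i
  exact congrArg Subtype.val (congrFun (congrFun huv E) i)

lemma finiteDimensional_kernelDG {k : ℕ} (S : FEPair 𝒯 k) (N : ℕ) :
    FiniteDimensional ℝ (S.kernelDG N) := by
  have := finiteDimensional_kernel S
  let F : S.kernelDG N →ₗ[ℝ] (Fin (N + 1) → S.kernel × S.kernel) :=
    { toFun := fun U n => (⟨(U.1 n).1, (U.2 n).1⟩, ⟨(U.1 n).2, (U.2 n).2⟩)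
      map_add' := fun _ _ => rfl
      map_smul' := fun _ _ => rfl }
  refine FiniteDimensional.of_injective F fun U V hUV => Subtype.ext ?_
  funext n
  have h := congrFun hUV n
  exact Prod.ext (congrArg (fun p => (p.1 : VField 𝒯)) h) (congrArg (fun p => (p.2 : VField 𝒯)) h)

/-- A positive, continuous, 2-homogeneous function is bounded below by a multiple of `‖x‖²`. -/
lemma exists_pos_mul_norm_sq_le {E : Type*} [NormedAddCommGroup E] [NormedSpace ℝ E]
    [FiniteDimensional ℝ E] {q : E → ℝ} (hc : Continuous q)
    (hs : ∀ (s : ℝ) x, q (s • x) = s ^ 2 * q x) (hpos : ∀ x, x ≠ 0 → 0 < q x) :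
    ∃ c, 0 < c ∧ ∀ x, c * ‖x‖ ^ 2 ≤ q x := by
  have h0 : q 0 = 0 := by simpa using hs 0 0
  rcases (Metric.sphere (0 : E) 1).eq_empty_or_nonempty with he | hne
  · refine ⟨1, one_pos, fun x => ?_⟩
    by_cases hx : x = 0
    · simp [hx, h0]
    · have : ‖x‖⁻¹ • x ∈ Metric.sphere (0 : E) 1 := by
        simp [norm_smul, hx]
      rw [he] at this
      exact this.elim
  · obtain ⟨y, hy, hmin⟩ := (isCompact_sphere (0 : E) 1).exists_isMinOn hne hc.continuousOn
    have hy0 : y ≠ 0 := by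
      rintro rfl
      simp at hy
    refine ⟨q y, hpos y hy0, fun x => ?_⟩
    by_cases hx : x = 0
    · simp [hx, h0]
    · have hmem : ‖x‖⁻¹ • x ∈ Metric.sphere (0 : E) 1 := by
        simp [norm_smul, hx]
      have h1 : q y ≤ q (‖x‖⁻¹ • x) := hmin hmem
      have hn : 0 < ‖x‖ := norm_pos_iff.2 hx
      rw [hs, inv_pow, ← div_eq_inv_mul, le_div_iff₀ (by positivity)] at h1
      exact h1

/-- The sum of the squared traces of a discrete function of time. -/
def traceSq (τ : ℝ) (U : DG N (VField 𝒯)) : ℝ :=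
  ∑ j ∈ Finset.Iic (Fin.last N), (inner2 (plus U j) (plus U j) +
    inner2 (minusNext τ U j) (minusNext τ U j))

/-- An affine function on a slab is determined by its two end traces, so the traces define a norm on
the discrete functions of time. -/
lemma eq_zero_of_traceSq_le_zero (hτ : 0 < τ) {U : DG N (VField 𝒯)} (h : traceSq τ U ≤ 0) :
    U = 0 := by
  have hnn : ∀ j ∈ Finset.Iic (Fin.last N), 0 ≤ inner2 (plus U j) (plus U j) +
      inner2 (minusNext τ U j) (minusNext τ U j) := fun j _ =>
    add_nonneg (inner2_self_nonneg _) (inner2_self_nonneg _)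
  have h0 := (Finset.sum_eq_zero_iff_of_nonneg hnn).1 (le_antisymm h (Finset.sum_nonneg hnn))
  funext j
  have hj := h0 j (Finset.mem_Iic.2 (Fin.le_last j))
  have h1 := inner2_self_nonneg (plus U j)
  have h2 := inner2_self_nonneg (minusNext τ U j)
  have h3 : (U j).1 = 0 := eq_zero_of_inner2_self (u := plus U j) (by linarith)
  have h4 : (U j).1 + τ • (U j).2 = 0 := eq_zero_of_inner2_self (u := minusNext τ U j) (by linarith)
  rw [h3, zero_add, smul_eq_zero_iff_right hτ.ne'] at h4
  exact Prod.ext h3 h4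

/-- Existence of discrete solutions. -/
theorem exists_isSolution (hΩ : IsOpen Ω) (hv : volume Ω < ⊤) {k : ℕ} (S : FEPair 𝒯 k)
    (hν : 0 < ν) (hτ : 0 < τ) (hT : ((N : ℝ) + 1) * τ = T) (hδ : ∀ E, 0 ≤ δ E)
    (hδle : ∀ E, δ E ≤ diam E ^ 4 / (ν * gammaE (k + 2) E ^ 2))
    (hf : MemLp (fun z : ℝ × Plane => f z.1 z.2) 2
      ((volume.restrict (Set.Ioo 0 T)).prod (volume.restrict Ω)))
    (hκ : MemLp (fun z : ℝ × Plane => κ z.1 z.2) 2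
      ((volume.restrict (Set.Ioo 0 T)).prod (volume.restrict Ω))) (U₀ : VField 𝒯) :
    ∃ U : DG N (VField 𝒯), IsSolution S ν τ δ f κ U₀ U := by
  have hfin := finiteDimensional_kernelDG S N
  choose R hR using fun U : DG N (VField 𝒯) =>
    exists_residual_linear (ν := ν) (δ := δ) (U₀ := U₀) hτ.le hT hv hf hκ U
  let X := EuclideanSpace ℝ (Fin (Module.finrank ℝ (S.kernelDG N)))
  let e : X ≃ₗ[ℝ] S.kernelDG N := LinearEquiv.ofFinrankEq _ _ (by simp [X])
  let L : X →ₗ[ℝ] DG N (VField 𝒯) := (S.kernelDG N).subtype ∘ₗ e.toLinearMap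
  have hL : ∀ x, L x ∈ S.Zτ N := fun x => (e x).2
  have hLinj : ∀ x, L x = 0 → x = 0 := fun x hx =>
    e.map_eq_zero_iff.1 (Subtype.ext hx)
  let P : Fin (N + 1) → DG N (VField 𝒯) →ₗ[ℝ] VField 𝒯 × VField 𝒯 := fun j => LinearMap.proj j
  have hsep : SepDG fun x => L x := fun j =>
    ⟨Sep.linear (LinearMap.fst ℝ (VField 𝒯) (VField 𝒯) ∘ₗ P j ∘ₗ L),
      Sep.linear (LinearMap.snd ℝ (VField 𝒯) (VField 𝒯) ∘ₗ P j ∘ₗ L)⟩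
  -- Testing with all truncations at once makes every energy appear on the diagonal; the full-length
  -- test function alone would give only the last one, which does not absorb the load term.
  let M : X → X →ₗ[ℝ] ℝ := fun x => ∑ n, R (L x) ∘ₗ trunc n ∘ₗ L
  let b := EuclideanSpace.basisFun (Fin (Module.finrank ℝ (S.kernelDG N))) ℝ
  let G : X → X := fun x => WithLp.toLp 2 fun i => M x (b i)
  have hM : ∀ x y, M x y = ∑ n, residual ν τ δ f κ U₀ (L x) (trunc n (L y)) := fun x y => by
    simp only [M, LinearMap.sum_apply, LinearMap.comp_apply, hR]
  have hMb : ∀ x y : X, M x y = ∑ i, y i * M x (b i) := fun x y => by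
    conv_lhs => rw [← b.sum_repr y]
    simp [b]
  have hG : ContDiff ℝ 1 G := by
    rw [contDiff_euclidean]
    intro i
    change ContDiff ℝ 1 fun x => M x (b i)
    simp only [hM]
    refine ContDiff.sum fun n _ => ?_
    exact (contDiff_AStab ν τ δ _ hsep (SepDG.const _)).sub
      (contDiff_RStab hτ.le hT hv hf hκ δ _ U₀ hsep (SepDG.const _))
  have hinner : ∀ x, inner ℝ (G x) x = M x x := fun x => by
    rw [hMb x x, PiLp.inner_apply]
    refine Finset.sum_congr rfl fun i _ => ?_
    simp [G]
  obtain ⟨c, hc, hcle⟩ := exists_pos_mul_norm_sq_le (q := fun x : X => traceSq τ (L x))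
    (continuous_finsetSum _ fun j _ => by
      have h := (((hsep j).1.inner2 (hsep j).1).add
        ((hsep.minusNext τ j).inner2 (hsep.minusNext τ j))).contDiff 0
      exact h.continuous)
    (fun s x => by
      simp only [traceSq, map_smul, plus_smul, Finset.mul_sum]
      refine Finset.sum_congr rfl fun j _ => ?_
      have h : minusNext τ (s • L x) j = s • minusNext τ (L x) j := by
        simp only [minusNext, Pi.smul_apply, Prod.smul_fst, Prod.smul_snd, smul_add, smul_comm s]
      rw [h]
      simp only [inner2_smul_left, inner2_smul_right]
      ring)
    (fun x hx => by
      by_contra hle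
      exact hx (hLinj x (eq_zero_of_traceSq_le_zero hτ (not_lt.1 hle))))
  set K := (8 + 80 * T) * ∑ n : Fin (N + 1), dataTerm τ δ f κ U₀ n
  -- Summing over levels, the double sum of energies costs 1/32 of the total and 1/32 remains. The
  -- trace bound contributes a further factor 1/10, whence 320.
  have hlow : ∀ x, c / 320 * ‖x‖ ^ 2 - K ≤ M x x := by
    intro x
    have h1 := Finset.sum_le_sum fun (n : Fin (N + 1)) (_ : n ∈ Finset.univ) =>
      le_residual_trunc (U₀ := U₀) hΩ hv hν hτ hT hδ hδle hf hκ (hL x) n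
    rw [← hM x x, Finset.sum_sub_distrib, Finset.sum_sub_distrib, ← Finset.mul_sum,
      ← Finset.mul_sum, ← Finset.mul_sum] at h1
    have hE := fun n => normSq_nonneg hν hτ.le hδ n (L x)
    set E := ∑ n, normSq ν τ δ n (L x) (L x)
    have h2 : ∑ n : Fin (N + 1), ∑ j ∈ Finset.Iic n, normSq ν τ δ j (L x) (L x) ≤
        (N + 1) * E := by
      refine (Finset.sum_le_card_nsmul _ _ E fun n _ => Finset.sum_le_univ_sum_of_nonneg
        hE).trans_eq ?_
      simp
    have h3 : 1 / (32 * ((N : ℝ) + 1)) *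
        ∑ n : Fin (N + 1), ∑ j ∈ Finset.Iic n, normSq ν τ δ j (L x) (L x) ≤ 1 / 32 * E := by
      refine (mul_le_mul_of_nonneg_left h2 (by positivity)).trans_eq ?_
      have hN : (0 : ℝ) < N + 1 := by positivity
      field_simp
    have h4 := sum_inner2_traces_le hν hτ.le hδ (L x) (Fin.last N)
    have h5 : Finset.Iic (Fin.last N) = Finset.univ := by
      ext j; simp [Fin.le_last]
    have h6 := hcle x
    rw [traceSq] at h6
    have h7 : ∑ j ∈ Finset.Iic (Fin.last N), normSq ν τ δ j (L x) (L x) = E := by rw [h5]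
    rw [h7] at h4
    linarith
  -- The radius makes c r/320 exceed |K|; the added 1 ensures r ≥ 1, so that ‖x‖ ≥ r implies ‖x‖² ≥
  -- r.
  set r : ℝ := 320 * (|K| + 1) / c + 1
  have hr : 1 ≤ r := le_add_of_nonneg_left (by positivity)
  obtain ⟨x, hx⟩ := exists_zero_of_inner_pos hG (R := r) (by linarith) fun x hx => by
    rw [hinner]
    refine lt_of_lt_of_le ?_ (hlow x)
    have h1 : r ≤ ‖x‖ ^ 2 := by nlinarith
    have h2 : c / 320 * r = |K| + 1 + c / 320 := by
      simp only [r]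
      field_simp
    have h3 := mul_le_mul_of_nonneg_left h1 (show 0 ≤ c / 320 by positivity)
    have h4 := le_abs_self K
    have h5 : 0 < c / 320 := by positivity
    linarith
  refine ⟨L x, hL x, fun V hV => ?_⟩
  have hM0 : ∀ y, M x y = 0 := fun y => by
    rw [hMb]
    refine Finset.sum_eq_zero fun i _ => ?_
    have : M x (b i) = G x i := rfl
    rw [this, hx]
    simp
  -- Slab j survives in exactly the truncations with n ≥ j. Dividing V by this positive count slab
  -- by slab gives a W whose truncations sum to V.
  let a : Fin (N + 1) → ℝ := fun j => (Finset.univ.filter fun n : Fin (N + 1) => j ≤ n).card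
  have ha : ∀ j, a j ≠ 0 := fun j => by
    have : j ∈ Finset.univ.filter fun n : Fin (N + 1) => j ≤ n := by simp
    exact Nat.cast_ne_zero.2 (Finset.card_pos.2 ⟨j, this⟩).ne'
  let W : DG N (VField 𝒯) := fun j => (a j)⁻¹ • V j
  have hW : W ∈ S.kernelDG N := fun j =>
    ⟨S.kernel.smul_mem _ (hV j).1, S.kernel.smul_mem _ (hV j).2⟩
  have hsum : ∑ n, trunc n W = V := by
    funext j
    rw [Finset.sum_apply]
    simp only [trunc_apply]
    rw [← Finset.sum_filter, Finset.sum_const, ← Nat.cast_smul_eq_nsmul ℝ]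
    exact smul_inv_smul₀ (ha j) (V j)
  have h1 := hM0 (e.symm ⟨W, hW⟩)
  have h2 : L (e.symm ⟨W, hW⟩) = W := by simp [L]
  rw [hM, h2] at h1
  simp only [← hR] at h1
  rw [← map_sum, hsum, hR] at h1
  exact sub_eq_zero.1 h1

end Residual

end

end VortStab

theorem mainTheorem2 (Ω : Set VortStab.Plane) (hΩ : VortStab.IsPolygonalDomain Ω)
    (T : ℝ) (hT : 0 < T) (k : ℕ) (c₁ : ℝ) :
    ∃ C : ℝ, 0 < C ∧
      ∀ (𝒯 : VortStab.Triangulation Ω), 𝒯.ShapeRegular c₁ →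
      ∀ (S : VortStab.FEPair 𝒯 k) (N : ℕ) (τ : ℝ), τ = T / (N + 1) →
      ∀ (ν : ℝ), 0 < ν →
      ∀ (δ : 𝒯.Cell → ℝ), (∀ E, 0 ≤ δ E) →
        (∀ E, δ E ≤ VortStab.Triangulation.diam E ^ 4 / (ν * VortStab.gammaE (k + 2) E ^ 2)) →
      ∀ (f : ℝ → VortStab.Plane → VortStab.Plane) (curlf : ℝ → VortStab.Plane → ℝ),
        MemLp (fun z : ℝ × VortStab.Plane => f z.1 z.2) 2
          ((volume.restrict (Set.Ioo 0 T)).prod (volume.restrict Ω)) →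
        MemLp (fun z : ℝ × VortStab.Plane => curlf z.1 z.2) 2
          ((volume.restrict (Set.Ioo 0 T)).prod (volume.restrict Ω)) →
        (∀ᵐ t ∂(volume.restrict (Set.Ioo 0 T)), VortStab.IsWeakCurl Ω (f t) (curlf t)) →
      ∀ U₀ ∈ S.V,
        (∃ U : VortStab.DG N (VortStab.VField 𝒯),
          VortStab.IsSolution S ν τ δ f curlf U₀ U) ∧
        ∀ U : VortStab.DG N (VortStab.VField 𝒯),
          VortStab.IsSolution S ν τ δ f curlf U₀ U →
          ∀ n : Fin (N + 1),
            VortStab.normSq ν τ δ n U U ≤ C * VortStab.dataTerm τ δ f curlf U₀ n := by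
  have hv : volume Ω < ⊤ := hΩ.isBounded.measure_lt_top
  refine ⟨32 * (8 + 80 * T), by positivity, ?_⟩
  intro 𝒯 _ S N τ hτ ν hν δ hδ hδle f curlf hf hκ _ U₀ _
  have hτpos : 0 < τ := by rw [hτ]; positivity
  have hNτ : ((N : ℝ) + 1) * τ = T := by
    rw [hτ]
    field_simp
  exact ⟨VortStab.exists_isSolution hΩ.isOpen hv S hν hτpos hNτ hδ hδle hf hκ U₀,
    fun U hU n => VortStab.normSq_le_of_isSolution hΩ.isOpen hv hν hτpos hNτ hδ hδle hf hκ hU n⟩
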